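/- Let $G$ be a compact Lie group and $K\subset G$ a closed Lie subgroup such that $G/K$ is connected and effective (that is, $K$ contains no nontrivial normal subgroup of $G$), and suppose that $K$ is maximal in $G$: $K\ne G$ and every closed subgroup $H$ with $K\le H<G$, $H\neq G$, contains $K$ with finite index (for instance, $K$ is a maximal proper closed subgroup of $G$). Let $\mathfrak g=\mathfrak k\oplus\mathfrak p$ with $\mathfrak p$ an $\mathrm{Ad}(K)$-invariant complement orthogonal to $\mathfrak k$ for the Killing form $B$, and suppose that $\mathfrak p=\mathfrak p_1\oplus\mathfrak p_2$ with $\mathfrak p_1,\mathfrak p_2$ irreducible and inequivalent as representations of $K$. Fix an $\mathrm{Ad}(K)$-invariant scalar product $Q$ on $\mathfrak p$ with $-B|_{\mathfrak p_i}=b_i\,Q|_{\mathfrak p_i}$, $b_i>0$ ($i=1,2$). Identify the $G$-invariant Riemannian metrics on $G/K$ with the $\mathrm{Ad}(K)$-invariant scalar products $g=x_1\,Q|_{\mathfrak p_1}\oplus x_2\,Q|_{\mathfrak p_2}$ on $\mathfrak p$, $x_1,x_2>0$, and put $y=x_1/x_2$. Suppose that $G/K$ carries exactly three $G$-invariant Einstein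 metrics up to scaling: there are $0<y_1<y_2<y_3$ such that $g$ is Einstein if and only if $y\in\{y_1,y_2,y_3\}$. A homogeneous Ricci flow on an interval $I$ is a family $g(t)$, $t\in I$, of $G$-invariant metrics on $G/K$ with $\partial_t g=-2\,\mathrm{Ric}(g)$; write $y(t)=x_1(t)/x_2(t)$. A flow has a type I singularity at $T<\infty$ if $\sup_{[0,T)}|\mathrm{Rm}(g(t))|_{g(t)}=\infty$ and $\sup_{[0,T)}(T-t)|\mathrm{Rm}(g(t))|_{g(t)}<\infty$. It shrinks $G/K$ to a point as $t\to T$ if $g(t)\to0$, i.e. $x_1(t),x_2(t)\to0$. An ancient flow is one defined on some $(-\infty,T)$, $T<\infty$; it is of type I if $\lim_{t\to-\infty}|t|\,|\mathrm{Rm}(g(t))|_{g(t)}$ exists and is finite. Let $g_0$ be a $G$-invariant metric and $y(0)$ its ratio. 1. If $y(0)<y_1$, there are $0<T<\infty$ and a unique homogeneous Ricci flow with $g(0)=g_0$ on the maximal (forward) time interval $[0,T)$. It has a type I singularity at $T$, and as $t\to T$ it shrinks $G/K$ to a point and $y(t)\to y_1$. There is no ancient homogeneous Ricci flow, defined on some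 $(-\infty,T')$ with $0<T'<\infty$, whose value at time $0$ is $g_0$. 2. If $y_1<y(0)<y_2$, there are $0<T<\infty$ and a unique homogeneous Ricci flow with $g(0)=g_0$, whose maximal time interval is $(-\infty,T)$. It is a type I ancient solution with a type I singularity at $T$; as $t\to T$ it shrinks $G/K$ to a point and $y(t)\to y_1$, and $y(t)\to y_2$ as $t\to-\infty$. 3. If $y_2<y(0)<y_3$, there are $0<T<\infty$ and a unique homogeneous Ricci flow with $g(0)=g_0$, whose maximal time interval is $(-\infty,T)$. It is a type I ancient solution with a type I singularity at $T$; as $t\to T$ it shrinks $G/K$ to a point and $y(t)\to y_3$, and $y(t)\to y_2$ as $t\to-\infty$. 4. If $y(0)>y_3$, there are $0<T<\infty$ and a unique homogeneous Ricci flow with $g(0)=g_0$ on the maximal (forward) time interval $[0,T)$. It has a type I singularity at $T$, and as $t\to T$ it shrinks $G/K$ to a point and $y(t)\to y_3$. There is no ancient homogeneous Ricci flow, defined on some $(-\infty,T')$ with $0<T'<\infty$, whose value at time $0$ is $g_0$. -/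

import Mathlib

open Set Filter Topology
open scoped Manifold ContDiff

noncomputable section

/-! ### Invariant metrics on a reductive pair: connection, curvature, Ricci tensor

`L` is a real Lie algebra with a vector space decomposition `L = 𝔭 ⊕ 𝔨`. A scalar product `g` on
`𝔭`, the tangent space of `G/K` at the base point, which is invariant under the isotropy group,
is the same thing as a `G`-invariant Riemannian metric on `G/K`. Its Levi-Civita connection and
its curvature at the base point are given by the formulas below (`[ , ]_𝔭`, `[ , ]_𝔨` denote the
components of the bracket). -/

namespace Reductive

variable {L : Type*} [LieRing L] [LieAlgebra ℝ L] {𝔭 𝔨 : Submodule ℝ L}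

/-- `[X, Y]_𝔭`, the `𝔭`-component of the bracket of two elements of `𝔭`. -/
def bracketP (hc : IsCompl 𝔭 𝔨) : 𝔭 →ₗ[ℝ] 𝔭 →ₗ[ℝ] 𝔭 :=
  LinearMap.mk₂ ℝ (fun X Y => 𝔭.projectionOnto 𝔨 hc ⁅(X : L), (Y : L)⁆)
    (by intros; simp) (by intros; simp) (by intros; simp) (by intros; simp)

/-- `[X, Y]_𝔨`, the `𝔨`-component of the bracket of two elements of `𝔭`. -/
def bracketK (hc : IsCompl 𝔭 𝔨) (X Y : 𝔭) : 𝔨 :=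
  𝔨.projectionOnto 𝔭 hc.symm ⁅(X : L), (Y : L)⁆

/-- The linear form `Z ↦ ½ (g([X,Y]_𝔭, Z) + g([Z,X]_𝔭, Y) + g(X, [Z,Y]_𝔭))`. -/
def koszulForm (hc : IsCompl 𝔭 𝔨) (g : LinearMap.BilinForm ℝ 𝔭) (X Y : 𝔭) :
    Module.Dual ℝ 𝔭 :=
  (1 / 2 : ℝ) • (g (bracketP hc X Y) + (g.flip Y) ∘ₗ ((bracketP hc).flip X)
    + (g X) ∘ₗ ((bracketP hc).flip Y))

theorem koszulForm_apply (hc : IsCompl 𝔭 𝔨) (g : LinearMap.BilinForm ℝ 𝔭) (X Y Z : 𝔭) :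
    koszulForm hc g X Y Z = 1 / 2 * (g (bracketP hc X Y) Z + g (bracketP hc Z X) Y
      + g X (bracketP hc Z Y)) := by
  simp [koszulForm]
  ring

variable [FiniteDimensional ℝ L]

/-- The Levi-Civita connection `Λ(X)Y` of the invariant metric `g` at the base point:
`g(Λ(X)Y, Z) = ½ (g([X,Y]_𝔭, Z) + g([Z,X]_𝔭, Y) + g(X, [Z,Y]_𝔭))` for all `Z`. -/
def leviCivita (hc : IsCompl 𝔭 𝔨) (g : LinearMap.BilinForm ℝ 𝔭) (hg : g.Nondegenerate) :
    𝔭 →ₗ[ℝ] 𝔭 →ₗ[ℝ] 𝔭 :=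
  LinearMap.mk₂ ℝ (fun X Y => (g.toDual hg).symm (koszulForm hc g X Y))
    (by
      intro X X' Y
      rw [← map_add]; congr 1; ext Z
      simp only [koszulForm_apply, LinearMap.add_apply, map_add]; ring)
    (by
      intro c X Y
      rw [← map_smul]; congr 1; ext Z
      simp only [koszulForm_apply, LinearMap.smul_apply, map_smul, smul_eq_mul]; ring)
    (by
      intro X Y Y'
      rw [← map_add]; congr 1; ext Z
      simp only [koszulForm_apply, LinearMap.add_apply, map_add]; ring)
    (by
      intro c X Y
      rw [← map_smul]; congr 1; ext Z
      simp only [koszulForm_apply, LinearMap.smul_apply, map_smul, smul_eq_mul]; ring)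

/-- The curvature tensor at the base point:
`R(X,Y)Z = Λ(X)Λ(Y)Z - Λ(Y)Λ(X)Z - Λ([X,Y]_𝔭)Z - [[X,Y]_𝔨, Z]`.
The last bracket lies in `𝔭` when `𝔭` is invariant under the isotropy group. -/
def curvature (hc : IsCompl 𝔭 𝔨) (g : LinearMap.BilinForm ℝ 𝔭) (hg : g.Nondegenerate)
    (X Y Z : 𝔭) : 𝔭 :=
  leviCivita hc g hg X (leviCivita hc g hg Y Z) - leviCivita hc g hg Y (leviCivita hc g hg X Z)
    - leviCivita hc g hg (bracketP hc X Y) Z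
    - 𝔭.projectionOnto 𝔨 hc ⁅(bracketK hc X Y : L), (Z : L)⁆

/-- The endomorphism `Z ↦ R(Z,X)Y`. -/
def curvatureEnd (hc : IsCompl 𝔭 𝔨) (g : LinearMap.BilinForm ℝ 𝔭) (hg : g.Nondegenerate)
    (X Y : 𝔭) : 𝔭 →ₗ[ℝ] 𝔭 where
  toFun Z := curvature hc g hg Z X Y
  map_add' Z Z' := by
    simp only [curvature, bracketK, map_add, LinearMap.add_apply, Submodule.coe_add, add_lie]
    abel
  map_smul' c Z := by
    simp only [curvature, bracketK, map_smul, LinearMap.smul_apply, Submodule.coe_smul, smul_lie,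
      RingHom.id_apply, smul_sub]

/-- The Ricci tensor `Ric(X,Y) = tr (Z ↦ R(Z,X)Y)`. -/
def ricci (hc : IsCompl 𝔭 𝔨) (g : LinearMap.BilinForm ℝ 𝔭) (hg : g.Nondegenerate)
    (X Y : 𝔭) : ℝ :=
  LinearMap.trace ℝ 𝔭 (curvatureEnd hc g hg X Y)

end Reductive

/-! ### Lie groups, homogeneous spaces and their invariant metrics -/

section Homogeneous

variable {E : Type*} [NormedAddCommGroup E] [NormedSpace ℝ E]
  {G : Type*} [TopologicalSpace G] [ChartedSpace E G] [Group G]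
  {F : Type*} [NormedAddCommGroup F] [NormedSpace ℝ F]

instance instLieGroupMinSmoothness [LieGroup 𝓘(ℝ, E) ∞ G] :
    LieGroup 𝓘(ℝ, E) (minSmoothness ℝ 3) G := by
  rw [minSmoothness_of_isRCLikeNormedField]
  infer_instance

instance instFiniteDimensionalGroupLieAlgebra [FiniteDimensional ℝ E] :
    FiniteDimensional ℝ (GroupLieAlgebra 𝓘(ℝ, E) G) :=
  inferInstanceAs (FiniteDimensional ℝ E)

/-- The adjoint representation: the derivative at `1` of `z ↦ x z x⁻¹`. -/
def Ad (x : G) : GroupLieAlgebra 𝓘(ℝ, E) G →ₗ[ℝ] GroupLieAlgebra 𝓘(ℝ, E) G :=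
  (mfderiv 𝓘(ℝ, E) 𝓘(ℝ, E) (fun z : G => x * z * x⁻¹) 1).toLinearMap

/-- `K` is a closed Lie subgroup of `G`: it is closed, and the inclusion of the Lie group `K`
(with the subspace topology) in `G` is a smooth immersion. -/
structure IsClosedLieSubgroup (K : Subgroup G) [ChartedSpace F K] : Prop where
  isClosed : IsClosed (K : Set G)
  contMDiff : ContMDiff 𝓘(ℝ, F) 𝓘(ℝ, E) ∞ (Subtype.val : K → G)
  injective_mfderiv : ∀ k : K,
    Function.Injective (mfderiv 𝓘(ℝ, F) 𝓘(ℝ, E) (Subtype.val : K → G) k)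

/-- The Lie algebra of the Lie subgroup `K`, as a subspace of the Lie algebra of `G`. -/
def lieAlgebraOf (K : Subgroup G) [ChartedSpace F K] :
    Submodule ℝ (GroupLieAlgebra 𝓘(ℝ, E) G) :=
  LinearMap.range (mfderiv 𝓘(ℝ, F) 𝓘(ℝ, E) (Subtype.val : K → G) 1).toLinearMap

/-- `K` is maximal in `G`: there is no intermediate closed subgroup `K < H < G`, except possibly
finite extensions `H` of `K`. In particular this holds if `K` is a maximal proper closed
subgroup of `G`. -/
def IsMaximalIn (K : Subgroup G) : Prop :=
  K ≠ ⊤ ∧ ∀ H : Subgroup G, IsClosed (H : Set G) → K ≤ H → H ≠ ⊤ → K.relIndex H ≠ 0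

/-- `W` is an `Ad(K)`-invariant subspace of the Lie algebra of `G`. -/
def IsAdInvariant (K : Subgroup G) (W : Submodule ℝ (GroupLieAlgebra 𝓘(ℝ, E) G)) : Prop :=
  ∀ k ∈ K, ∀ X ∈ W, Ad k X ∈ W

/-- `W` is an irreducible `Ad(K)`-invariant subspace. -/
def IsAdIrreducible (K : Subgroup G) (W : Submodule ℝ (GroupLieAlgebra 𝓘(ℝ, E) G)) : Prop :=
  IsAdInvariant K W ∧ W ≠ ⊥ ∧ ∀ V ≤ W, IsAdInvariant K V → V = ⊥ ∨ V = W

/-- `V` and `W` are equivalent as representations of `K`. -/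
def AdEquivalent (K : Subgroup G) (V W : Submodule ℝ (GroupLieAlgebra 𝓘(ℝ, E) G)) : Prop :=
  ∃ φ : V ≃ₗ[ℝ] W, ∀ k ∈ K, ∀ X Y : V, Ad k (X : GroupLieAlgebra 𝓘(ℝ, E) G) = Y →
    Ad k (φ X : GroupLieAlgebra 𝓘(ℝ, E) G) = φ Y

variable [FiniteDimensional ℝ E] [LieGroup 𝓘(ℝ, E) ∞ G]

variable (E F) in
/-- An isotropy representation `𝔭` of `G/K`: an `Ad(K)`-invariant complement of `𝔨` in `𝔤`,
orthogonal to `𝔨` for the Killing form. -/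
structure IsotropyRep (K : Subgroup G) [ChartedSpace F K] where
  /-- the underlying subspace of `𝔤` -/
  𝔭 : Submodule ℝ (GroupLieAlgebra 𝓘(ℝ, E) G)
  isCompl : IsCompl 𝔭 (lieAlgebraOf (E := E) (F := F) K)
  invariant : IsAdInvariant K 𝔭
  orthogonal : ∀ X ∈ lieAlgebraOf (E := E) (F := F) K, ∀ Y ∈ 𝔭,
    killingForm ℝ (GroupLieAlgebra 𝓘(ℝ, E) G) X Y = 0

variable {K : Subgroup G} [ChartedSpace F K]

/-- A `G`-invariant Riemannian metric on `G/K`, i.e. an `Ad(K)`-invariant scalar product on the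
isotropy representation. -/
@[ext]
structure InvariantMetric (D : IsotropyRep E F K) where
  /-- the scalar product -/
  form : LinearMap.BilinForm ℝ D.𝔭
  symm : ∀ X Y, form X Y = form Y X
  pos : ∀ X, X ≠ 0 → 0 < form X X
  invariant : ∀ k (hk : k ∈ K) (X Y : D.𝔭),
    form ⟨Ad k X, D.invariant k hk X X.2⟩ ⟨Ad k Y, D.invariant k hk Y Y.2⟩ = form X Y

namespace InvariantMetric

variable {D : IsotropyRep E F K}

theorem nondegenerate (g : InvariantMetric D) : g.form.Nondegenerate := by
  refine ⟨fun X h => ?_, fun X h => ?_⟩ <;>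
  · by_contra hX
    exact (g.pos X hX).ne' (h X)

theorem exists_orthonormal_basis (g : InvariantMetric D) :
    ∃ e : Module.Basis (Fin (Module.finrank ℝ D.𝔭)) ℝ D.𝔭,
      ∀ i j, g.form (e i) (e j) = if i = j then 1 else 0 := by
  classical
  let c : InnerProductSpace.Core ℝ D.𝔭 :=
    { inner := fun X Y => g.form X Y
      conj_inner_symm := fun X Y => by simp [g.symm X Y]
      re_inner_nonneg := fun X => by
        by_cases h : X = 0
        · simp [h]
        · simpa using (g.pos X h).le
      add_left := fun X Y Z => by simp
      smul_left := fun X Y r => by simp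
      definite := fun X h => by
        by_contra hX
        exact (g.pos X hX).ne' h }
  let _ : NormedAddCommGroup D.𝔭 := @InnerProductSpace.Core.toNormedAddCommGroup ℝ D.𝔭 _ _ _ c
  let _ : InnerProductSpace ℝ D.𝔭 := InnerProductSpace.ofCore c.toCore
  refine ⟨(stdOrthonormalBasis ℝ D.𝔭).toBasis, fun i j => ?_⟩
  have := orthonormal_iff_ite.1 (stdOrthonormalBasis ℝ D.𝔭).orthonormal i j
  rw [OrthonormalBasis.coe_toBasis]
  exact this

/-- The Ricci tensor of an invariant metric, at the base point. -/
def ricci (g : InvariantMetric D) (X Y : D.𝔭) : ℝ :=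
  Reductive.ricci D.isCompl g.form g.nondegenerate X Y

/-- `|Rm(g)|_g`: the norm of the curvature tensor of an invariant metric, computed in a
`g`-orthonormal basis of the tangent space at the base point. By homogeneity it is the same at
all points of `G/K`. -/
def normRm (g : InvariantMetric D) : ℝ :=
  let e := g.exists_orthonormal_basis.choose
  √(∑ i, ∑ j, ∑ k, ∑ l,
    g.form (Reductive.curvature D.isCompl g.form g.nondegenerate (e i) (e j) (e k)) (e l) ^ 2)

/-- The invariant metric `g` is Einstein. -/
def IsEinstein (g : InvariantMetric D) : Prop :=
  ∃ c : ℝ, ∀ X Y, g.ricci X Y = c * g.form X Y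

/-- `g = x₁ Q|_{𝔭₁} ⊕ x₂ Q|_{𝔭₂}` with `x₁, x₂ > 0`. -/
def IsDiagonal (g Q : InvariantMetric D) (𝔭₁ 𝔭₂ : Submodule ℝ (GroupLieAlgebra 𝓘(ℝ, E) G))
    (x₁ x₂ : ℝ) : Prop :=
  0 < x₁ ∧ 0 < x₂ ∧
  (∀ X Y : D.𝔭, (X : GroupLieAlgebra 𝓘(ℝ, E) G) ∈ 𝔭₁ → (Y : GroupLieAlgebra 𝓘(ℝ, E) G) ∈ 𝔭₁ →
    g.form X Y = x₁ * Q.form X Y) ∧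
  (∀ X Y : D.𝔭, (X : GroupLieAlgebra 𝓘(ℝ, E) G) ∈ 𝔭₂ → (Y : GroupLieAlgebra 𝓘(ℝ, E) G) ∈ 𝔭₂ →
    g.form X Y = x₂ * Q.form X Y) ∧
  (∀ X Y : D.𝔭, (X : GroupLieAlgebra 𝓘(ℝ, E) G) ∈ 𝔭₁ → (Y : GroupLieAlgebra 𝓘(ℝ, E) G) ∈ 𝔭₂ →
    g.form X Y = 0)

/-- `Q` restricted to `V ⊆ 𝔭` is a negative multiple of the Killing form. -/
def IsNegKillingOn (Q : InvariantMetric D)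
    (V : Submodule ℝ (GroupLieAlgebra 𝓘(ℝ, E) G)) : Prop :=
  ∃ b : ℝ, 0 < b ∧ ∀ X Y : D.𝔭, (X : GroupLieAlgebra 𝓘(ℝ, E) G) ∈ V →
    (Y : GroupLieAlgebra 𝓘(ℝ, E) G) ∈ V →
    -killingForm ℝ (GroupLieAlgebra 𝓘(ℝ, E) G) X Y = b * Q.form X Y

end InvariantMetric

/-! ### The homogeneous Ricci flow -/

variable {D : IsotropyRep E F K}

/-- `g` is a homogeneous Ricci flow on the time interval `I`: `∂g/∂t = -2 Ric(g)` on `I`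
(one-sided derivatives at endpoints belonging to `I`). -/
def IsHRF (I : Set ℝ) (g : ℝ → InvariantMetric D) : Prop :=
  ∀ t ∈ I, ∀ X Y : D.𝔭,
    HasDerivWithinAt (fun s => (g s).form X Y) (-2 * (g t).ricci X Y) I t

/-- Among the homogeneous Ricci flows starting from `g₀` at time `0` and defined on an interval
`J ∋ 0` contained in `A`, the flow `g` is the unique maximal one, and its interval of
definition is `I`. -/
def IsUniqueMaximalHRF (A I : Set ℝ) (g₀ : InvariantMetric D) (g : ℝ → InvariantMetric D) :
    Prop :=
  I ⊆ A ∧ IsHRF I g ∧ g 0 = g₀ ∧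
  ∀ J ⊆ A, J.OrdConnected → (0 : ℝ) ∈ J → ∀ h : ℝ → InvariantMetric D,
    IsHRF J h → h 0 = g₀ → J ⊆ I ∧ EqOn h g J

/-- The flow `g` develops a type I singularity at the finite time `T`. -/
def IsTypeISingularity (g : ℝ → InvariantMetric D) (T : ℝ) : Prop :=
  ¬ BddAbove ((fun t => (g t).normRm) '' Ico 0 T) ∧
  BddAbove ((fun t => (T - t) * (g t).normRm) '' Ico 0 T)

/-- The whole space `(G/K, g(t))` shrinks to a point as `t → T`: `g(t) → 0`. -/
def ShrinksToPoint (g : ℝ → InvariantMetric D) (T : ℝ) : Prop :=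
  ∀ X Y : D.𝔭, Tendsto (fun t => (g t).form X Y) (𝓝[<] T) (𝓝 0)

/-- The ancient flow `g` is of type I: `lim_{t → -∞} |t| |Rm(g(t))|` is finite. -/
def IsTypeIAncient (g : ℝ → InvariantMetric D) : Prop :=
  ∃ l : ℝ, Tendsto (fun t => |t| * (g t).normRm) atBot (𝓝 l)

/-- There is an ancient homogeneous Ricci flow, defined on some `(-∞, T)` with `0 < T < ∞`, whose
value at time `0` is `g₀`. -/
def ExistsAncientHRF (g₀ : InvariantMetric D) : Prop :=
  ∃ (T : ℝ) (g : ℝ → InvariantMetric D), 0 < T ∧ IsHRF (Iio T) g ∧ g 0 = g₀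

/-- Along the flow `g = x₁ Q|_{𝔭₁} ⊕ x₂ Q|_{𝔭₂}` on the interval `I`, the ratio `y = x₁ / x₂`
tends to `y` along the filter `l`. -/
def RatioTendsto (Q : InvariantMetric D) (𝔭₁ 𝔭₂ : Submodule ℝ (GroupLieAlgebra 𝓘(ℝ, E) G))
    (I : Set ℝ) (g : ℝ → InvariantMetric D) (l : Filter ℝ) (y : ℝ) : Prop :=
  ∃ x₁ x₂ : ℝ → ℝ, (∀ t ∈ I, (g t).IsDiagonal Q 𝔭₁ 𝔭₂ (x₁ t) (x₂ t)) ∧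
    Tendsto (fun t => x₁ t / x₂ t) l (𝓝 y)

end Homogeneous

end

/-! By Schur's lemma every invariant metric is x₁Q ⊕ x₂Q, and its Ricci tensor is ρ₁(y)Q ⊕ ρ₂(y)Q
with y = x₁/x₂, so the flow is the planar system xᵢ' = -2ρᵢ(y). Tracing the Ricci tensor over each
summand in a Killing-orthonormal basis gives ρ₁ = a₁ - m₁/y + n₁y² and ρ₂ = a₂ - n₂y + m₂/y²
(`IsTwoSummand.exists_ricciCoeffs`). Here m₁, m₂ are positive multiples of the sum of squared
structure constants of type (1,1,2), and n₁, n₂ of type (1,2,2). The Killing form of a compact group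
is negative semidefinite, which yields aᵢ ≥ 0 and m₁n₂ ≤ a₁a₂.

A metric is Einstein exactly when gap(y) = ρ₁ - yρ₂ vanishes, and y·gap(y) is a cubic. Having y₁ <
y₂ < y₃ as its only positive roots, it equals n(y-y₁)(y-y₂)(y-y₃) with n = n₁ + n₂ > 0. All mᵢ, nᵢ
are then positive, and m₁n₂ ≤ a₁a₂ gives ρ₂ > 0 at the three roots
(`RicciCoeffs.IsAdmissible.isGeneric`).

Since y' = -2 gap(y)/x₂, the ratio is monotone between roots and can replace time as parameter:
d(log x₂)/dy = ρ₂/gap and dt/dy = -x₂/(2 gap). Partial fractions give x₂ = const·y^A₀ ∏|y-yᵢ|^Aᵢ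
with A₀ > -1, A₁, A₃ > 0 and A₂ < 0 (`RicciCoeffs.IsGeneric.exists_rho₂_div_gap`). These signs
decide everything. At y₁ and y₃, x₂ tends to 0 and, as ρ₂ has a positive limit there, it does so in
finite time at a linear rate. At y₂, x₂ tends to ∞, which is reached only as t → -∞, again at a
linear rate. As y → 0, dt/dy → 0, so the backward flow lives for finite time only and is not
ancient. Every solution with the given initial value follows the same explicit curve, whence
uniqueness and maximality (`RicciCoeffs.IsProfile.eq_of_isFlow`).

It suffices to treat (0, y₁) and (y₂, y₃): exchanging the summands inverts y and yields the other
two ranges. Finally |Rm| = Φ(y)/x₂ with Φ continuous, and positive at y₁ and y₃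
(`IsTwoSummand.exists_normRm_eq`, `IsTwoSummand.curvatureNorm_pos`), which turns the linear rates
into the type I statements. -/

noncomputable section

/-! ### The adjoint representation acts by Lie algebra automorphisms. -/

section AdjointRepresentation

open VectorField

variable {E : Type*} [NormedAddCommGroup E] [NormedSpace ℝ E]
  {G : Type*} [TopologicalSpace G] [ChartedSpace E G] [Group G]
  [LieGroup 𝓘(ℝ, E) ∞ G]

theorem contMDiff_conj (x : G) :
    ContMDiff 𝓘(ℝ, E) 𝓘(ℝ, E) ∞ (fun z : G => x * z * x⁻¹) :=
  (contMDiff_mul_right (I := 𝓘(ℝ, E)) (n := ∞) (a := x⁻¹)).comp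
    (contMDiff_mul_left (I := 𝓘(ℝ, E)) (n := ∞) (a := x))

theorem mdifferentiableAt_conj (x z : G) :
    MDifferentiableAt 𝓘(ℝ, E) 𝓘(ℝ, E) (fun z : G => x * z * x⁻¹) z :=
  (contMDiff_conj x).mdifferentiable (by simp) z

theorem mdifferentiableAt_mul_left' (x z : G) :
    MDifferentiableAt 𝓘(ℝ, E) 𝓘(ℝ, E) (fun z : G => x * z) z :=
  (contMDiff_mul_left (I := 𝓘(ℝ, E)) (n := ∞) (a := x)).mdifferentiable (by simp) z

omit [LieGroup 𝓘(ℝ, E) ∞ G] in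
theorem Ad_one : Ad (E := E) (1 : G) = LinearMap.id := by
  ext v
  have h1 : (fun z : G => 1 * z * (1 : G)⁻¹) = id := by ext z; simp
  -- The type of `mfderiv` depends on the map and the base point, so here and below equalities of
  -- these are transported by substitution, on vectors of the model space.
  have key : ∀ f : G → G, f = id → ∀ w : E,
      (mfderiv 𝓘(ℝ, E) 𝓘(ℝ, E) f 1 : E → E) w = w := by
    rintro f rfl w
    rw [mfderiv_id]
    rfl
  exact key _ h1 v

theorem Ad_mul (x y : G) : Ad (E := E) (x * y) = Ad x ∘ₗ Ad y := by
  ext v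
  have h1 : (fun z : G => (x * y) * z * (x * y)⁻¹) =
      (fun z : G => x * z * x⁻¹) ∘ (fun z : G => y * z * y⁻¹) := by
    ext z; simp [mul_assoc]
  have h2 := mfderiv_comp (1 : G) (mdifferentiableAt_conj (E := E) x (y * 1 * y⁻¹))
    (mdifferentiableAt_conj (E := E) y 1)
  have key : ∀ (f f' : G → G) (g g' : G), f = f' → g = g' → ∀ w : E,
      (mfderiv 𝓘(ℝ, E) 𝓘(ℝ, E) f g : E → E) w = (mfderiv 𝓘(ℝ, E) 𝓘(ℝ, E) f' g' : E → E) w := by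
    rintro f _ g _ rfl rfl w; rfl
  exact (key _ _ _ _ h1 rfl v).trans ((DFunLike.congr_fun h2 v).trans
    (key _ _ (y * 1 * y⁻¹) _ rfl (by simp) _))

theorem Ad_inv_Ad (x : G) (v : GroupLieAlgebra 𝓘(ℝ, E) G) : Ad x⁻¹ (Ad x v) = v := by
  have := LinearMap.congr_fun (Ad_mul (E := E) x⁻¹ x) v
  simpa [Ad_one] using this.symm

theorem Ad_Ad_inv (x : G) (v : GroupLieAlgebra 𝓘(ℝ, E) G) : Ad x (Ad x⁻¹ v) = v := by
  simpa using Ad_inv_Ad x⁻¹ v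

/-- Chain rule for conj_x ∘ L_h = L_{xhx⁻¹} ∘ conj_x: conjugation carries left-invariant fields to
left-invariant fields. -/
theorem mfderiv_conj_mulInvariantVectorField (x h : G) (w : GroupLieAlgebra 𝓘(ℝ, E) G) :
    mfderiv 𝓘(ℝ, E) 𝓘(ℝ, E) (fun z : G => x * z * x⁻¹) h (mulInvariantVectorField w h) =
      mulInvariantVectorField (Ad x w) (x * h * x⁻¹) := by
  have h1 : (fun z : G => x * z * x⁻¹) ∘ (fun z : G => h * z) =
      (fun z : G => x * h * x⁻¹ * z) ∘ (fun z : G => x * z * x⁻¹) := by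
    ext z; simp [mul_assoc]
  have e1 := mfderiv_comp (1 : G) (mdifferentiableAt_conj (E := E) x (h * 1))
    (mdifferentiableAt_mul_left' (E := E) h 1)
  have e2 := mfderiv_comp (1 : G) (mdifferentiableAt_mul_left' (E := E) (x * h * x⁻¹) (x * 1 * x⁻¹))
    (mdifferentiableAt_conj (E := E) x 1)
  have key : ∀ (f : G → G) (g g' : G), g = g' → ∀ w : E,
      (mfderiv 𝓘(ℝ, E) 𝓘(ℝ, E) f g : E → E) w = (mfderiv 𝓘(ℝ, E) 𝓘(ℝ, E) f g' : E → E) w := by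
    rintro f g _ rfl w; rfl
  have e3 : ∀ v : E, (mfderiv 𝓘(ℝ, E) 𝓘(ℝ, E)
      ((fun z : G => x * z * x⁻¹) ∘ (fun z : G => h * z)) 1 : E → E) v =
      (mfderiv 𝓘(ℝ, E) 𝓘(ℝ, E)
      ((fun z : G => x * h * x⁻¹ * z) ∘ (fun z : G => x * z * x⁻¹)) 1 : E → E) v := by
    rw [h1]; intro v; rfl
  have e4 := e3 w
  rw [e1, e2] at e4
  exact (key _ _ _ (mul_one h).symm _).trans (e4.trans (key _ _ _ (by simp) _))

theorem mfderiv_conj_isInvertible (x h : G) :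
    (mfderiv 𝓘(ℝ, E) 𝓘(ℝ, E) (fun z : G => x * z * x⁻¹) h).IsInvertible := by
  have aux : ∀ (x h : G), ∀ v : E,
      (mfderiv 𝓘(ℝ, E) 𝓘(ℝ, E) (fun z : G => x⁻¹ * z * x⁻¹⁻¹) (x * h * x⁻¹) : E → E)
      ((mfderiv 𝓘(ℝ, E) 𝓘(ℝ, E) (fun z : G => x * z * x⁻¹) h : E → E) v) = v := by
    intro x h v
    have e := mfderiv_comp h (mdifferentiableAt_conj (E := E) x⁻¹ (x * h * x⁻¹))
      (mdifferentiableAt_conj (E := E) x h)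
    have h1 : (fun z : G => x⁻¹ * z * x⁻¹⁻¹) ∘ (fun z : G => x * z * x⁻¹) = id := by
      ext z; simp [mul_assoc]
    have e' := DFunLike.congr_fun e v
    have e2 : (mfderiv 𝓘(ℝ, E) 𝓘(ℝ, E)
      ((fun z : G => x⁻¹ * z * x⁻¹⁻¹) ∘ (fun z : G => x * z * x⁻¹)) h : E → E) v = v := by
      rw [h1, mfderiv_id]; rfl
    exact e'.symm.trans e2
  have key : ∀ (f : G → G) (g g' : G), g = g' → ∀ w : E,
      (mfderiv 𝓘(ℝ, E) 𝓘(ℝ, E) f g : E → E) w = (mfderiv 𝓘(ℝ, E) 𝓘(ℝ, E) f g' : E → E) w := by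
    rintro f g _ rfl w; rfl
  refine ⟨ContinuousLinearEquiv.equivOfInverse
    (mfderiv 𝓘(ℝ, E) 𝓘(ℝ, E) (fun z : G => x * z * x⁻¹) h)
    (mfderiv 𝓘(ℝ, E) 𝓘(ℝ, E) (fun z : G => x⁻¹ * z * x⁻¹⁻¹) (x * h * x⁻¹)) (aux x h) ?_, rfl⟩
  intro v
  have := aux x⁻¹ (x * h * x⁻¹) v
  have hx : (fun z : G => x⁻¹⁻¹ * z * x⁻¹⁻¹⁻¹) = (fun z : G => x * z * x⁻¹) := by simp
  rw [hx] at this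
  have hh : h = x⁻¹ * (x * h * x⁻¹) * x⁻¹⁻¹ := by simp [mul_assoc]
  exact (key _ _ _ hh _).trans this

variable [FiniteDimensional ℝ E]

/-- Pullback along the diffeomorphism conj_x commutes with brackets of vector fields, and takes the
left-invariant field of Ad x u to that of u. -/
theorem Ad_lie (x : G) (v w : GroupLieAlgebra 𝓘(ℝ, E) G) : Ad x ⁅v, w⁆ = ⁅Ad x v, Ad x w⁆ := by
  have : CompleteSpace E := FiniteDimensional.complete ℝ E
  have hp : ∀ u : GroupLieAlgebra 𝓘(ℝ, E) G,
      mpullback 𝓘(ℝ, E) 𝓘(ℝ, E) (fun z : G => x * z * x⁻¹) (mulInvariantVectorField (Ad x u)) =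
      mulInvariantVectorField u := by
    intro u
    ext h
    rw [mpullback_apply, ← mfderiv_conj_mulInvariantVectorField]
    exact (mfderiv_conj_isInvertible x h).inverse_apply_self _
  have h := mpullback_mlieBracket (x₀ := (1 : G)) (f := fun z : G => x * z * x⁻¹)
    (mdifferentiableAt_mulInvariantVectorField (I := 𝓘(ℝ, E)) (Ad x v))
    (mdifferentiableAt_mulInvariantVectorField (I := 𝓘(ℝ, E)) (Ad x w))
    (n := ∞) (contMDiff_conj (E := E) x 1)
    (by rw [minSmoothness_of_isRCLikeNormedField]; exact WithTop.coe_le_coe.2 (le_top : (2 : ℕ∞) ≤ ⊤))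
  rw [hp, hp, mpullback_apply] at h
  have key : ∀ (V W : (g : G) → TangentSpace 𝓘(ℝ, E) g) (g : G), g = 1 →
      (mlieBracket 𝓘(ℝ, E) V W g : E) = mlieBracket 𝓘(ℝ, E) V W 1 := by
    rintro V W g rfl; rfl
  rw [GroupLieAlgebra.bracket_def, GroupLieAlgebra.bracket_def, ← h]
  refine Eq.trans ?_ (key _ _ (x * 1 * x⁻¹) (by simp))
  exact (mfderiv_conj_isInvertible x 1).self_apply_inverse _

end AdjointRepresentation

/-! ### Derivatives as maps of model spaces, with no base point in the type. -/

section ModelDerivative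

variable {E : Type*} [NormedAddCommGroup E] [NormedSpace ℝ E]
  {E' : Type*} [NormedAddCommGroup E'] [NormedSpace ℝ E']
  {E'' : Type*} [NormedAddCommGroup E''] [NormedSpace ℝ E'']
  {M : Type*} [TopologicalSpace M] [ChartedSpace E M]
  {M' : Type*} [TopologicalSpace M'] [ChartedSpace E' M']
  {M'' : Type*} [TopologicalSpace M''] [ChartedSpace E'' M'']

/-- The derivative of a map of manifolds modelled on `E` and `E'`, as a linear map `E → E'`. -/
def modelDeriv (f : M → M') (x : M) : E →L[ℝ] E' := mfderiv 𝓘(ℝ, E) 𝓘(ℝ, E') f x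

theorem modelDeriv_comp_apply {g : M' → M''} {f : M → M'} {x : M}
    (hg : MDifferentiableAt 𝓘(ℝ, E') 𝓘(ℝ, E'') g (f x))
    (hf : MDifferentiableAt 𝓘(ℝ, E) 𝓘(ℝ, E') f x) (v : E) :
    (modelDeriv (g ∘ f) x : E →L[ℝ] E'') v =
      (modelDeriv g (f x) : E' →L[ℝ] E'') ((modelDeriv f x : E →L[ℝ] E') v) :=
  DFunLike.congr_fun (mfderiv_comp x hg hf) v

theorem modelDeriv_congr {f g : M → M'} {x : M} (h : f =ᶠ[𝓝 x] g) :
    (modelDeriv f x : E →L[ℝ] E') = modelDeriv g x :=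
  h.mfderiv_eq

theorem modelDeriv_eq_fderiv (f : E → E') (x : E) :
    (modelDeriv f x : E →L[ℝ] E') = fderiv ℝ f x :=
  mfderiv_eq_fderiv

theorem modelDeriv_extChartAt_self [IsManifold 𝓘(ℝ, E) ∞ M] (x : M) (v : E) :
    (modelDeriv (extChartAt 𝓘(ℝ, E) x) x : E →L[ℝ] E) v = v := by
  have : IsManifold 𝓘(ℝ, E) 1 M := IsManifold.of_le (n := ∞) (by exact_mod_cast le_top)
  exact DFunLike.congr_fun (mfderiv_extChartAt_self (I := 𝓘(ℝ, E)) (x := x)) v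

end ModelDerivative

/-! ### The group law and the left-invariant fields in a chart at the identity. -/

section AdjointDerivative

open VectorField

variable {E : Type*} [NormedAddCommGroup E] [NormedSpace ℝ E]
  {G : Type*} [TopologicalSpace G] [ChartedSpace E G] [Group G]

variable (E G) in
/-- The product of a Lie group in the preferred chart at the identity. -/
def chartMul (p : E × E) : E :=
  extChartAt 𝓘(ℝ, E) (1 : G)
    ((extChartAt 𝓘(ℝ, E) (1 : G)).symm p.1 * (extChartAt 𝓘(ℝ, E) (1 : G)).symm p.2)

local notation "φ" => extChartAt 𝓘(ℝ, E) (1 : G)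

theorem eventually_nhds_chart_one {P : E → E → Prop}
    (h : ∀ᶠ p in 𝓝 (φ 1, φ 1), P p.1 p.2) :
    (∀ᶠ y in 𝓝 (φ 1), P y (φ 1)) ∧ (∀ᶠ y in 𝓝 (φ 1), P (φ 1) y) := by
  constructor
  · have : Tendsto (fun y : E => (y, φ 1)) (𝓝 (φ 1)) (𝓝 (φ 1, φ 1)) := by
      apply Continuous.tendsto' <;> first | fun_prop | rfl
    exact this.eventually h
  · have : Tendsto (fun y : E => (φ 1, y)) (𝓝 (φ 1)) (𝓝 (φ 1, φ 1)) := by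
      apply Continuous.tendsto' <;> first | fun_prop | rfl
    exact this.eventually h

variable [LieGroup 𝓘(ℝ, E) ∞ G]

theorem contDiffAt_chartMul :
    ContDiffAt ℝ ∞ (chartMul E G) (φ 1, φ 1) := by
  rw [← contMDiffAt_iff_contDiffAt]
  have hs : ContMDiffAt 𝓘(ℝ, E) 𝓘(ℝ, E) ∞ (φ).symm (φ 1) :=
    (contMDiffOn_extChartAt_symm (1 : G)).contMDiffAt (extChartAt_target_mem_nhds (1 : G))
  have h1 : ContMDiffAt 𝓘(ℝ, E × E) 𝓘(ℝ, E) ∞ (fun p : E × E => (φ).symm p.1) (φ 1, φ 1) :=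
    ContMDiffAt.comp (φ 1, φ 1) (f := Prod.fst) hs contDiff_fst.contMDiff.contMDiffAt
  have h2 : ContMDiffAt 𝓘(ℝ, E × E) 𝓘(ℝ, E) ∞ (fun p : E × E => (φ).symm p.2) (φ 1, φ 1) :=
    ContMDiffAt.comp (φ 1, φ 1) (f := Prod.snd) hs contDiff_snd.contMDiff.contMDiffAt
  have h3 := h1.mul h2
  refine ContMDiffAt.comp (φ 1, φ 1) (g := φ) ?_ h3
  refine contMDiffAt_extChartAt' ?_
  simp

theorem eventually_differentiableAt_chartMul :
    ∀ᶠ p in 𝓝 (φ 1, φ 1), DifferentiableAt ℝ (chartMul E G) (p.1, p.2) := by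
  have h := ((contDiffAt_chartMul (E := E) (G := G)).of_le (m := 1)
    (by exact_mod_cast le_top)).eventually (by simp)
  filter_upwards [h] with p hp
  exact hp.differentiableAt (by simp)

theorem mdifferentiableAt_chart {g : G} (hg : g ∈ (chartAt E (1 : G)).source) :
    MDifferentiableAt 𝓘(ℝ, E) 𝓘(ℝ, E) (φ) g :=
  (contMDiffAt_extChartAt' (n := ∞) hg).mdifferentiableAt (by simp)

/-- Differentiate φ(gz) = m(y, φ(z)) at z = 1, where y = φ(g) and m is the product in the chart:
this is the left-invariant field in coordinates. -/
theorem fderiv_chartMul_snd :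
    ∀ᶠ y in 𝓝 (φ 1), ∀ v : GroupLieAlgebra 𝓘(ℝ, E) G,
      (modelDeriv (φ) ((φ).symm y) : E →L[ℝ] E) (mulInvariantVectorField v ((φ).symm y)) =
        fderiv ℝ (chartMul E G) (y, φ 1) ((0 : E), (v : E)) := by
  filter_upwards [extChartAt_target_mem_nhds (I := 𝓘(ℝ, E)) (1 : G),
    (eventually_nhds_chart_one (P := fun y z => DifferentiableAt ℝ (chartMul E G) (y, z))
      eventually_differentiableAt_chartMul).1] with y hy hd v
  set g := (φ).symm y with hg
  have hgs : g ∈ (chartAt E (1 : G)).source := by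
    rw [hg]
    simpa using (φ).map_target hy
  have e1 : (modelDeriv (φ ∘ fun z => g * z) 1 : E →L[ℝ] E) =
      modelDeriv ((fun z => chartMul E G (y, z)) ∘ φ) 1 := by
    apply modelDeriv_congr
    filter_upwards [extChartAt_source_mem_nhds (I := 𝓘(ℝ, E)) (1 : G)] with z hz
    simp only [Function.comp, chartMul]
    rw [(φ).left_inv hz]
  have d2 : HasFDerivAt (fun z => chartMul E G (y, z))
      ((fderiv ℝ (chartMul E G) (y, φ 1)).comp (ContinuousLinearMap.inr ℝ E E)) (φ 1) :=
    hd.hasFDerivAt.comp (φ 1) (hasFDerivAt_prodMk_right y (φ 1))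
  have e2 := modelDeriv_comp_apply (x := (1 : G)) (f := fun z => g * z) (g := φ)
    (mdifferentiableAt_chart (by simpa using hgs)) (mdifferentiableAt_mul_left' g 1) v
  have e3 := modelDeriv_comp_apply (x := (1 : G)) (f := φ) (g := fun z => chartMul E G (y, z))
    d2.differentiableAt.mdifferentiableAt (mdifferentiableAt_chart (mem_chart_source E 1)) v
  have e0 := modelDeriv_extChartAt_self (E := E) (1 : G) v
  rw [← e1, e2, mul_one, modelDeriv_eq_fderiv, d2.fderiv] at e3
  refine e3.trans ?_
  simp only [ContinuousLinearMap.comp_apply, ContinuousLinearMap.inr_apply]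
  exact congrArg (fun u : E => fderiv ℝ (chartMul E G) (y, φ 1) (0, u)) e0

/-- The same field computed from gz = (gzg⁻¹)g. Comparison with `fderiv_chartMul_snd` expresses Ad
through the two partial derivatives of the product. -/
theorem fderiv_chartMul_fst :
    ∀ᶠ y in 𝓝 (φ 1), ∀ v : GroupLieAlgebra 𝓘(ℝ, E) G,
      (modelDeriv (φ) ((φ).symm y) : E →L[ℝ] E) (mulInvariantVectorField v ((φ).symm y)) =
        fderiv ℝ (chartMul E G) (φ 1, y) (Ad ((φ).symm y) v, (0 : E)) := by
  filter_upwards [extChartAt_target_mem_nhds (I := 𝓘(ℝ, E)) (1 : G),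
    (eventually_nhds_chart_one (P := fun y z => DifferentiableAt ℝ (chartMul E G) (y, z))
      eventually_differentiableAt_chartMul).2] with y hy hd v
  set g := (φ).symm y with hg
  have hgs : g ∈ (chartAt E (1 : G)).source := by
    rw [hg]
    simpa using (φ).map_target hy
  have hconj : Tendsto (fun z => g * z * g⁻¹) (𝓝 1) (𝓝 (1 : G)) := by
    have := (contMDiff_conj (E := E) g).continuous.tendsto 1
    simpa using this
  have e1 : (modelDeriv (φ ∘ fun z => g * z) 1 : E →L[ℝ] E) =
      modelDeriv (((fun z => chartMul E G (z, y)) ∘ φ) ∘ fun z => g * z * g⁻¹) 1 := by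
    apply modelDeriv_congr
    filter_upwards [hconj (extChartAt_source_mem_nhds (I := 𝓘(ℝ, E)) (1 : G))] with z hz
    simp only [Function.comp, chartMul]
    rw [(φ).left_inv hz, ← hg]
    simp
  have d2 : HasFDerivAt (fun z => chartMul E G (z, y))
      ((fderiv ℝ (chartMul E G) (φ 1, y)).comp (ContinuousLinearMap.inl ℝ E E)) (φ 1) :=
    HasFDerivAt.comp (g := chartMul E G) (f := fun z => (z, y)) (φ 1) hd.hasFDerivAt
      (hasFDerivAt_prodMk_left (φ 1) y)
  have e2 := modelDeriv_comp_apply (x := (1 : G)) (f := fun z => g * z) (g := φ)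
    (mdifferentiableAt_chart (by simpa using hgs)) (mdifferentiableAt_mul_left' g 1) v
  have c1 : g * 1 * g⁻¹ = 1 := by simp
  have m1 : MDifferentiableAt 𝓘(ℝ, E) 𝓘(ℝ, E) (φ) (g * 1 * g⁻¹) :=
    mdifferentiableAt_chart (by rw [c1]; exact mem_chart_source E 1)
  have m2 : MDifferentiableAt 𝓘(ℝ, E) 𝓘(ℝ, E) (fun z => chartMul E G (z, y))
      ((φ) (g * 1 * g⁻¹)) := by
    rw [c1]
    exact d2.differentiableAt.mdifferentiableAt
  have e3 := modelDeriv_comp_apply (x := (1 : G)) (f := fun z => g * z * g⁻¹)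
    (g := (fun z => chartMul E G (z, y)) ∘ φ) (m2.comp _ m1) (mdifferentiableAt_conj g 1) v
  rw [modelDeriv_comp_apply m2 m1, c1, modelDeriv_eq_fderiv, d2.fderiv, ← e1, e2, mul_one] at e3
  refine e3.trans ?_
  simp only [ContinuousLinearMap.comp_apply, ContinuousLinearMap.inl_apply]
  exact congrArg (fun u : E => fderiv ℝ (chartMul E G) (φ 1, y) (u, 0))
    (modelDeriv_extChartAt_self (E := E) (1 : G) _)

theorem lie_eq_lieBracket_chart (v w : GroupLieAlgebra 𝓘(ℝ, E) G) :
    ⁅v, w⁆ = lieBracket ℝ (fun y => fderiv ℝ (chartMul E G) (y, φ 1) ((0 : E), (v : E)))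
      (fun y => fderiv ℝ (chartMul E G) (y, φ 1) ((0 : E), (w : E))) (φ 1) := by
  have : IsManifold 𝓘(ℝ, E) 1 G := IsManifold.of_le (n := ∞) (by exact_mod_cast le_top)
  have hV : ∀ u : E, mpullbackWithin 𝓘(ℝ, E) 𝓘(ℝ, E) (φ).symm
      (mulInvariantVectorField (I := 𝓘(ℝ, E)) (G := G) u) (range 𝓘(ℝ, E)) =ᶠ[𝓝 (φ 1)]
      fun y => fderiv ℝ (chartMul E G) (y, φ 1) (0, u) := by
    intro u
    filter_upwards [fderiv_chartMul_snd (E := E) (G := G),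
      extChartAt_target_mem_nhds (I := 𝓘(ℝ, E)) (1 : G)] with y hy hyt
    rw [← hy u, mpullbackWithin_apply]
    have h1 := mfderiv_extChartAt_comp_mfderivWithin_extChartAt_symm (I := 𝓘(ℝ, E)) hyt
    have h2 := isInvertible_mfderivWithin_extChartAt_symm (I := 𝓘(ℝ, E)) hyt
    have h3 := DFunLike.congr_fun h1 ((mfderivWithin 𝓘(ℝ, E) 𝓘(ℝ, E) (φ).symm
      (range 𝓘(ℝ, E)) y).inverse (mulInvariantVectorField u ((φ).symm y)))
    refine Eq.trans h3.symm ?_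
    have h4 := h2.self_apply_inverse (mulInvariantVectorField u ((φ).symm y))
    exact congrArg (modelDeriv (φ) ((φ).symm y) : E →L[ℝ] E) h4
  have inv : ∀ u : E, (ContinuousLinearMap.id ℝ E).inverse u = u := by simp
  rw [GroupLieAlgebra.bracket_def, ← mlieBracketWithin_univ, mlieBracketWithin_apply,
    mfderiv_extChartAt_self]
  refine (inv _).trans ?_
  simp only [preimage_univ, univ_inter]
  have h6 : ∀ V W : E → E, lieBracketWithin ℝ V W univ (φ 1) = lieBracket ℝ V W (φ 1) :=
    fun V W => by rw [lieBracketWithin_univ]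
  have h5 := Filter.EventuallyEq.lieBracket_vectorField_eq (𝕜 := ℝ) (hV v) (hV w)
  rw [← h5]
  simp only [modelWithCornersSelf_coe, range_id]
  exact h6 _ _

end AdjointDerivative

/-! ### The derivative of Ad is the bracket; continuity of Ad. -/

section AdjointContinuity

open VectorField

variable {E : Type*} [NormedAddCommGroup E] [NormedSpace ℝ E]
  {G : Type*} [TopologicalSpace G] [ChartedSpace E G] [Group G]
  [LieGroup 𝓘(ℝ, E) ∞ G]

local notation "φ" => extChartAt 𝓘(ℝ, E) (1 : G)

variable (E) in
/-- The adjoint representation, as a map of the model space. -/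
def modelAd (g : G) : E →L[ℝ] E := modelDeriv (fun z : G => g * z * g⁻¹) 1

variable (G) in
/-- The bracket of the Lie algebra of a Lie group, as an operation on the model space. -/
def modelLie (v w : E) : E :=
  Bracket.bracket (L := GroupLieAlgebra 𝓘(ℝ, E) G) (M := GroupLieAlgebra 𝓘(ℝ, E) G) v w

theorem modelAd_one (w : E) : modelAd E (1 : G) w = w :=
  LinearMap.congr_fun (Ad_one (E := E) (G := G)) w

theorem modelAd_mul (x y : G) (w : E) : modelAd E (x * y) w = modelAd E x (modelAd E y w) :=
  LinearMap.congr_fun (Ad_mul (E := E) x y) w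

variable [FiniteDimensional ℝ E]

/-- The derivative of the adjoint representation at the identity is the bracket. -/
theorem hasFDerivAt_modelAd_chart (w : E) :
    ∃ A' : E →L[ℝ] E, HasFDerivAt (fun y : E => modelAd E ((φ).symm y) w) A' (φ 1) ∧
      ∀ u : E, A' u = modelLie G u w := by
  have : CompleteSpace E := FiniteDimensional.complete ℝ E
  have hm : ContDiffAt ℝ 2 (chartMul E G) (φ 1, φ 1) :=
    contDiffAt_chartMul.of_le (WithTop.coe_le_coe.2 (le_top : (2 : ℕ∞) ≤ ⊤))
  have hDm : HasFDerivAt (fderiv ℝ (chartMul E G))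
      (fderiv ℝ (fderiv ℝ (chartMul E G)) (φ 1, φ 1)) (φ 1, φ 1) :=
    ((hm.fderiv_right (m := 1) (by norm_num)).differentiableAt (by simp)).hasFDerivAt
  set D2 := fderiv ℝ (fderiv ℝ (chartMul E G)) (φ 1, φ 1) with hD2
  have hsymm : ∀ p q : E × E, D2 p q = D2 q p := fun p q =>
    (hm.isSymmSndFDerivAt (by simp)) p q
  have h1 : HasFDerivAt (fun y => fderiv ℝ (chartMul E G) (y, φ 1))
      (D2.comp (ContinuousLinearMap.inl ℝ E E)) (φ 1) :=
    HasFDerivAt.comp (f := fun y => (y, φ 1)) (φ 1) hDm (hasFDerivAt_prodMk_left (φ 1) (φ 1))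
  have h2 : HasFDerivAt (fun y => fderiv ℝ (chartMul E G) (φ 1, y))
      (D2.comp (ContinuousLinearMap.inr ℝ E E)) (φ 1) :=
    HasFDerivAt.comp (f := fun y => (φ 1, y)) (φ 1) hDm (hasFDerivAt_prodMk_right (φ 1) (φ 1))
  have hV : ∀ v : E, HasFDerivAt (fun y => fderiv ℝ (chartMul E G) (y, φ 1) ((0 : E), v))
      ((D2.comp (ContinuousLinearMap.inl ℝ E E)).flip ((0 : E), v)) (φ 1) := by
    intro v
    simpa using h1.clm_apply (hasFDerivAt_const ((0 : E), v) (φ 1))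
  -- `B y` is the derivative of right translation in the chart; the left-invariant field is V_v(y) =
  -- B(y) Ad(y) v.
  set B : E → (E →L[ℝ] E) := fun y =>
    (fderiv ℝ (chartMul E G) (φ 1, y)).comp (ContinuousLinearMap.inl ℝ E E) with hB
  have hBd : HasFDerivAt B (((ContinuousLinearMap.compL ℝ E (E × E) E).flip
      (ContinuousLinearMap.inl ℝ E E)).comp (D2.comp (ContinuousLinearMap.inr ℝ E E))) (φ 1) :=
    (((ContinuousLinearMap.compL ℝ E (E × E) E).flip
      (ContinuousLinearMap.inl ℝ E E)).hasFDerivAt).comp (φ 1) h2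
  have hVB : ∀ v : E,
      (fun y => fderiv ℝ (chartMul E G) (y, φ 1) ((0 : E), v)) =ᶠ[𝓝 (φ 1)]
      fun y => B y (modelAd E ((φ).symm y) v) := by
    intro v
    filter_upwards [fderiv_chartMul_snd (E := E) (G := G),
      fderiv_chartMul_fst (E := E) (G := G)] with y hy1 hy2
    exact (hy1 v).symm.trans (hy2 v)
  have hB0 : B (φ 1) = ContinuousLinearMap.id ℝ E := by
    have e : (fun z => chartMul E G (z, φ 1)) =ᶠ[𝓝 (φ 1)] id := by
      filter_upwards [extChartAt_target_mem_nhds (I := 𝓘(ℝ, E)) (1 : G)] with z hz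
      simp only [chartMul, extChartAt_to_inv, mul_one, id]
      exact (φ).right_inv hz
    have d : HasFDerivAt (fun z => chartMul E G (z, φ 1)) (B (φ 1)) (φ 1) :=
      HasFDerivAt.comp (g := chartMul E G) (f := fun z => (z, φ 1)) (φ 1)
        (hm.differentiableAt (by simp)).hasFDerivAt (hasFDerivAt_prodMk_left (φ 1) (φ 1))
    exact (d.congr_of_eventuallyEq e.symm).unique (hasFDerivAt_id (φ 1))
  have hA0 : ∀ v : E, modelAd E ((φ).symm (φ 1)) v = v := by
    intro v
    rw [extChartAt_to_inv, modelAd_one]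
  have hV0 : ∀ v : E, fderiv ℝ (chartMul E G) (φ 1, φ 1) ((0 : E), v) = v := by
    intro v
    have := (hVB v).self_of_nhds
    simp only [hB0, hA0] at this
    exact this
  have hinv : ContDiffAt ℝ 1 (ContinuousLinearMap.inverse : (E →L[ℝ] E) → (E →L[ℝ] E))
      (B (φ 1)) := by
    rw [hB0]
    exact ContinuousLinearMap.IsInvertible.contDiffAt_map_inverse
      (e := ContinuousLinearMap.id ℝ E) ⟨ContinuousLinearEquiv.refl ℝ E, rfl⟩
  have hBinv : ∀ᶠ y in 𝓝 (φ 1), (B y).IsInvertible := by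
    have hn := ContinuousLinearEquiv.nhds (ContinuousLinearEquiv.refl ℝ E)
    have : Tendsto B (𝓝 (φ 1)) (𝓝 (ContinuousLinearEquiv.refl ℝ E : E →L[ℝ] E)) := by
      have := hBd.continuousAt.tendsto
      rw [hB0] at this
      exact this
    filter_upwards [this hn] with y hy
    obtain ⟨e, he⟩ := hy
    exact ⟨e, he⟩
  -- Differentiability of Ad comes from Ad(y)w = B(y)⁻¹V_w(y), valid near the identity, where B is
  -- invertible because it is the identity at φ 1.
  have hAd : DifferentiableAt ℝ (fun y : E => modelAd E ((φ).symm y) w) (φ 1) := by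
    have d1 : DifferentiableAt ℝ (fun y => (B y).inverse
        (fderiv ℝ (chartMul E G) (y, φ 1) ((0 : E), w))) (φ 1) :=
      DifferentiableAt.clm_apply
        ((hinv.differentiableAt (by simp)).comp (φ 1) hBd.differentiableAt)
        (hV w).differentiableAt
    refine d1.congr_of_eventuallyEq ?_
    filter_upwards [hBinv, hVB w] with y hy1 hy2
    rw [hy2]
    exact (hy1.inverse_apply_self _).symm
  refine ⟨_, hAd.hasFDerivAt, fun u => ?_⟩
  -- Differentiating V_w = B·Ad w along u gives D²m((u,0),(0,w)) = D²m((0,u),(w,0)) + A'u. By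
  -- symmetry of D²m the last D² term is the one subtracted in the bracket [V_u, V_w], so the
  -- bracket is A'u.
  have hprod := hBd.clm_apply hAd.hasFDerivAt
  have huniq := ((hV w).congr_of_eventuallyEq (hVB w).symm).unique hprod
  have hu := DFunLike.congr_fun huniq (u : E)
  have hlie : modelLie G u w = _ := lie_eq_lieBracket_chart (G := G) u w
  rw [hlie, lieBracket, (hV _).fderiv, (hV _).fderiv, hV0, hV0]
  simp only [hA0, hB0] at hu
  simp only [add_apply, ContinuousLinearMap.comp_apply,
    ContinuousLinearMap.flip_apply, ContinuousLinearMap.compL_apply, ContinuousLinearMap.id_apply,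
    ContinuousLinearMap.inl_apply, ContinuousLinearMap.inr_apply] at hu ⊢
  rw [hu, hsymm (w, 0) (0, u)]
  abel

/-- Differentiability in the chart gives continuity at 1; elsewhere use Ad g = Ad g₀ ∘ Ad (g₀⁻¹g).
-/
theorem continuous_modelAd_apply (w : E) : Continuous (fun g : G => modelAd E g w) := by
  have h1 : ∀ v : E, ContinuousAt (fun g : G => modelAd E g v) 1 := by
    intro v
    obtain ⟨A', hA, -⟩ := hasFDerivAt_modelAd_chart (G := G) v
    have hc : ContinuousAt (fun g : G => modelAd E ((φ).symm (φ g)) v) 1 :=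
      ContinuousAt.comp (f := φ) (g := fun y : E => modelAd E ((φ).symm y) v) (x := 1)
        hA.continuousAt (continuousAt_extChartAt (1 : G))
    refine hc.congr ?_
    filter_upwards [extChartAt_source_mem_nhds (I := 𝓘(ℝ, E)) (1 : G)] with g hg
    rw [(φ).left_inv hg]
  rw [continuous_iff_continuousAt]
  intro g₀
  have h2 : ContinuousAt (fun g : G => g₀⁻¹ * g) g₀ :=
    (contMDiff_mul_left (I := 𝓘(ℝ, E)) (n := ∞) (a := g₀⁻¹)).continuous.continuousAt
  have h3 : ContinuousAt (fun g : G => modelAd E (g₀⁻¹ * g) w) g₀ :=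
    ContinuousAt.comp (g := fun g : G => modelAd E g w) (by rw [inv_mul_cancel]; exact h1 w) h2
  have h5 := (modelAd E g₀).continuous.continuousAt.comp h3
  refine h5.congr (Eventually.of_forall fun g => ?_)
  have := modelAd_mul g₀ (g₀⁻¹ * g) w
  rw [mul_inv_cancel_left] at this
  exact this.symm

/-- Differentiate the constant function g ↦ b(Ad g v, Ad g w) at the identity. -/
theorem modelLie_skew_of_modelAd_invariant (b : E →L[ℝ] E →L[ℝ] ℝ)
    (hb : ∀ (x : G) (X Y : E), b (modelAd E x X) (modelAd E x Y) = b X Y) (u v w : E) :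
    b (modelLie G u v) w + b v (modelLie G u w) = 0 := by
  obtain ⟨A', hA, hA'⟩ := hasFDerivAt_modelAd_chart (G := G) v
  obtain ⟨B', hB, hB'⟩ := hasFDerivAt_modelAd_chart (G := G) w
  have h := (b.hasFDerivAt.comp (φ 1) hA).clm_apply hB
  have hc : HasFDerivAt (fun y : E => b (modelAd E ((φ).symm y) v) (modelAd E ((φ).symm y) w))
      (0 : E →L[ℝ] ℝ) (φ 1) := by
    refine (hasFDerivAt_const (b v w) (φ 1)).congr_of_eventuallyEq (Eventually.of_forall ?_)
    intro y
    exact hb _ _ _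
  have hu := DFunLike.congr_fun (h.unique hc) u
  simp only [add_apply, ContinuousLinearMap.comp_apply, Function.comp,
    ContinuousLinearMap.flip_apply, extChartAt_to_inv, modelAd_one, hA', hB'] at hu
  rw [add_comm] at hu
  exact hu

theorem lie_skew_of_Ad_invariant (β : LinearMap.BilinForm ℝ (GroupLieAlgebra 𝓘(ℝ, E) G))
    (hβ : ∀ (x : G) X Y, β (Ad x X) (Ad x Y) = β X Y)
    (u v w : GroupLieAlgebra 𝓘(ℝ, E) G) : β ⁅u, v⁆ w + β v ⁅u, w⁆ = 0 := by
  let β' : E →ₗ[ℝ] E →ₗ[ℝ] ℝ := β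
  let b : E →L[ℝ] E →L[ℝ] ℝ :=
    LinearMap.toContinuousLinearMap
      ((LinearMap.toContinuousLinearMap : (E →ₗ[ℝ] ℝ) ≃ₗ[ℝ] (E →L[ℝ] ℝ)).toLinearMap ∘ₗ β')
  exact modelLie_skew_of_modelAd_invariant (G := G) b hβ u v w

end AdjointContinuity

/-! ### Orthonormal bases and traces for a positive form. -/

section PositiveForms

variable {V : Type*} [AddCommGroup V] [Module ℝ V]

variable {ι : Type*} [Fintype ι] [DecidableEq ι]

theorem repr_eq_of_orthonormal {β : LinearMap.BilinForm ℝ V} {e : Module.Basis ι ℝ V}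
    (he : ∀ i j, β (e i) (e j) = if i = j then 1 else 0) (v : V) (i : ι) :
    e.repr v i = β v (e i) := by
  have h := congrArg (fun w => β w (e i)) (e.sum_repr v)
  simp only [map_sum, map_smul, LinearMap.sum_apply, LinearMap.smul_apply, he, smul_eq_mul,
    mul_ite, mul_one, mul_zero, Finset.sum_ite_eq', Finset.mem_univ, if_true] at h
  exact h

theorem eq_sum_form_smul_of_orthonormal {β : LinearMap.BilinForm ℝ V} {e : Module.Basis ι ℝ V}
    (he : ∀ i j, β (e i) (e j) = if i = j then 1 else 0)
    (v : V) : v = ∑ d, β v (e d) • e d := by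
  conv_lhs => rw [← e.sum_repr v]
  exact Finset.sum_congr rfl fun d _ => by rw [repr_eq_of_orthonormal he]

theorem trace_eq_sum_of_orthonormal {β : LinearMap.BilinForm ℝ V} {e : Module.Basis ι ℝ V}
    (he : ∀ i j, β (e i) (e j) = if i = j then 1 else 0) (T : V →ₗ[ℝ] V) :
    LinearMap.trace ℝ V T = ∑ i, β (T (e i)) (e i) := by
  rw [LinearMap.trace_eq_matrix_trace ℝ e, Matrix.trace]
  refine Finset.sum_congr rfl fun i _ => ?_
  rw [Matrix.diag_apply, LinearMap.toMatrix_apply, repr_eq_of_orthonormal he]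

variable [FiniteDimensional ℝ V]

theorem exists_orthonormal_basis_of_pos (β : LinearMap.BilinForm ℝ V)
    (hs : ∀ X Y, β X Y = β Y X) (hp : ∀ X, X ≠ 0 → 0 < β X X) :
    ∃ e : Module.Basis (Fin (Module.finrank ℝ V)) ℝ V,
      ∀ i j, β (e i) (e j) = if i = j then 1 else 0 := by
  classical
  let c : InnerProductSpace.Core ℝ V :=
    { inner := fun X Y => β X Y
      conj_inner_symm := fun X Y => by simp [hs X Y]
      re_inner_nonneg := fun X => by
        by_cases h : X = 0
        · simp [h]
        · simpa using (hp X h).le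
      add_left := fun X Y Z => by simp
      smul_left := fun X Y r => by simp
      definite := fun X h => by
        by_contra hX
        exact (hp X hX).ne' h }
  let _ : NormedAddCommGroup V := @InnerProductSpace.Core.toNormedAddCommGroup ℝ V _ _ _ c
  let _ : InnerProductSpace ℝ V := InnerProductSpace.ofCore c.toCore
  refine ⟨(stdOrthonormalBasis ℝ V).toBasis, fun i j => ?_⟩
  have := orthonormal_iff_ite.1 (stdOrthonormalBasis ℝ V).orthonormal i j
  rw [OrthonormalBasis.coe_toBasis]
  exact this

/-- In a β-orthonormal basis, tr T² = Σ β(T²eᵢ, eᵢ) = -Σ β(Teᵢ, Teᵢ). It is applied to T = ad X. -/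
theorem trace_sq_nonpos_of_skew (β : LinearMap.BilinForm ℝ V)
    (hs : ∀ X Y, β X Y = β Y X) (hp : ∀ X, X ≠ 0 → 0 < β X X) (T : V →ₗ[ℝ] V)
    (hT : ∀ X Y, β (T X) Y + β X (T Y) = 0) : LinearMap.trace ℝ V (T ∘ₗ T) ≤ 0 := by
  classical
  obtain ⟨e, he⟩ := exists_orthonormal_basis_of_pos β hs hp
  rw [trace_eq_sum_of_orthonormal he]
  refine Finset.sum_nonpos fun i _ => ?_
  have h1 := hT (T (e i)) (e i)
  have h2 : 0 ≤ β (T (e i)) (T (e i)) := by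
    by_cases h : T (e i) = 0
    · simp [h]
    · exact (hp _ h).le
  simp only [LinearMap.comp_apply]
  linarith

end PositiveForms

/-! ### Averaging over the compact group; sign of the Killing form. -/

section HaarAverage

open MeasureTheory

variable {E : Type*} [NormedAddCommGroup E] [NormedSpace ℝ E]
  {G : Type*} [TopologicalSpace G] [ChartedSpace E G] [Group G]
  [LieGroup 𝓘(ℝ, E) ∞ G] [FiniteDimensional ℝ E] [T2Space G] [CompactSpace G]

variable (E G) in
-- Integrate a coordinate scalar product of Ad(g⁻¹)X and Ad(g⁻¹)Y against Haar measure. Left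
-- invariance of the measure makes the result Ad-invariant; for positivity it suffices that the
-- continuous integrand is positive at g = 1.
theorem exists_Ad_invariant_form :
    ∃ β : LinearMap.BilinForm ℝ (GroupLieAlgebra 𝓘(ℝ, E) G),
      (∀ X Y, β X Y = β Y X) ∧ (∀ X, X ≠ 0 → 0 < β X X) ∧
      ∀ (x : G) X Y, β (Ad x X) (Ad x Y) = β X Y := by
  have : IsTopologicalGroup G := topologicalGroup_of_lieGroup 𝓘(ℝ, E) ∞
  let _ : MeasurableSpace G := borel G
  have : BorelSpace G := ⟨rfl⟩
  let μ : Measure G := Measure.haar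
  let c := Module.finBasis ℝ E
  have hc : ∀ (X : E) i, Continuous (fun g : G => c.repr (modelAd E g⁻¹ X) i) := by
    intro X i
    have h1 : Continuous (fun v : E => c.repr v i) :=
      LinearMap.continuous_of_finiteDimensional (c.coord i)
    exact h1.comp ((continuous_modelAd_apply X).comp continuous_inv)
  have hcont : ∀ X Y : E, Continuous (fun g : G =>
      ∑ i, c.repr (modelAd E g⁻¹ X) i * c.repr (modelAd E g⁻¹ Y) i) :=
    fun X Y => continuous_finsetSum _ fun i _ => (hc X i).mul (hc Y i)
  have hint : ∀ X Y : E, Integrable (fun g : G =>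
      ∑ i, c.repr (modelAd E g⁻¹ X) i * c.repr (modelAd E g⁻¹ Y) i) μ :=
    fun X Y => (hcont X Y).integrable_of_hasCompactSupport (HasCompactSupport.of_compactSpace _)
  let β : E →ₗ[ℝ] E →ₗ[ℝ] ℝ := LinearMap.mk₂ ℝ
    (fun X Y => ∫ g : G, ∑ i, c.repr (modelAd E g⁻¹ X) i * c.repr (modelAd E g⁻¹ Y) i ∂μ)
    (by
      intro X X' Y
      rw [← integral_add (hint X Y) (hint X' Y)]
      congr 1; ext g
      simp [add_mul, Finset.sum_add_distrib])
    (by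
      intro r X Y
      rw [smul_eq_mul, ← integral_const_mul]
      congr 1; ext g
      simp [mul_assoc, Finset.mul_sum])
    (by
      intro X Y Y'
      rw [← integral_add (hint X Y) (hint X Y')]
      congr 1; ext g
      simp [mul_add, Finset.sum_add_distrib])
    (by
      intro r X Y
      rw [smul_eq_mul, ← integral_const_mul]
      congr 1; ext g
      simp [mul_left_comm, Finset.mul_sum])
  have hsymm : ∀ X Y : E, β X Y = β Y X := by
    intro X Y
    change ∫ g : G, _ ∂μ = ∫ g : G, _ ∂μ
    congr 1; ext g
    exact Finset.sum_congr rfl fun i _ => mul_comm _ _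
  have hpos : ∀ X : E, X ≠ 0 → 0 < β X X := by
    intro X hX
    change 0 < ∫ g : G, _ ∂μ
    refine (hcont X X).integral_pos_of_hasCompactSupport_nonneg_nonzero
      (HasCompactSupport.of_compactSpace _)
      (fun g => Finset.sum_nonneg fun i _ => mul_self_nonneg _) (x := 1) ?_
    intro h0
    rw [Finset.sum_eq_zero_iff_of_nonneg fun i _ => mul_self_nonneg _] at h0
    apply hX
    rw [← c.repr.map_eq_zero_iff]
    ext i
    have := h0 i (Finset.mem_univ i)
    rw [inv_one, modelAd_one] at this
    simpa using this
  have hinv : ∀ (x : G) (X Y : E), β (modelAd E x X) (modelAd E x Y) = β X Y := by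
    intro x X Y
    have h1 : ∀ (g : G) (Z : E), modelAd E g⁻¹ (modelAd E x Z) = modelAd E (x⁻¹ * g)⁻¹ Z := by
      intro g Z
      rw [← modelAd_mul]; simp
    have h2 := integral_mul_left_eq_self (μ := μ) (fun g : G =>
      ∑ i, c.repr (modelAd E g⁻¹ X) i * c.repr (modelAd E g⁻¹ Y) i) x⁻¹
    refine Eq.trans ?_ h2
    change ∫ g : G, ∑ i, c.repr (modelAd E g⁻¹ (modelAd E x X)) i *
      c.repr (modelAd E g⁻¹ (modelAd E x Y)) i ∂μ = _
    simp only [h1]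
  exact ⟨β, hsymm, hpos, hinv⟩

/-- The Killing form of a compact Lie group is negative semidefinite. -/
theorem killingForm_apply_self_nonpos (X : GroupLieAlgebra 𝓘(ℝ, E) G) :
    killingForm ℝ (GroupLieAlgebra 𝓘(ℝ, E) G) X X ≤ 0 := by
  obtain ⟨β, hs, hp, hinv⟩ := exists_Ad_invariant_form E G
  rw [killingForm_apply_apply]
  exact trace_sq_nonpos_of_skew β hs hp _ fun Y Z => lie_skew_of_Ad_invariant β hinv X Y Z

omit [T2Space G] [CompactSpace G] in
theorem killingForm_Ad (x : G) (X Y : GroupLieAlgebra 𝓘(ℝ, E) G) :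
    killingForm ℝ (GroupLieAlgebra 𝓘(ℝ, E) G) (Ad x X) (Ad x Y) =
      killingForm ℝ (GroupLieAlgebra 𝓘(ℝ, E) G) X Y := by
  let e : GroupLieAlgebra 𝓘(ℝ, E) G ≃ₗ⁅ℝ⁆ GroupLieAlgebra 𝓘(ℝ, E) G :=
    { Ad x with
      map_lie' := fun {v w} => Ad_lie x v w
      invFun := Ad x⁻¹
      left_inv := Ad_inv_Ad x
      right_inv := Ad_Ad_inv x }
  exact LieAlgebra.killingForm_of_equiv_apply e X Y

end HaarAverage

/-! ### Curvature of diagonal metrics through structure constants. -/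

namespace Reductive

variable {L : Type*} [LieRing L] [LieAlgebra ℝ L] {𝔭 𝔨 : Submodule ℝ L}

section StructureConstants

variable {ι : Type*}

/-- The structure constants `N([e_a, e_b]_𝔭, e_d)`. -/
def structConst (hc : IsCompl 𝔭 𝔨) (N : LinearMap.BilinForm ℝ 𝔭) (e : Module.Basis ι ℝ 𝔭)
    (a b d : ι) : ℝ :=
  N (bracketP hc (e a) (e b)) (e d)

/-- The coefficient of `N([e_a, e_b]_𝔭, e_d)` in the `e_d`-component of `Λ(e_a)e_b`, for the
diagonal metric with eigenvalues `x`. -/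
def connCoeff (x : ι → ℝ) (a b d : ι) : ℝ := (x d + x b - x a) / (2 * x d)

/-- The component `N([[e_i, e_j]_𝔨, e_k], e_l)`. -/
def isotropyConst (hc : IsCompl 𝔭 𝔨) (N : LinearMap.BilinForm ℝ 𝔭) (e : Module.Basis ι ℝ 𝔭)
    (i j k l : ι) : ℝ :=
  N (𝔭.projectionOnto 𝔨 hc ⁅(bracketK hc (e i) (e j) : L), ((e k : 𝔭) : L)⁆) (e l)

variable {hc : IsCompl 𝔭 𝔨} {N : LinearMap.BilinForm ℝ 𝔭} {e : Module.Basis ι ℝ 𝔭}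

theorem structConst_swap_left (a b d : ι) :
    structConst hc N e b a d = - structConst hc N e a b d := by
  have : bracketP hc (e b) (e a) = - bracketP hc (e a) (e b) := by
    simp only [bracketP, LinearMap.mk₂_apply]
    rw [← lie_skew, map_neg]
  simp [structConst, this]

/-- As 𝔨 ⟂ 𝔭, the projection to 𝔭 is invisible when paired with 𝔭. Inside N one may thus work with
brackets of the full algebra. -/
theorem form_bracketP (hN : ∀ X Y : 𝔭, N X Y = -killingForm ℝ L X Y)
    (hort : ∀ X ∈ 𝔨, ∀ Y ∈ 𝔭, killingForm ℝ L X Y = 0) (w : L) (Z : 𝔭) :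
    N (𝔭.projectionOnto 𝔨 hc w) Z = -killingForm ℝ L w Z := by
  have h : ((𝔭.projectionOnto 𝔨 hc w : 𝔭) : L) + (𝔨.projectionOnto 𝔭 hc.symm w : 𝔨) = w :=
    Submodule.projection_add_projection_eq_self hc w
  conv_rhs => rw [← h]
  rw [map_add, LinearMap.add_apply, hort _ (𝔨.projectionOnto 𝔭 hc.symm w).2 Z Z.2, hN, add_zero]

/-- Invariance of the Killing form. Together with `structConst_swap_left` the structure constants
are totally skew. -/
theorem structConst_swap_right (hN : ∀ X Y : 𝔭, N X Y = -killingForm ℝ L X Y)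
    (hort : ∀ X ∈ 𝔨, ∀ Y ∈ 𝔭, killingForm ℝ L X Y = 0) (a b d : ι) :
    structConst hc N e a d b = - structConst hc N e a b d := by
  simp only [structConst, bracketP, LinearMap.mk₂_apply]
  rw [form_bracketP hN hort, form_bracketP hN hort,
    LieModule.traceForm_apply_lie_apply', LieModule.traceForm_comm]

/-- Invariance moves e_b across to form [e_i, e_b], of which only the 𝔨-component survives by
orthogonality. The isotropy term of Ricci is therefore minus a Killing form, which has a sign on the
diagonal when the group is compact. -/
theorem isotropyConst_eq_killingForm (hN : ∀ X Y : 𝔭, N X Y = -killingForm ℝ L X Y)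
    (hort : ∀ X ∈ 𝔨, ∀ Y ∈ 𝔭, killingForm ℝ L X Y = 0) (i a b : ι) :
    isotropyConst hc N e i a b i =
      killingForm ℝ L (bracketK hc (e i) (e a)) (bracketK hc (e i) (e b)) := by
  have h : ((𝔭.projectionOnto 𝔨 hc ⁅((e i : 𝔭) : L), (e b : L)⁆ : 𝔭) : L) +
      bracketK hc (e i) (e b) = ⁅((e i : 𝔭) : L), (e b : L)⁆ :=
    Submodule.projection_add_projection_eq_self hc _
  rw [isotropyConst, form_bracketP hN hort, LieModule.traceForm_apply_lie_apply, ← lie_skew,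
    map_neg, neg_neg, ← h, map_add, hort _ (bracketK hc (e i) (e a)).2 _ (Submodule.coe_mem _),
    zero_add]

variable [Fintype ι]

/-- The components `N(R(e_i, e_j)e_k, e_l)` of the curvature tensor of the diagonal metric with
eigenvalues `x`. -/
def curvComp (hc : IsCompl 𝔭 𝔨) (N : LinearMap.BilinForm ℝ 𝔭) (e : Module.Basis ι ℝ 𝔭)
    (x : ι → ℝ) (i j k l : ι) : ℝ :=
  ∑ d, connCoeff x j k d * structConst hc N e j k d * (connCoeff x i d l * structConst hc N e i d l)
  - ∑ d, connCoeff x i k d * structConst hc N e i k d *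
      (connCoeff x j d l * structConst hc N e j d l)
  - ∑ d, structConst hc N e i j d * (connCoeff x d k l * structConst hc N e d k l)
  - isotropyConst hc N e i j k l

variable [DecidableEq ι]

variable {g : LinearMap.BilinForm ℝ 𝔭} {x : ι → ℝ}

theorem form_basis_right (he : ∀ i j, N (e i) (e j) = if i = j then 1 else 0)
    (hx : ∀ i j, g (e i) (e j) = if i = j then x i else 0) (v : 𝔭) (d : ι) :
    g v (e d) = x d * N v (e d) := by
  conv_lhs => rw [eq_sum_form_smul_of_orthonormal he v]
  simp [hx, mul_comm]

theorem form_basis_left (he : ∀ i j, N (e i) (e j) = if i = j then 1 else 0)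
    (hx : ∀ i j, g (e i) (e j) = if i = j then x i else 0) (v : 𝔭) (d : ι) :
    g (e d) v = x d * N v (e d) := by
  conv_lhs => rw [eq_sum_form_smul_of_orthonormal he v]
  simp [hx, mul_comm]

variable [FiniteDimensional ℝ L]

theorem form_leviCivita (hg : g.Nondegenerate) (X Y Z : 𝔭) :
    g (leviCivita hc g hg X Y) Z = koszulForm hc g X Y Z := by
  simp only [leviCivita, LinearMap.mk₂_apply]
  exact LinearMap.BilinForm.apply_toDual_symm_apply ..

/-- By total skewness the three Koszul terms are the same structure constant, with weights x_d, x_b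
and -x_a. -/
theorem leviCivita_basis (hN : ∀ X Y : 𝔭, N X Y = -killingForm ℝ L X Y)
    (hort : ∀ X ∈ 𝔨, ∀ Y ∈ 𝔭, killingForm ℝ L X Y = 0)
    (he : ∀ i j, N (e i) (e j) = if i = j then 1 else 0)
    (hx : ∀ i j, g (e i) (e j) = if i = j then x i else 0) (hx0 : ∀ i, x i ≠ 0)
    (hg : g.Nondegenerate) (a b d : ι) :
    N (leviCivita hc g hg (e a) (e b)) (e d) = connCoeff x a b d * structConst hc N e a b d := by
  have h1 := form_basis_right he hx (leviCivita hc g hg (e a) (e b)) d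
  rw [form_leviCivita, koszulForm_apply, form_basis_right he hx, form_basis_right he hx,
    form_basis_left he hx] at h1
  change 1 / 2 * (x d * structConst hc N e a b d + x b * structConst hc N e d a b +
    x a * structConst hc N e d b a) = _ at h1
  have h2 : structConst hc N e d a b = structConst hc N e a b d := by
    rw [structConst_swap_left, structConst_swap_right hN hort, neg_neg]
  have h3 : structConst hc N e d b a = - structConst hc N e a b d := by
    rw [structConst_swap_right hN hort, h2]
  rw [h2, h3] at h1
  have := hx0 d
  rw [connCoeff]
  field_simp
  linarith

theorem curvature_basis (hN : ∀ X Y : 𝔭, N X Y = -killingForm ℝ L X Y)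
    (hort : ∀ X ∈ 𝔨, ∀ Y ∈ 𝔭, killingForm ℝ L X Y = 0)
    (he : ∀ i j, N (e i) (e j) = if i = j then 1 else 0)
    (hx : ∀ i j, g (e i) (e j) = if i = j then x i else 0) (hx0 : ∀ i, x i ≠ 0)
    (hg : g.Nondegenerate) (i j k l : ι) :
    N (curvature hc g hg (e i) (e j) (e k)) (e l) = curvComp hc N e x i j k l := by
  have h1 : ∀ (a : ι) (v : 𝔭), N (leviCivita hc g hg (e a) v) (e l) =
      ∑ d, N v (e d) * (connCoeff x a d l * structConst hc N e a d l) := by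
    intro a v
    conv_lhs => rw [eq_sum_form_smul_of_orthonormal he v]
    simp only [map_sum, map_smul, LinearMap.sum_apply, LinearMap.smul_apply, smul_eq_mul,
      leviCivita_basis hN hort he hx hx0]
  have h2 : ∀ (a : ι) (v : 𝔭), N (leviCivita hc g hg v (e a)) (e l) =
      ∑ d, N v (e d) * (connCoeff x d a l * structConst hc N e d a l) := by
    intro a v
    conv_lhs => rw [eq_sum_form_smul_of_orthonormal he v]
    simp only [map_sum, map_smul, LinearMap.sum_apply, LinearMap.smul_apply, smul_eq_mul,
      leviCivita_basis hN hort he hx hx0]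
  simp only [curvature, map_sub, LinearMap.sub_apply, h1, h2, leviCivita_basis hN hort he hx hx0]
  rfl

theorem ricci_basis (hN : ∀ X Y : 𝔭, N X Y = -killingForm ℝ L X Y)
    (hort : ∀ X ∈ 𝔨, ∀ Y ∈ 𝔭, killingForm ℝ L X Y = 0)
    (he : ∀ i j, N (e i) (e j) = if i = j then 1 else 0)
    (hx : ∀ i j, g (e i) (e j) = if i = j then x i else 0) (hx0 : ∀ i, x i ≠ 0)
    (hg : g.Nondegenerate) (j k : ι) :
    ricci hc g hg (e j) (e k) = ∑ i, curvComp hc N e x i j k i := by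
  rw [ricci, trace_eq_sum_of_orthonormal he]
  exact Finset.sum_congr rfl fun i _ => curvature_basis hN hort he hx hx0 hg i j k i

/-- Contraction kills the first curvature sum, since N([e_i, e_d], e_i) = 0, and skewness merges the
others. The case of equal eigenvalues covers two vectors of one summand; mixed components are left
to Schur's lemma. -/
theorem ricci_basis_of_eq (hN : ∀ X Y : 𝔭, N X Y = -killingForm ℝ L X Y)
    (hort : ∀ X ∈ 𝔨, ∀ Y ∈ 𝔭, killingForm ℝ L X Y = 0)
    (he : ∀ i j, N (e i) (e j) = if i = j then 1 else 0)
    (hx : ∀ i j, g (e i) (e j) = if i = j then x i else 0) (hx0 : ∀ i, x i ≠ 0)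
    (hg : g.Nondegenerate) {a b : ι} (hab : x a = x b) :
    ricci hc g hg (e a) (e b) =
      ∑ i, ∑ d, structConst hc N e i a d * structConst hc N e i b d *
        (connCoeff x d a i - connCoeff x i a d * connCoeff x a d i) +
      ∑ i, - killingForm ℝ L (bracketK hc (e i) (e a)) (bracketK hc (e i) (e b)) := by
  rw [ricci_basis hN hort he hx hx0, ← Finset.sum_add_distrib]
  refine Finset.sum_congr rfl fun i _ => ?_
  have h0 : ∀ d, structConst hc N e i d i = 0 := fun d => by
    have h := structConst_swap_left (hc := hc) (N := N) (e := e) i i d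
    rw [structConst_swap_right hN hort]
    linarith
  rw [curvComp, isotropyConst_eq_killingForm hN hort]
  simp only [h0, mul_zero, Finset.sum_const_zero, zero_sub]
  rw [← sub_eq_add_neg, ← Finset.sum_neg_distrib, ← Finset.sum_sub_distrib]
  congr 1
  refine Finset.sum_congr rfl fun d _ => ?_
  have h2 : structConst hc N e a d i = structConst hc N e i a d := by
    rw [structConst_swap_right hN hort, structConst_swap_left, neg_neg]
  have h3 : structConst hc N e d b i = - structConst hc N e i b d := by
    rw [structConst_swap_left, structConst_swap_right hN hort, structConst_swap_left b i d, neg_neg]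
  rw [h2, h3, connCoeff, connCoeff, connCoeff, connCoeff, connCoeff, hab]
  ring

end StructureConstants

end Reductive

/-! ### Sums of squares of components do not depend on the orthonormal basis. -/

section SumsOfSquares

variable {V : Type*} [AddCommGroup V] [Module ℝ V]
  {ι ι' : Type*} [Fintype ι] [DecidableEq ι] [Fintype ι'] [DecidableEq ι']
  {β : LinearMap.BilinForm ℝ V} {e : Module.Basis ι ℝ V} {e' : Module.Basis ι' ℝ V}

/-- Both sides are the squared norm of the vector representing f. -/
theorem sum_sq_eq_of_orthonormal (hs : ∀ X Y, β X Y = β Y X)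
    (he : ∀ i j, β (e i) (e j) = if i = j then 1 else 0)
    (he' : ∀ i j, β (e' i) (e' j) = if i = j then 1 else 0) {f : V → ℝ} (hf : IsLinearMap ℝ f) :
    ∑ i, f (e i) ^ 2 = ∑ j, f (e' j) ^ 2 := by
  let φ : V →ₗ[ℝ] ℝ := hf.mk' f
  have hφ : ∀ w, f w = φ w := fun w => rfl
  set v : V := ∑ j, f (e' j) • e' j with hv
  have h1 : ∀ w, f w = β w v := by
    intro w
    conv_lhs => rw [hφ, eq_sum_form_smul_of_orthonormal he' w]
    simp [hv, hφ, mul_comm]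
  have h2 : ∑ i, f (e i) ^ 2 = β v v := by
    have h3 := congrArg (fun u => β u v) (eq_sum_form_smul_of_orthonormal he v)
    simp only [map_sum, map_smul, LinearMap.sum_apply, LinearMap.smul_apply, smul_eq_mul] at h3
    rw [h3]
    refine Finset.sum_congr rfl fun i _ => ?_
    rw [h1, hs v]
    ring
  rw [h2]
  nth_rewrite 2 [hv]
  simp only [map_sum, map_smul, smul_eq_mul]
  refine Finset.sum_congr rfl fun i _ => ?_
  rw [hs v, ← h1]
  ring

/-- Change the basis one slot at a time, moving the sum over that slot innermost. This frees |Rm|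
from the basis chosen in its definition. -/
theorem sum_sq_four_eq_of_orthonormal (hs : ∀ X Y, β X Y = β Y X)
    (he : ∀ i j, β (e i) (e j) = if i = j then 1 else 0)
    (he' : ∀ i j, β (e' i) (e' j) = if i = j then 1 else 0) {T : V → V → V → V → ℝ}
    (h1 : ∀ Y Z W, IsLinearMap ℝ fun X => T X Y Z W) (h2 : ∀ X Z W, IsLinearMap ℝ fun Y => T X Y Z W)
    (h3 : ∀ X Y W, IsLinearMap ℝ fun Z => T X Y Z W) (h4 : ∀ X Y Z, IsLinearMap ℝ fun W => T X Y Z W) :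
    ∑ i, ∑ j, ∑ k, ∑ l, T (e i) (e j) (e k) (e l) ^ 2 =
      ∑ i, ∑ j, ∑ k, ∑ l, T (e' i) (e' j) (e' k) (e' l) ^ 2 := by
  have s4 : ∀ X Y Z, ∑ l, T X Y Z (e l) ^ 2 = ∑ l, T X Y Z (e' l) ^ 2 :=
    fun X Y Z => sum_sq_eq_of_orthonormal hs he he' (h4 X Y Z)
  have s3 : ∀ X Y, ∑ k, ∑ l, T X Y (e k) (e l) ^ 2 = ∑ k, ∑ l, T X Y (e' k) (e' l) ^ 2 := by
    intro X Y
    simp only [s4]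
    rw [Finset.sum_comm]
    conv_rhs => rw [Finset.sum_comm]
    exact Finset.sum_congr rfl fun l _ => sum_sq_eq_of_orthonormal hs he he' (h3 X Y _)
  have s2 : ∀ X, ∑ j, ∑ k, ∑ l, T X (e j) (e k) (e l) ^ 2 =
      ∑ j, ∑ k, ∑ l, T X (e' j) (e' k) (e' l) ^ 2 := by
    intro X
    simp only [s3]
    rw [Finset.sum_comm]
    conv_rhs => rw [Finset.sum_comm]
    refine Finset.sum_congr rfl fun k _ => ?_
    rw [Finset.sum_comm]
    conv_rhs => rw [Finset.sum_comm]
    exact Finset.sum_congr rfl fun l _ => sum_sq_eq_of_orthonormal hs he he' (h2 X _ _)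
  simp only [s2]
  rw [Finset.sum_comm]
  conv_rhs => rw [Finset.sum_comm]
  refine Finset.sum_congr rfl fun j _ => ?_
  rw [Finset.sum_comm]
  conv_rhs => rw [Finset.sum_comm]
  refine Finset.sum_congr rfl fun k _ => ?_
  rw [Finset.sum_comm]
  conv_rhs => rw [Finset.sum_comm]
  exact Finset.sum_congr rfl fun l _ => sum_sq_eq_of_orthonormal hs he he' (h1 _ _ _)

theorem isLinearMap_form_left {f : V → V} (hf : IsLinearMap ℝ f) (W : V) :
    IsLinearMap ℝ fun X => β (f X) W :=
  ⟨fun X Y => by rw [hf.map_add, map_add, LinearMap.add_apply],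
    fun r X => by rw [hf.map_smul, map_smul, LinearMap.smul_apply]⟩

end SumsOfSquares

/-! ### Multilinearity and equivariance of the curvature. -/

namespace Reductive

variable {L : Type*} [LieRing L] [LieAlgebra ℝ L] {𝔭 𝔨 : Submodule ℝ L} {hc : IsCompl 𝔭 𝔨}
  {g : LinearMap.BilinForm ℝ 𝔭}

theorem bracketP_skew (X Y : 𝔭) : bracketP hc X Y = - bracketP hc Y X := by
  simp only [bracketP, LinearMap.mk₂_apply]
  rw [← lie_skew, map_neg]

theorem bracketK_skew (X Y : 𝔭) : bracketK hc X Y = - bracketK hc Y X := by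
  simp only [bracketK]
  rw [← lie_skew, map_neg]

theorem coe_bracketK (X Y : 𝔭) :
    (bracketK hc X Y : L) = ⁅(X : L), (Y : L)⁆ - (bracketP hc X Y : 𝔭) :=
  Submodule.projection_eq_self_sub_projection hc _

variable [FiniteDimensional ℝ L] {hg : g.Nondegenerate}

theorem curvature_skew (X Y Z : 𝔭) :
    curvature hc g hg X Y Z = - curvature hc g hg Y X Z := by
  simp only [curvature]
  rw [bracketP_skew X Y, bracketK_skew X Y]
  simp only [map_neg, LinearMap.neg_apply, Submodule.coe_neg, neg_lie]
  abel

theorem isLinearMap_curvature_left (Y Z : 𝔭) :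
    IsLinearMap ℝ fun X => curvature hc g hg X Y Z :=
  (curvatureEnd hc g hg Y Z).isLinear

theorem isLinearMap_curvature_middle (X Z : 𝔭) :
    IsLinearMap ℝ fun Y => curvature hc g hg X Y Z := by
  have h : (fun Y => curvature hc g hg X Y Z) = fun Y => -curvatureEnd hc g hg X Z Y :=
    funext fun Y => curvature_skew X Y Z
  rw [h]
  exact (-curvatureEnd hc g hg X Z).isLinear

theorem isLinearMap_curvature_right (X Y : 𝔭) :
    IsLinearMap ℝ fun Z => curvature hc g hg X Y Z := by
  constructor
  · intro Z Z'
    simp only [curvature, map_add, Submodule.coe_add, lie_add]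
    abel
  · intro r Z
    simp only [curvature, map_smul, Submodule.coe_smul, lie_smul, smul_sub]

theorem sum_sq_curvature_eq_of_orthonormal
    {ι ι' : Type*} [Fintype ι] [DecidableEq ι] [Fintype ι'] [DecidableEq ι']
    {e : Module.Basis ι ℝ 𝔭} {e' : Module.Basis ι' ℝ 𝔭} (hs : ∀ X Y, g X Y = g Y X)
    (he : ∀ i j, g (e i) (e j) = if i = j then 1 else 0)
    (he' : ∀ i j, g (e' i) (e' j) = if i = j then 1 else 0) :
    ∑ i, ∑ j, ∑ k, ∑ l, g (curvature hc g hg (e i) (e j) (e k)) (e l) ^ 2 =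
      ∑ i, ∑ j, ∑ k, ∑ l, g (curvature hc g hg (e' i) (e' j) (e' k)) (e' l) ^ 2 :=
  sum_sq_four_eq_of_orthonormal hs he he'
    (T := fun X Y Z W => g (curvature hc g hg X Y Z) W)
    (fun Y Z => isLinearMap_form_left (isLinearMap_curvature_left Y Z))
    (fun X Z => isLinearMap_form_left (isLinearMap_curvature_middle X Z))
    (fun X Y => isLinearMap_form_left (isLinearMap_curvature_right X Y))
    (fun X Y Z => LinearMap.isLinear (g (curvature hc g hg X Y Z)))

section Equivariance

variable {A : L →ₗ[ℝ] L} {σ : 𝔭 ≃ₗ[ℝ] 𝔭}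

omit [FiniteDimensional ℝ L] in
-- The 𝔭-component of a vector is determined by its Killing products with 𝔭, and A preserves both 𝔭
-- and the Killing form.
theorem projectionOnto_equivariant {N : LinearMap.BilinForm ℝ 𝔭} (hNd : N.Nondegenerate)
    (hN : ∀ X Y : 𝔭, N X Y = -killingForm ℝ L X Y)
    (hort : ∀ X ∈ 𝔨, ∀ Y ∈ 𝔭, killingForm ℝ L X Y = 0)
    (hAB : ∀ X Y, killingForm ℝ L (A X) (A Y) = killingForm ℝ L X Y)
    (hσ : ∀ X : 𝔭, (σ X : L) = A X) (w : L) :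
    𝔭.projectionOnto 𝔨 hc (A w) = σ (𝔭.projectionOnto 𝔨 hc w) := by
  rw [← sub_eq_zero]
  refine hNd.1 _ fun Z => ?_
  obtain ⟨Z, rfl⟩ := σ.surjective Z
  rw [map_sub, LinearMap.sub_apply, form_bracketP hN hort, hN, hσ, hσ, hAB, hAB, ← hN,
    form_bracketP hN hort, sub_self]

variable (hA : ∀ X Y, A ⁅X, Y⁆ = ⁅A X, A Y⁆) (hσ : ∀ X : 𝔭, (σ X : L) = A X)
  (hpr : ∀ w, 𝔭.projectionOnto 𝔨 hc (A w) = σ (𝔭.projectionOnto 𝔨 hc w))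
  (hgσ : ∀ X Y, g (σ X) (σ Y) = g X Y)

include hA hσ hpr

omit [FiniteDimensional ℝ L] in
theorem bracketP_equivariant (X Y : 𝔭) :
    bracketP hc (σ X) (σ Y) = σ (bracketP hc X Y) := by
  simp only [bracketP, LinearMap.mk₂_apply]
  rw [hσ, hσ, ← hA, hpr]

omit [FiniteDimensional ℝ L] in
theorem bracketK_equivariant (X Y : 𝔭) :
    (bracketK hc (σ X) (σ Y) : L) = A (bracketK hc X Y) := by
  rw [coe_bracketK, coe_bracketK, bracketP_equivariant hA hσ hpr, hσ, hσ, hσ, map_sub, hA]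

include hgσ

theorem leviCivita_equivariant (X Y : 𝔭) :
    leviCivita hc g hg (σ X) (σ Y) = σ (leviCivita hc g hg X Y) := by
  rw [← sub_eq_zero]
  refine hg.1 _ fun Z => ?_
  obtain ⟨Z, rfl⟩ := σ.surjective Z
  rw [map_sub, LinearMap.sub_apply, form_leviCivita, hgσ, form_leviCivita, koszulForm_apply,
    koszulForm_apply]
  simp only [bracketP_equivariant hA hσ hpr, hgσ, sub_self]

theorem curvature_equivariant (X Y Z : 𝔭) :
    curvature hc g hg (σ X) (σ Y) (σ Z) = σ (curvature hc g hg X Y Z) := by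
  simp only [curvature, leviCivita_equivariant hA hσ hpr hgσ, bracketP_equivariant hA hσ hpr,
    bracketK_equivariant hA hσ hpr, hσ, ← hA, hpr, map_sub]

theorem ricci_equivariant (X Y : 𝔭) :
    ricci hc g hg (σ X) (σ Y) = ricci hc g hg X Y := by
  have h : curvatureEnd hc g hg (σ X) (σ Y) = σ.conj (curvatureEnd hc g hg X Y) := by
    ext Z
    obtain ⟨Z, rfl⟩ := σ.surjective Z
    rw [LinearEquiv.conj_apply_apply, LinearEquiv.symm_apply_apply]
    exact congrArg _ (curvature_equivariant hA hσ hpr hgσ Z X Y)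
  rw [ricci, h, LinearMap.trace_conj', ricci]

end Equivariance

end Reductive

/-! ### Schur's lemma for real orthogonal representations. -/

section Schur

variable {V : Type*} [AddCommGroup V] [Module ℝ V] [FiniteDimensional ℝ V]

/-- The spectral theorem for self-adjoint maps supplies the eigenvalue which, over ℝ, irreducibility
alone does not. -/
theorem exists_eigenvector_of_symmetric [Nontrivial V] (β : LinearMap.BilinForm ℝ V)
    (hs : ∀ X Y, β X Y = β Y X) (hp : ∀ X, X ≠ 0 → 0 < β X X) (T : V →ₗ[ℝ] V)
    (hT : ∀ X Y, β (T X) Y = β X (T Y)) : ∃ (c : ℝ) (v : V), v ≠ 0 ∧ T v = c • v := by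
  classical
  let c : InnerProductSpace.Core ℝ V :=
    { inner := fun X Y => β X Y
      conj_inner_symm := fun X Y => by simp [hs X Y]
      re_inner_nonneg := fun X => by
        by_cases h : X = 0
        · simp [h]
        · simpa using (hp X h).le
      add_left := fun X Y Z => by simp
      smul_left := fun X Y r => by simp
      definite := fun X h => by
        by_contra hX
        exact (hp X hX).ne' h }
  let _ : NormedAddCommGroup V := @InnerProductSpace.Core.toNormedAddCommGroup ℝ V _ _ _ c
  let _ : InnerProductSpace ℝ V := InnerProductSpace.ofCore c.toCore
  have hsymm : T.IsSymmetric := hT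
  have hpos : 0 < Module.finrank ℝ V := Module.finrank_pos
  obtain ⟨v, hv⟩ := (hsymm.hasEigenvalue_eigenvalues rfl ⟨0, hpos⟩).exists_hasEigenvector
  exact ⟨_, v, hv.2, hv.apply_eq_smul⟩

variable {Γ : Type*} [Group Γ] (ρ : Representation ℝ Γ V)

/-- `q` is an invariant subspace of the representation `ρ`. -/
def IsInvariantSubspace (q : Submodule ℝ V) : Prop := ∀ g, ∀ X ∈ q, ρ g X ∈ q

/-- `q` is an irreducible invariant subspace of the representation `ρ`. -/
def IsIrreducibleSubspace (q : Submodule ℝ V) : Prop :=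
  IsInvariantSubspace ρ q ∧ q ≠ ⊥ ∧ ∀ q' ≤ q, IsInvariantSubspace ρ q' → q' = ⊥ ∨ q' = q

variable {ρ} {β b : LinearMap.BilinForm ℝ V}

omit [FiniteDimensional ℝ V] in
theorem restrict_nondegenerate_of_pos (hp : ∀ X, X ≠ 0 → 0 < β X X) (q : Submodule ℝ V) :
    (β.restrict q).Nondegenerate := by
  refine ⟨fun X h => ?_, fun X h => ?_⟩ <;>
  · by_contra hX
    exact (hp X (by simpa using hX)).ne' (h X)

/-- An invariant pairing between two subspaces, as a map from the first to the second. -/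
theorem exists_equivariant_of_invariant_pairing (hp : ∀ X, X ≠ 0 → 0 < β X X)
    (hβ : ∀ g X Y, β (ρ g X) (ρ g Y) = β X Y) (hb : ∀ g X Y, b (ρ g X) (ρ g Y) = b X Y)
    {q₁ q₂ : Submodule ℝ V} (h₁ : IsInvariantSubspace ρ q₁) (h₂ : IsInvariantSubspace ρ q₂) :
    ∃ T : q₁ →ₗ[ℝ] q₂, (∀ (X : q₁) (Y : q₂), β (T X) Y = b X Y) ∧
      ∀ g (X : q₁), (T ⟨ρ g X, h₁ g X X.2⟩ : V) = ρ g (T X) := by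
  have hnd := restrict_nondegenerate_of_pos hp q₂
  let T : q₁ →ₗ[ℝ] q₂ := ((β.restrict q₂).toDual hnd).symm.toLinearMap ∘ₗ
    (b.compl₁₂ q₁.subtype q₂.subtype : q₁ →ₗ[ℝ] q₂ →ₗ[ℝ] ℝ)
  have hT : ∀ (X : q₁) (Y : q₂), β (T X) Y = b X Y := fun X Y =>
    LinearMap.BilinForm.apply_toDual_symm_apply (hB := hnd) (f := _) (v := Y)
  refine ⟨T, hT, fun g X => ?_⟩
  have h3 : (T ⟨ρ g X, h₁ g X X.2⟩ - ⟨ρ g (T X), h₂ g _ (T X).2⟩ : q₂) = 0 := by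
    refine hnd.1 _ fun Y => ?_
    have hY : (Y : V) = ρ g (ρ g⁻¹ Y) := (ρ.self_inv_apply g Y).symm
    change β ((T ⟨ρ g X, h₁ g X X.2⟩ : V) - ρ g (T X)) Y = 0
    rw [map_sub, LinearMap.sub_apply, hT ⟨ρ g X, h₁ g X X.2⟩ Y, hY, hβ, hb,
      ← hT X ⟨ρ g⁻¹ Y, h₂ _ _ Y.2⟩, sub_self]
  exact congrArg Subtype.val (sub_eq_zero.1 h3)

/-- The pairing is β(T·, ·) for an equivariant T : q₁ → q₂. Kernel and range of T are invariant, so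
T is zero or an isomorphism, and inequivalence excludes the latter. -/
theorem invariant_pairing_eq_zero (hp : ∀ X, X ≠ 0 → 0 < β X X)
    (hβ : ∀ g X Y, β (ρ g X) (ρ g Y) = β X Y) (hb : ∀ g X Y, b (ρ g X) (ρ g Y) = b X Y)
    {q₁ q₂ : Submodule ℝ V} (h₁ : IsIrreducibleSubspace ρ q₁) (h₂ : IsIrreducibleSubspace ρ q₂)
    (hne : ¬ ∃ φ : q₁ ≃ₗ[ℝ] q₂, ∀ g (X : q₁), (φ ⟨ρ g X, h₁.1 g X X.2⟩ : V) = ρ g (φ X))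
    {X Y : V} (hX : X ∈ q₁) (hY : Y ∈ q₂) : b X Y = 0 := by
  obtain ⟨T, hT, hTe⟩ := exists_equivariant_of_invariant_pairing hp hβ hb h₁.1 h₂.1
  have hker : IsInvariantSubspace ρ ((LinearMap.ker T).map q₁.subtype) := by
    rintro g _ ⟨Z, hZ, rfl⟩
    refine ⟨⟨ρ g Z, h₁.1 g Z Z.2⟩, ?_, rfl⟩
    have hZ0 : T Z = 0 := hZ
    have := hTe g Z
    rw [hZ0] at this
    exact Subtype.ext (by simpa using this)
  have hrange : IsInvariantSubspace ρ ((LinearMap.range T).map q₂.subtype) := by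
    rintro g _ ⟨_, ⟨Z, rfl⟩, rfl⟩
    exact ⟨_, ⟨⟨ρ g Z, h₁.1 g Z Z.2⟩, rfl⟩, hTe g Z⟩
  rcases h₁.2.2 _ (Submodule.map_subtype_le _ _) hker with h | h
  · have hinj : LinearMap.ker T = ⊥ := by
      apply Submodule.map_injective_of_injective q₁.injective_subtype
      rw [h, Submodule.map_bot]
    rcases h₂.2.2 _ (Submodule.map_subtype_le _ _) hrange with h' | h'
    · have hT0 : LinearMap.range T = ⊥ := by
        apply Submodule.map_injective_of_injective q₂.injective_subtype
        rw [h', Submodule.map_bot]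
      rw [← hT ⟨X, hX⟩ ⟨Y, hY⟩, LinearMap.range_eq_bot.1 hT0]
      simp
    · have hsurj : LinearMap.range T = ⊤ := by
        apply Submodule.map_injective_of_injective q₂.injective_subtype
        rw [h', Submodule.map_subtype_top]
      exact absurd ⟨LinearEquiv.ofBijective T ⟨LinearMap.ker_eq_bot.1 hinj,
        LinearMap.range_eq_top.1 hsurj⟩, hTe⟩ hne
  · have htop : LinearMap.ker T = ⊤ := by
      apply Submodule.map_injective_of_injective q₁.injective_subtype
      rw [h, Submodule.map_subtype_top]
    rw [← hT ⟨X, hX⟩ ⟨Y, hY⟩, LinearMap.ker_eq_top.1 htop]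
    simp

/-- The equivariant T representing b is self-adjoint, so it has an eigenvector, and the eigenspace,
being invariant, is all of q. Symmetry of b matters: a real irreducible representation may carry
invariant skew forms. -/
theorem invariant_form_eq_smul (hs : ∀ X Y, β X Y = β Y X) (hp : ∀ X, X ≠ 0 → 0 < β X X)
    (hβ : ∀ g X Y, β (ρ g X) (ρ g Y) = β X Y) (hb : ∀ g X Y, b (ρ g X) (ρ g Y) = b X Y)
    {q : Submodule ℝ V} (h : IsIrreducibleSubspace ρ q)
    (hbs : ∀ X ∈ q, ∀ Y ∈ q, b X Y = b Y X) :
    ∃ c : ℝ, ∀ X ∈ q, ∀ Y ∈ q, b X Y = c * β X Y := by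
  obtain ⟨T, hT, hTe⟩ := exists_equivariant_of_invariant_pairing hp hβ hb h.1 h.1
  have : Nontrivial q := Submodule.nontrivial_iff_ne_bot.2 h.2.1
  obtain ⟨c, v, hv, hvc⟩ := exists_eigenvector_of_symmetric (β.restrict q)
    (fun X Y => hs X Y) (fun X hX => hp X (by simpa using hX)) T
    (fun X Y => by
      change β (T X) Y = β X (T Y)
      rw [hT, hs, hT]
      exact hbs X X.2 Y Y.2)
  have hinv : IsInvariantSubspace ρ
      ((LinearMap.ker (T - c • LinearMap.id)).map q.subtype) := by
    rintro g _ ⟨Z, hZ, rfl⟩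
    refine ⟨⟨ρ g Z, h.1 g Z Z.2⟩, ?_, rfl⟩
    have hZ0 : T Z = c • Z := by simpa [sub_eq_zero] using hZ
    have h1 := hTe g Z
    rw [hZ0] at h1
    have h2 : T ⟨ρ g Z, h.1 g Z Z.2⟩ = c • ⟨ρ g Z, h.1 g Z Z.2⟩ :=
      Subtype.ext (by simpa using h1)
    simp [h2]
  refine ⟨c, fun X hX Y hY => ?_⟩
  rcases h.2.2 _ (Submodule.map_subtype_le _ _) hinv with h' | h'
  · have h0 : LinearMap.ker (T - c • LinearMap.id) = ⊥ := by
      apply Submodule.map_injective_of_injective q.injective_subtype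
      rw [h', Submodule.map_bot]
    have : v ∈ LinearMap.ker (T - c • LinearMap.id) := by simp [hvc]
    rw [h0] at this
    exact absurd (by simpa using this) hv
  · have hXm : X ∈ (LinearMap.ker (T - c • LinearMap.id)).map q.subtype := by rw [h']; exact hX
    obtain ⟨Z, hZ, rfl⟩ := hXm
    have hZ0 : T Z = c • Z := by simpa [sub_eq_zero] using hZ
    have := hT Z ⟨Y, hY⟩
    rw [hZ0] at this
    simpa using this.symm

end Schur

/-! ### The isotropy representation with two inequivalent summands. -/

section TwoSummands

variable {E : Type*} [NormedAddCommGroup E] [NormedSpace ℝ E] [FiniteDimensional ℝ E]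
  {F : Type*} [NormedAddCommGroup F] [NormedSpace ℝ F]
  {G : Type*} [TopologicalSpace G] [ChartedSpace E G] [Group G] [LieGroup 𝓘(ℝ, E) ∞ G]
  {K : Subgroup G} [ChartedSpace F K]

/-- The isotropy representation, as a representation of `K`. -/
def IsotropyRep.rep (D : IsotropyRep E F K) : Representation ℝ K D.𝔭 where
  toFun k := (Ad (k : G)).restrict fun X hX => D.invariant k k.2 X hX
  map_one' := by
    ext X
    simp [LinearMap.restrict_apply, Ad_one]
  map_mul' x y := by
    ext X
    simp [LinearMap.restrict_apply, Ad_mul]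

theorem IsotropyRep.coe_rep (D : IsotropyRep E F K) (k : K) (X : D.𝔭) :
    (D.rep k X : GroupLieAlgebra 𝓘(ℝ, E) G) = Ad (k : G) (X : GroupLieAlgebra 𝓘(ℝ, E) G) := rfl

/-- The negative of the Killing form on the isotropy representation. -/
def IsotropyRep.negKilling (D : IsotropyRep E F K) : LinearMap.BilinForm ℝ D.𝔭 :=
  -(killingForm ℝ (GroupLieAlgebra 𝓘(ℝ, E) G)).restrict D.𝔭

theorem IsotropyRep.negKilling_apply (D : IsotropyRep E F K) (X Y : D.𝔭) :
    D.negKilling X Y = -killingForm ℝ (GroupLieAlgebra 𝓘(ℝ, E) G) X Y := rfl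

theorem IsotropyRep.negKilling_symm (D : IsotropyRep E F K) (X Y : D.𝔭) :
    D.negKilling X Y = D.negKilling Y X := by
  rw [negKilling_apply, negKilling_apply, LieModule.traceForm_comm]

theorem IsotropyRep.negKilling_rep (D : IsotropyRep E F K) (k : K) (X Y : D.𝔭) :
    D.negKilling (D.rep k X) (D.rep k Y) = D.negKilling X Y := by
  rw [negKilling_apply, negKilling_apply, coe_rep, coe_rep, killingForm_Ad]

theorem InvariantMetric.form_rep {D : IsotropyRep E F K} (g : InvariantMetric D) (k : K)
    (X Y : D.𝔭) : g.form (D.rep k X) (D.rep k Y) = g.form X Y :=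
  g.invariant k k.2 X Y

/-- The isotropy representation is the sum of two inequivalent irreducible summands, on which `Q`
is a multiple of the Killing form. -/
structure IsTwoSummand {D : IsotropyRep E F K} (Q : InvariantMetric D)
    (𝔭₁ 𝔭₂ : Submodule ℝ (GroupLieAlgebra 𝓘(ℝ, E) G)) : Prop where
  sup : 𝔭₁ ⊔ 𝔭₂ = D.𝔭
  disj : Disjoint 𝔭₁ 𝔭₂
  irr₁ : IsAdIrreducible K 𝔭₁
  irr₂ : IsAdIrreducible K 𝔭₂
  ineq : ¬ AdEquivalent K 𝔭₁ 𝔭₂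
  neg₁ : Q.IsNegKillingOn 𝔭₁
  neg₂ : Q.IsNegKillingOn 𝔭₂

theorem IsotropyRep.isIrreducibleSubspace_comap (D : IsotropyRep E F K)
    {W : Submodule ℝ (GroupLieAlgebra 𝓘(ℝ, E) G)} (hW : W ≤ D.𝔭) (h : IsAdIrreducible K W) :
    IsIrreducibleSubspace D.rep (W.comap D.𝔭.subtype) := by
  have hmap : (W.comap D.𝔭.subtype).map D.𝔭.subtype = W := by
    rw [Submodule.map_comap_subtype, inf_eq_right.2 hW]
  have hinj : Function.Injective (Submodule.map D.𝔭.subtype) :=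
    Submodule.map_injective_of_injective D.𝔭.injective_subtype
  refine ⟨fun k X hX => h.1 k k.2 X hX, fun h0 => h.2.1 ?_, fun q' hq' hinv => ?_⟩
  · rw [← hmap, h0, Submodule.map_bot]
  · have hle : q'.map D.𝔭.subtype ≤ W := by
      rw [← hmap]
      exact Submodule.map_mono hq'
    rcases h.2.2 _ hle (by
      rintro k hk _ ⟨X, hX, rfl⟩
      exact ⟨D.rep ⟨k, hk⟩ X, hinv ⟨k, hk⟩ X hX, rfl⟩) with h' | h'
    · exact Or.inl (hinj (by rw [h', Submodule.map_bot]))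
    · exact Or.inr (hinj (by rw [h', hmap]))

namespace IsTwoSummand

variable {D : IsotropyRep E F K} {Q : InvariantMetric D}
  {𝔭₁ 𝔭₂ : Submodule ℝ (GroupLieAlgebra 𝓘(ℝ, E) G)} (H : IsTwoSummand Q 𝔭₁ 𝔭₂)

include H

theorem le₁ : 𝔭₁ ≤ D.𝔭 := H.sup ▸ le_sup_left

theorem le₂ : 𝔭₂ ≤ D.𝔭 := H.sup ▸ le_sup_right

theorem irreducible₁ : IsIrreducibleSubspace D.rep (𝔭₁.comap D.𝔭.subtype) :=
  D.isIrreducibleSubspace_comap H.le₁ H.irr₁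

theorem irreducible₂ : IsIrreducibleSubspace D.rep (𝔭₂.comap D.𝔭.subtype) :=
  D.isIrreducibleSubspace_comap H.le₂ H.irr₂

theorem isCompl : IsCompl (𝔭₁.comap D.𝔭.subtype) (𝔭₂.comap D.𝔭.subtype) := by
  constructor
  · rw [Submodule.disjoint_def]
    intro X hX hY
    have := Submodule.disjoint_def.1 H.disj X hX hY
    exact Subtype.ext this
  · rw [codisjoint_iff, eq_top_iff]
    intro X _
    have hX : (X : GroupLieAlgebra 𝓘(ℝ, E) G) ∈ 𝔭₁ ⊔ 𝔭₂ := by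
      rw [H.sup]
      exact X.2
    obtain ⟨Y, hY, Z, hZ, hYZ⟩ := Submodule.mem_sup.1 hX
    exact Submodule.mem_sup.2 ⟨⟨Y, H.le₁ hY⟩, hY, ⟨Z, H.le₂ hZ⟩, hZ, Subtype.ext hYZ⟩

theorem invariant_pairing_eq_zero {b : LinearMap.BilinForm ℝ D.𝔭}
    (hb : ∀ k X Y, b (D.rep k X) (D.rep k Y) = b X Y) {X Y : D.𝔭}
    (hX : (X : GroupLieAlgebra 𝓘(ℝ, E) G) ∈ 𝔭₁) (hY : (Y : GroupLieAlgebra 𝓘(ℝ, E) G) ∈ 𝔭₂) :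
    b X Y = 0 := by
  refine _root_.invariant_pairing_eq_zero (ρ := D.rep) Q.pos Q.form_rep hb H.irreducible₁
    H.irreducible₂ ?_ hX hY
  rintro ⟨φ, hφ⟩
  apply H.ineq
  let e₁ := Submodule.comapSubtypeEquivOfLe H.le₁
  let e₂ := Submodule.comapSubtypeEquivOfLe H.le₂
  refine ⟨e₁.symm.trans (φ.trans e₂), fun k hk X Y hXY => ?_⟩
  have h1 := hφ ⟨k, hk⟩ (e₁.symm X)
  have h2 : (⟨D.rep ⟨k, hk⟩ (e₁.symm X), H.irreducible₁.1 _ _ (e₁.symm X).2⟩ :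
      𝔭₁.comap D.𝔭.subtype) = e₁.symm Y := by
    apply Subtype.ext
    apply Subtype.ext
    exact hXY
  rw [h2] at h1
  exact (congrArg Subtype.val h1).symm

theorem invariant_pairing_eq_zero' {b : LinearMap.BilinForm ℝ D.𝔭}
    (hb : ∀ k X Y, b (D.rep k X) (D.rep k Y) = b X Y) {X Y : D.𝔭}
    (hX : (X : GroupLieAlgebra 𝓘(ℝ, E) G) ∈ 𝔭₂) (hY : (Y : GroupLieAlgebra 𝓘(ℝ, E) G) ∈ 𝔭₁) :
    b X Y = 0 :=
  H.invariant_pairing_eq_zero (b := b.flip) (fun k X Y => hb k Y X) hY hX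

/-- Every invariant metric is diagonal. -/
theorem exists_isDiagonal (g : InvariantMetric D) : ∃ x₁ x₂, g.IsDiagonal Q 𝔭₁ 𝔭₂ x₁ x₂ := by
  obtain ⟨x₁, h₁⟩ := invariant_form_eq_smul Q.symm Q.pos Q.form_rep g.form_rep H.irreducible₁
    fun X _ Y _ => g.symm X Y
  obtain ⟨x₂, h₂⟩ := invariant_form_eq_smul Q.symm Q.pos Q.form_rep g.form_rep H.irreducible₂
    fun X _ Y _ => g.symm X Y
  have pos : ∀ {q : Submodule ℝ D.𝔭} {x : ℝ}, q ≠ ⊥ →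
      (∀ X ∈ q, ∀ Y ∈ q, g.form X Y = x * Q.form X Y) → 0 < x := by
    intro q x hq hx
    obtain ⟨X, hX, hX0⟩ := Submodule.exists_mem_ne_zero_of_ne_bot hq
    have h := hx X hX X hX
    have h1 := g.pos X hX0
    rw [h] at h1
    exact pos_of_mul_pos_left h1 (Q.pos X hX0).le
  exact ⟨x₁, x₂, pos H.irreducible₁.2.1 h₁, pos H.irreducible₂.2.1 h₂,
    fun X Y hX hY => h₁ X hX Y hY, fun X Y hX hY => h₂ X hX Y hY,
    fun X Y hX hY => H.invariant_pairing_eq_zero g.form_rep hX hY⟩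

/-- On each summand the form is bᵢQ, and the cross terms vanish by Schur's lemma. -/
theorem negKilling_pos (X : D.𝔭) (hX : X ≠ 0) : 0 < D.negKilling X X := by
  obtain ⟨b₁, hb₁, h₁⟩ := H.neg₁
  obtain ⟨b₂, hb₂, h₂⟩ := H.neg₂
  have hXt : X ∈ 𝔭₁.comap D.𝔭.subtype ⊔ 𝔭₂.comap D.𝔭.subtype := by
    rw [H.isCompl.sup_eq_top]; trivial
  obtain ⟨Y, hY, Z, hZ, rfl⟩ := Submodule.mem_sup.1 hXt
  have hYZ : D.negKilling Y Z = 0 := H.invariant_pairing_eq_zero D.negKilling_rep hY hZ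
  have hZY : D.negKilling Z Y = 0 := by rw [D.negKilling_symm, hYZ]
  have hYY : D.negKilling Y Y = b₁ * Q.form Y Y := h₁ Y Y hY hY
  have hZZ : D.negKilling Z Z = b₂ * Q.form Z Z := h₂ Z Z hZ hZ
  simp only [map_add, LinearMap.add_apply, hYZ, hZY, hYY, hZZ, add_zero, zero_add]
  have nonneg : ∀ W, 0 ≤ Q.form W W := fun W => by
    by_cases h : W = 0
    · simp [h]
    · exact (Q.pos W h).le
  by_cases hY0 : Y = 0
  · have hZ0 : Z ≠ 0 := by
      rintro rfl
      exact hX (by simp [hY0])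
    have := mul_pos hb₂ (Q.pos Z hZ0)
    have := mul_nonneg hb₁.le (nonneg Y)
    linarith
  · have := mul_pos hb₁ (Q.pos Y hY0)
    have := mul_nonneg hb₂.le (nonneg Z)
    linarith

/-- A basis of the isotropy representation which is orthonormal for the Killing form, and adapted
to the decomposition in two summands. -/
theorem exists_adapted_basis :
    ∃ (b₁ b₂ : ℝ) (n₁ n₂ : ℕ) (e : Module.Basis (Fin n₁ ⊕ Fin n₂) ℝ D.𝔭),
      0 < b₁ ∧ 0 < b₂ ∧ 0 < n₁ ∧ 0 < n₂ ∧
      (∀ i j, D.negKilling (e i) (e j) = if i = j then 1 else 0) ∧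
      (∀ i, (e (Sum.inl i) : GroupLieAlgebra 𝓘(ℝ, E) G) ∈ 𝔭₁) ∧
      (∀ i, (e (Sum.inr i) : GroupLieAlgebra 𝓘(ℝ, E) G) ∈ 𝔭₂) ∧
      (∀ X Y : D.𝔭, (X : GroupLieAlgebra 𝓘(ℝ, E) G) ∈ 𝔭₁ →
        (Y : GroupLieAlgebra 𝓘(ℝ, E) G) ∈ 𝔭₁ → D.negKilling X Y = b₁ * Q.form X Y) ∧
      (∀ X Y : D.𝔭, (X : GroupLieAlgebra 𝓘(ℝ, E) G) ∈ 𝔭₂ →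
        (Y : GroupLieAlgebra 𝓘(ℝ, E) G) ∈ 𝔭₂ → D.negKilling X Y = b₂ * Q.form X Y) := by
  obtain ⟨b₁, hb₁, h₁⟩ := H.neg₁
  obtain ⟨b₂, hb₂, h₂⟩ := H.neg₂
  set q₁ := 𝔭₁.comap D.𝔭.subtype with hq₁
  set q₂ := 𝔭₂.comap D.𝔭.subtype with hq₂
  have aux : ∀ q : Submodule ℝ D.𝔭, ∃ e : Module.Basis (Fin (Module.finrank ℝ q)) ℝ q,
      ∀ i j, D.negKilling (e i) (e j) = if i = j then 1 else 0 := fun q =>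
    exists_orthonormal_basis_of_pos (D.negKilling.restrict q)
      (fun X Y => D.negKilling_symm X Y) (fun X hX => H.negKilling_pos X (by simpa using hX))
  obtain ⟨e₁, he₁⟩ := aux q₁
  obtain ⟨e₂, he₂⟩ := aux q₂
  let e := (e₁.prod e₂).map (Submodule.prodEquivOfIsCompl q₁ q₂ H.isCompl)
  have hl : ∀ i, e (Sum.inl i) = e₁ i := fun i => by simp [e]
  have hr : ∀ i, e (Sum.inr i) = e₂ i := fun i => by simp [e]
  have : Nontrivial q₁ := Submodule.nontrivial_iff_ne_bot.2 H.irreducible₁.2.1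
  have : Nontrivial q₂ := Submodule.nontrivial_iff_ne_bot.2 H.irreducible₂.2.1
  refine ⟨b₁, b₂, _, _, e, hb₁, hb₂, Module.finrank_pos, Module.finrank_pos, ?_, ?_, ?_, h₁, h₂⟩
  · rintro (i | i) (j | j)
    · rw [hl, hl, he₁]; simp
    · rw [hl, hr]
      simpa using H.invariant_pairing_eq_zero D.negKilling_rep (e₁ i).2 (e₂ j).2
    · rw [hl, hr]
      simpa using H.invariant_pairing_eq_zero' D.negKilling_rep (e₂ i).2 (e₁ j).2
    · rw [hr, hr, he₂]; simp
  · intro i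
    rw [hl]
    exact (e₁ i).2
  · intro i
    rw [hr]
    exact (e₂ i).2

end IsTwoSummand

end TwoSummands

/-! ### Scaling, continuity and norm of the curvature of diagonal metrics. -/

namespace Reductive

variable {L : Type*} [LieRing L] [LieAlgebra ℝ L] {𝔭 𝔨 : Submodule ℝ L} {hc : IsCompl 𝔭 𝔨}
  {g : LinearMap.BilinForm ℝ 𝔭}

/-- The connection coefficients are homogeneous of degree 0 in the metric. Hence |Rm| is a function
of the ratio divided by x₂. -/
theorem curvComp_smul {ι : Type*} [Fintype ι] {N : LinearMap.BilinForm ℝ 𝔭}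
    {e : Module.Basis ι ℝ 𝔭} (x : ι → ℝ) {s : ℝ} (hs : s ≠ 0) (i j k l : ι) :
    curvComp hc N e (fun a => s * x a) i j k l = curvComp hc N e x i j k l := by
  have h : ∀ a b d, connCoeff (fun a => s * x a) a b d = connCoeff x a b d := by
    intro a b d
    simp only [connCoeff]
    rw [show s * x d + s * x b - s * x a = s * (x d + x b - x a) by ring,
      show 2 * (s * x d) = s * (2 * x d) by ring, mul_div_mul_left _ _ hs]
  simp only [curvComp, h]

theorem continuousOn_curvComp {ι : Type*} [Fintype ι] {N : LinearMap.BilinForm ℝ 𝔭}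
    {e : Module.Basis ι ℝ 𝔭} {x : ℝ → ι → ℝ} {s : Set ℝ}
    (hx : ∀ a, ContinuousOn (fun y => x y a) s) (hx0 : ∀ y ∈ s, ∀ a, x y a ≠ 0) (i j k l : ι) :
    ContinuousOn (fun y => curvComp hc N e (x y) i j k l) s := by
  have h : ∀ a b d, ContinuousOn (fun y => connCoeff (x y) a b d) s := by
    intro a b d
    simp only [connCoeff]
    exact (((hx d).add (hx b)).sub (hx a)).div (continuousOn_const.mul (hx d))
      fun y hy => mul_ne_zero two_ne_zero (hx0 y hy d)
  simp only [curvComp]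
  refine ((ContinuousOn.sub ?_ ?_).sub ?_).sub continuousOn_const
  · exact continuousOn_finsetSum _ fun d _ =>
      ((h _ _ _).mul continuousOn_const).mul ((h _ _ _).mul continuousOn_const)
  · exact continuousOn_finsetSum _ fun d _ =>
      ((h _ _ _).mul continuousOn_const).mul ((h _ _ _).mul continuousOn_const)
  · exact continuousOn_finsetSum _ fun d _ =>
      continuousOn_const.mul ((h _ _ _).mul continuousOn_const)

variable [FiniteDimensional ℝ L]

/-- The Ricci tensor as a bilinear form. -/
def ricciForm (hc : IsCompl 𝔭 𝔨) (g : LinearMap.BilinForm ℝ 𝔭) (hg : g.Nondegenerate) :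
    LinearMap.BilinForm ℝ 𝔭 :=
  LinearMap.mk₂ ℝ (ricci hc g hg)
    (by
      intro X X' Y
      rw [ricci, ricci, ricci, ← map_add]
      congr 1
      ext1 Z
      exact (isLinearMap_curvature_middle Z Y).map_add X X')
    (by
      intro r X Y
      rw [ricci, ricci, ← map_smul]
      congr 1
      ext1 Z
      exact (isLinearMap_curvature_middle Z Y).map_smul r X)
    (by
      intro X Y Y'
      rw [ricci, ricci, ricci, ← map_add]
      congr 1
      ext1 Z
      exact (isLinearMap_curvature_right Z X).map_add Y Y')
    (by
      intro r X Y
      rw [ricci, ricci, ← map_smul]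
      congr 1
      ext1 Z
      exact (isLinearMap_curvature_right Z X).map_smul r Y)

theorem ricciForm_apply (hg : g.Nondegenerate) (X Y : 𝔭) :
    ricciForm hc g hg X Y = ricci hc g hg X Y := rfl

variable {ι : Type*} [Fintype ι] [DecidableEq ι]

/-- Evaluate in the g-orthonormal basis eᵢ/√xᵢ. The factor x_l in the numerator converts N to g in
the last slot. -/
theorem sum_sq_curvature_diagonal {N : LinearMap.BilinForm ℝ 𝔭} {e : Module.Basis ι ℝ 𝔭}
    {x : ι → ℝ} (hN : ∀ X Y : 𝔭, N X Y = -killingForm ℝ L X Y)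
    (hort : ∀ X ∈ 𝔨, ∀ Y ∈ 𝔭, killingForm ℝ L X Y = 0)
    (he : ∀ i j, N (e i) (e j) = if i = j then 1 else 0)
    (hx : ∀ i j, g (e i) (e j) = if i = j then x i else 0) (hx0 : ∀ i, 0 < x i)
    (hg : g.Nondegenerate) (hs : ∀ X Y, g X Y = g Y X)
    {ι' : Type*} [Fintype ι'] [DecidableEq ι'] {f : Module.Basis ι' ℝ 𝔭}
    (hf : ∀ i j, g (f i) (f j) = if i = j then 1 else 0) :
    ∑ i, ∑ j, ∑ k, ∑ l, g (curvature hc g hg (f i) (f j) (f k)) (f l) ^ 2 =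
      ∑ i, ∑ j, ∑ k, ∑ l, (x l * curvComp hc N e x i j k l) ^ 2 / (x i * x j * x k * x l) := by
  have hu : ∀ i, IsUnit (√(x i))⁻¹ := fun i =>
    (inv_ne_zero (Real.sqrt_pos.2 (hx0 i)).ne').isUnit
  have hu2 : ∀ i, ((√(x i))⁻¹) ^ 2 = (x i)⁻¹ := fun i => by
    rw [inv_pow, Real.sq_sqrt (hx0 i).le]
  let f' := e.isUnitSMul hu
  have hf' : ∀ i, f' i = (√(x i))⁻¹ • e i := fun i => Module.Basis.isUnitSMul_apply hu i
  have hfo : ∀ i j, g (f' i) (f' j) = if i = j then 1 else 0 := by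
    intro i j
    rw [hf', hf', map_smul, map_smul, LinearMap.smul_apply, hx]
    split_ifs with h
    · subst h
      rw [smul_eq_mul, smul_eq_mul, ← mul_assoc, ← pow_two, hu2, inv_mul_cancel₀ (hx0 i).ne']
    · simp
  rw [sum_sq_curvature_eq_of_orthonormal hs hf hfo]
  refine Finset.sum_congr rfl fun i _ => Finset.sum_congr rfl fun j _ =>
    Finset.sum_congr rfl fun k _ => Finset.sum_congr rfl fun l _ => ?_
  rw [hf', hf', hf', hf', (isLinearMap_curvature_left _ _).map_smul,
    (isLinearMap_curvature_middle _ _).map_smul, (isLinearMap_curvature_right _ _).map_smul]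
  simp only [map_smul, LinearMap.smul_apply, smul_eq_mul]
  rw [form_basis_right he hx, curvature_basis hN hort he hx (fun i => (hx0 i).ne')]
  simp only [mul_pow, hu2]
  have := hx0 i
  have := hx0 j
  have := hx0 k
  have := hx0 l
  field_simp

omit [DecidableEq ι] in
theorem ricci_eq_zero_of_sum_sq_curvature (hg : g.Nondegenerate) {f : Module.Basis ι ℝ 𝔭}
    (h : ∑ i, ∑ j, ∑ k, ∑ l, g (curvature hc g hg (f i) (f j) (f k)) (f l) ^ 2 = 0) (X Y : 𝔭) :
    ricci hc g hg X Y = 0 := by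
  have h1 : ∀ i j k, curvature hc g hg (f i) (f j) (f k) = 0 := by
    intro i j k
    refine hg.1 _ fun W => ?_
    have h2 : g (curvature hc g hg (f i) (f j) (f k)) = 0 := by
      refine f.ext fun l => ?_
      have nn : ∀ i j k, 0 ≤ ∑ l, g (curvature hc g hg (f i) (f j) (f k)) (f l) ^ 2 :=
        fun i j k => Finset.sum_nonneg fun l _ => sq_nonneg _
      have t1 := (Finset.sum_eq_zero_iff_of_nonneg fun i _ => Finset.sum_nonneg fun j _ =>
        Finset.sum_nonneg fun k _ => nn i j k).1 h i (Finset.mem_univ _)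
      have t2 := (Finset.sum_eq_zero_iff_of_nonneg fun j _ =>
        Finset.sum_nonneg fun k _ => nn i j k).1 t1 j (Finset.mem_univ _)
      have t3 := (Finset.sum_eq_zero_iff_of_nonneg fun k _ => nn i j k).1 t2 k (Finset.mem_univ _)
      have t4 := (Finset.sum_eq_zero_iff_of_nonneg fun l _ => sq_nonneg _).1 t3 l
        (Finset.mem_univ _)
      simpa using t4
    rw [h2]; rfl
  have h3 : ricciForm hc g hg = 0 := by
    refine f.ext fun j => f.ext fun k => ?_
    rw [ricciForm_apply, ricci]
    have : curvatureEnd hc g hg (f j) (f k) = 0 := f.ext fun i => h1 i j k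
    rw [this, map_zero]; rfl
  rw [← ricciForm_apply, h3]; rfl

end Reductive

/-- The coefficients of the Ricci tensor of the diagonal metrics on a homogeneous space with two
isotropy summands. -/
structure RicciCoeffs where
  /-- constant term on the first summand -/
  a₁ : ℝ
  /-- minus the coefficient of `x₂ / x₁` on the first summand -/
  m₁ : ℝ
  /-- coefficient of `(x₁ / x₂)²` on the first summand -/
  n₁ : ℝ
  /-- constant term on the second summand -/
  a₂ : ℝ
  /-- coefficient of `(x₂ / x₁)²` on the second summand -/
  m₂ : ℝ
  /-- minus the coefficient of `x₁ / x₂` on the second summand -/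
  n₂ : ℝ

namespace RicciCoeffs

/-- The Ricci curvature on the first summand, as a function of `y = x₁ / x₂`. -/
def rho₁ (C : RicciCoeffs) (y : ℝ) : ℝ := C.a₁ - C.m₁ / y + C.n₁ * y ^ 2

/-- The Ricci curvature on the second summand, as a function of `y = x₁ / x₂`. -/
def rho₂ (C : RicciCoeffs) (y : ℝ) : ℝ := C.a₂ - C.n₂ * y + C.m₂ / y ^ 2

/-- The sign conditions satisfied by the coefficients of the Ricci tensor. -/
structure IsAdmissible (C : RicciCoeffs) : Prop where
  a₁_nonneg : 0 ≤ C.a₁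
  a₂_nonneg : 0 ≤ C.a₂
  m₁_nonneg : 0 ≤ C.m₁
  m₂_nonneg : 0 ≤ C.m₂
  n₁_nonneg : 0 ≤ C.n₁
  n₂_nonneg : 0 ≤ C.n₂
  m_iff : C.m₁ = 0 ↔ C.m₂ = 0
  n_iff : C.n₁ = 0 ↔ C.n₂ = 0
  le : C.m₁ * C.n₂ ≤ C.a₁ * C.a₂

end RicciCoeffs

/-! ### Traces of the Ricci tensor over the two summands. -/

namespace Reductive

variable {L : Type*} [LieRing L] [LieAlgebra ℝ L] {𝔭 𝔨 : Submodule ℝ L} {hc : IsCompl 𝔭 𝔨}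
  {g N : LinearMap.BilinForm ℝ 𝔭}

theorem structConst_sq_swap_left {ι : Type*} {e : Module.Basis ι ℝ 𝔭} (a b d : ι) :
    structConst hc N e b a d ^ 2 = structConst hc N e a b d ^ 2 := by
  rw [structConst_swap_left, neg_sq]

theorem structConst_sq_swap_right {ι : Type*} {e : Module.Basis ι ℝ 𝔭}
    (hN : ∀ X Y : 𝔭, N X Y = -killingForm ℝ L X Y)
    (hort : ∀ X ∈ 𝔨, ∀ Y ∈ 𝔭, killingForm ℝ L X Y = 0) (a b d : ι) :
    structConst hc N e a d b ^ 2 = structConst hc N e a b d ^ 2 := by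
  rw [structConst_swap_right hN hort, neg_sq]

/-- The sum of the squares of the structure constants with indices in three given families. -/
def structSum {ι : Type*} (hc : IsCompl 𝔭 𝔨) (N : LinearMap.BilinForm ℝ 𝔭)
    (e : Module.Basis ι ℝ 𝔭) {α β γ : Type*} [Fintype α] [Fintype β] [Fintype γ]
    (u : α → ι) (v : β → ι) (w : γ → ι) : ℝ :=
  ∑ i, ∑ j, ∑ k, structConst hc N e (u i) (v j) (w k) ^ 2

section StructSum

variable {ι : Type*} {e : Module.Basis ι ℝ 𝔭} {α β γ : Type*} [Fintype α] [Fintype β] [Fintype γ]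
  (u : α → ι) (v : β → ι) (w : γ → ι)

theorem structSum_nonneg : 0 ≤ structSum hc N e u v w :=
  Finset.sum_nonneg fun _ _ => Finset.sum_nonneg fun _ _ => Finset.sum_nonneg fun _ _ =>
    sq_nonneg _

theorem structSum_swap_left : structSum hc N e v u w = structSum hc N e u v w := by
  simp only [structSum]
  rw [Finset.sum_comm]
  simp only [structConst_sq_swap_left]

theorem structSum_swap_right (hN : ∀ X Y : 𝔭, N X Y = -killingForm ℝ L X Y)
    (hort : ∀ X ∈ 𝔨, ∀ Y ∈ 𝔭, killingForm ℝ L X Y = 0) :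
    structSum hc N e u w v = structSum hc N e u v w := by
  simp only [structSum]
  refine Finset.sum_congr rfl fun i _ => ?_
  rw [Finset.sum_comm]
  simp only [structConst_sq_swap_right hN hort (u i)]

end StructSum

/-- The contribution of the isotropy algebra to the trace of the Ricci tensor. -/
def isotropySum {ι α : Type*} [Fintype ι] [Fintype α] (hc : IsCompl 𝔭 𝔨)
    (e : Module.Basis ι ℝ 𝔭) (u : α → ι) : ℝ :=
  ∑ a, ∑ i, - killingForm ℝ L (bracketK hc (e i) (e (u a))) (bracketK hc (e i) (e (u a)))

variable [FiniteDimensional ℝ L] {ι₁ ι₂ : Type*} [Fintype ι₁] [Fintype ι₂] [DecidableEq ι₁]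
  [DecidableEq ι₂] {e : Module.Basis (ι₁ ⊕ ι₂) ℝ 𝔭}

/-- Split the double sum of `ricci_basis_of_eq` by the summands of i and d. Pairs (1,1) contribute
the factor 1/4, pairs (1,2) and (2,1) together 1 - z₂/(2z₁), and pairs (2,2) the factor z₁²/(4z₂²).
Total skewness identifies the two mixed sums. -/
theorem sum_ricci_inl (hN : ∀ X Y : 𝔭, N X Y = -killingForm ℝ L X Y)
    (hort : ∀ X ∈ 𝔨, ∀ Y ∈ 𝔭, killingForm ℝ L X Y = 0)
    (he : ∀ i j, N (e i) (e j) = if i = j then 1 else 0) {z₁ z₂ : ℝ} (hz₁ : z₁ ≠ 0) (hz₂ : z₂ ≠ 0)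
    (hx : ∀ i j, g (e i) (e j) = if i = j then Sum.elim (fun _ => z₁) (fun _ => z₂) i else 0)
    (hg : g.Nondegenerate) :
    ∑ a, ricci hc g hg (e (Sum.inl a)) (e (Sum.inl a)) =
      structSum hc N e Sum.inl (Sum.inl : ι₁ → ι₁ ⊕ ι₂) (Sum.inl : ι₁ → ι₁ ⊕ ι₂) / 4 +
      structSum hc N e Sum.inl (Sum.inl : ι₁ → ι₁ ⊕ ι₂) (Sum.inr : ι₂ → ι₁ ⊕ ι₂) *
        (1 - z₂ / (2 * z₁)) +
      structSum hc N e Sum.inl (Sum.inr : ι₂ → ι₁ ⊕ ι₂) (Sum.inr : ι₂ → ι₁ ⊕ ι₂) *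
        (z₁ ^ 2 / (4 * z₂ ^ 2)) +
      isotropySum hc e Sum.inl := by
  have hx0 : ∀ i : ι₁ ⊕ ι₂, (Sum.elim (fun _ => z₁) (fun _ => z₂) i : ℝ) ≠ 0 := by
    rintro (i | i) <;> assumption
  have h1 : structSum hc N e Sum.inr (Sum.inl : ι₁ → ι₁ ⊕ ι₂) (Sum.inl : ι₁ → ι₁ ⊕ ι₂) =
      structSum hc N e Sum.inl (Sum.inl : ι₁ → ι₁ ⊕ ι₂) (Sum.inr : ι₂ → ι₁ ⊕ ι₂) := by
    rw [structSum_swap_left, structSum_swap_right _ _ _ hN hort]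
  have h2 : structSum hc N e Sum.inr (Sum.inl : ι₁ → ι₁ ⊕ ι₂) (Sum.inr : ι₂ → ι₁ ⊕ ι₂) =
      structSum hc N e Sum.inl (Sum.inr : ι₂ → ι₁ ⊕ ι₂) (Sum.inr : ι₂ → ι₁ ⊕ ι₂) :=
    structSum_swap_left _ _ _
  rw [← h2]
  have h3 := h1
  simp only [ricci_basis_of_eq hN hort he hx hx0 hg rfl, Finset.sum_add_distrib]
  congr 1
  rw [Finset.sum_comm]
  simp only [Fintype.sum_sum_type, Finset.sum_add_distrib, connCoeff, Sum.elim_inl, Sum.elim_inr,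
    ← pow_two (structConst _ _ _ _ _ _), ← Finset.sum_mul]
  simp only [structSum] at h3 ⊢
  rw [h3]
  field_simp
  ring

theorem sum_ricci_inr (hN : ∀ X Y : 𝔭, N X Y = -killingForm ℝ L X Y)
    (hort : ∀ X ∈ 𝔨, ∀ Y ∈ 𝔭, killingForm ℝ L X Y = 0)
    (he : ∀ i j, N (e i) (e j) = if i = j then 1 else 0) {z₁ z₂ : ℝ} (hz₁ : z₁ ≠ 0) (hz₂ : z₂ ≠ 0)
    (hx : ∀ i j, g (e i) (e j) = if i = j then Sum.elim (fun _ => z₁) (fun _ => z₂) i else 0)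
    (hg : g.Nondegenerate) :
    ∑ a, ricci hc g hg (e (Sum.inr a)) (e (Sum.inr a)) =
      structSum hc N e Sum.inr (Sum.inr : ι₂ → ι₁ ⊕ ι₂) (Sum.inr : ι₂ → ι₁ ⊕ ι₂) / 4 +
      structSum hc N e Sum.inl (Sum.inr : ι₂ → ι₁ ⊕ ι₂) (Sum.inr : ι₂ → ι₁ ⊕ ι₂) *
        (1 - z₁ / (2 * z₂)) +
      structSum hc N e Sum.inl (Sum.inl : ι₁ → ι₁ ⊕ ι₂) (Sum.inr : ι₂ → ι₁ ⊕ ι₂) *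
        (z₂ ^ 2 / (4 * z₁ ^ 2)) +
      isotropySum hc e Sum.inr := by
  have hx0 : ∀ i : ι₁ ⊕ ι₂, (Sum.elim (fun _ => z₁) (fun _ => z₂) i : ℝ) ≠ 0 := by
    rintro (i | i) <;> assumption
  have h1 : structSum hc N e Sum.inr (Sum.inr : ι₂ → ι₁ ⊕ ι₂) (Sum.inl : ι₁ → ι₁ ⊕ ι₂) =
      structSum hc N e Sum.inl (Sum.inr : ι₂ → ι₁ ⊕ ι₂) (Sum.inr : ι₂ → ι₁ ⊕ ι₂) := by
    rw [structSum_swap_right _ _ _ hN hort, structSum_swap_left]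
  have h2 : structSum hc N e Sum.inl (Sum.inr : ι₂ → ι₁ ⊕ ι₂) (Sum.inl : ι₁ → ι₁ ⊕ ι₂) =
      structSum hc N e Sum.inl (Sum.inl : ι₁ → ι₁ ⊕ ι₂) (Sum.inr : ι₂ → ι₁ ⊕ ι₂) :=
    structSum_swap_right _ _ _ hN hort
  rw [← h2]
  have h3 := h1
  simp only [ricci_basis_of_eq hN hort he hx hx0 hg rfl, Finset.sum_add_distrib]
  congr 1
  rw [Finset.sum_comm]
  simp only [Fintype.sum_sum_type, Finset.sum_add_distrib, connCoeff, Sum.elim_inl, Sum.elim_inr,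
    ← pow_two (structConst _ _ _ _ _ _), ← Finset.sum_mul]
  simp only [structSum] at h3 ⊢
  rw [h3]
  field_simp
  ring

end Reductive

/-! ### The Ricci tensor as a function of the ratio. -/

section TwoSummandsRicci

variable {E : Type*} [NormedAddCommGroup E] [NormedSpace ℝ E] [FiniteDimensional ℝ E]
  {F : Type*} [NormedAddCommGroup F] [NormedSpace ℝ F]
  {G : Type*} [TopologicalSpace G] [ChartedSpace E G] [Group G] [LieGroup 𝓘(ℝ, E) ∞ G]
  {K : Subgroup G} [ChartedSpace F K]

/-- The action of an element of `K` on the isotropy representation, as an equivalence. -/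
def IsotropyRep.repEquiv (D : IsotropyRep E F K) (k : K) : D.𝔭 ≃ₗ[ℝ] D.𝔭 where
  __ := D.rep k
  invFun := D.rep k⁻¹
  left_inv X := D.rep.inv_self_apply k X
  right_inv X := D.rep.self_inv_apply k X

namespace IsTwoSummand

variable {D : IsotropyRep E F K} {Q : InvariantMetric D}
  {𝔭₁ 𝔭₂ : Submodule ℝ (GroupLieAlgebra 𝓘(ℝ, E) G)} (H : IsTwoSummand Q 𝔭₁ 𝔭₂)

include H

theorem negKilling_nondegenerate : D.negKilling.Nondegenerate := by
  refine ⟨fun X h => ?_, fun X h => ?_⟩ <;>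
  · by_contra hX
    exact (H.negKilling_pos X hX).ne' (h X)

theorem ricci_rep (g : InvariantMetric D) (k : K) (X Y : D.𝔭) :
    g.ricci (D.rep k X) (D.rep k Y) = g.ricci X Y := by
  have hσ : ∀ X : D.𝔭, (D.repEquiv k X : GroupLieAlgebra 𝓘(ℝ, E) G) =
      Ad (k : G) (X : GroupLieAlgebra 𝓘(ℝ, E) G) :=
    fun X => D.coe_rep k X
  have hpr := Reductive.projectionOnto_equivariant (hc := D.isCompl) H.negKilling_nondegenerate
    D.negKilling_apply D.orthogonal (killingForm_Ad (k : G)) hσ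
  have hgσ : ∀ X Y, g.form (D.repEquiv k X) (D.repEquiv k Y) = g.form X Y := g.form_rep k
  exact Reductive.ricci_equivariant (hg := g.nondegenerate) (Ad_lie (k : G)) hσ hpr hgσ X Y

/-- The eigenvalues of a diagonal metric in an adapted basis. -/
theorem form_adapted_basis {n₁ n₂ : ℕ} {e : Module.Basis (Fin n₁ ⊕ Fin n₂) ℝ D.𝔭} {b₁ b₂ : ℝ}
    (hb₁ : 0 < b₁) (hb₂ : 0 < b₂)
    (he : ∀ i j, D.negKilling (e i) (e j) = if i = j then 1 else 0)
    (he₁ : ∀ i, (e (Sum.inl i) : GroupLieAlgebra 𝓘(ℝ, E) G) ∈ 𝔭₁)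
    (he₂ : ∀ i, (e (Sum.inr i) : GroupLieAlgebra 𝓘(ℝ, E) G) ∈ 𝔭₂)
    (h₁ : ∀ X Y : D.𝔭, (X : GroupLieAlgebra 𝓘(ℝ, E) G) ∈ 𝔭₁ →
      (Y : GroupLieAlgebra 𝓘(ℝ, E) G) ∈ 𝔭₁ → D.negKilling X Y = b₁ * Q.form X Y)
    (h₂ : ∀ X Y : D.𝔭, (X : GroupLieAlgebra 𝓘(ℝ, E) G) ∈ 𝔭₂ →
      (Y : GroupLieAlgebra 𝓘(ℝ, E) G) ∈ 𝔭₂ → D.negKilling X Y = b₂ * Q.form X Y)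
    {g : InvariantMetric D} {x₁ x₂ : ℝ} (hg : g.IsDiagonal Q 𝔭₁ 𝔭₂ x₁ x₂)
    (i j : Fin n₁ ⊕ Fin n₂) :
    g.form (e i) (e j) =
      if i = j then Sum.elim (fun _ => x₁ / b₁) (fun _ => x₂ / b₂) i else 0 := by
  obtain ⟨-, -, hg₁, hg₂, -⟩ := hg
  rcases i with i | i <;> rcases j with j | j
  · have := h₁ _ _ (he₁ i) (he₁ j)
    rw [he] at this
    rw [hg₁ _ _ (he₁ i) (he₁ j)]
    simp only [Sum.inl.injEq, Sum.elim_inl] at this ⊢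
    split_ifs at this ⊢
    · rw [div_eq_mul_inv, eq_inv_of_mul_eq_one_right this.symm]
    · rcases mul_eq_zero.1 this.symm with h | h
      · exact absurd h hb₁.ne'
      · rw [h, mul_zero]
  · simpa using H.invariant_pairing_eq_zero g.form_rep (he₁ i) (he₂ j)
  · simpa using H.invariant_pairing_eq_zero' g.form_rep (he₂ i) (he₁ j)
  · have := h₂ _ _ (he₂ i) (he₂ j)
    rw [he] at this
    rw [hg₂ _ _ (he₂ i) (he₂ j)]
    simp only [Sum.inr.injEq, Sum.elim_inr] at this ⊢
    split_ifs at this ⊢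
    · rw [div_eq_mul_inv, eq_inv_of_mul_eq_one_right this.symm]
    · rcases mul_eq_zero.1 this.symm with h | h
      · exact absurd h hb₂.ne'
      · rw [h, mul_zero]

theorem ricci_eq_zero (g : InvariantMetric D) {X Y : D.𝔭}
    (hX : (X : GroupLieAlgebra 𝓘(ℝ, E) G) ∈ 𝔭₁) (hY : (Y : GroupLieAlgebra 𝓘(ℝ, E) G) ∈ 𝔭₂) :
    g.ricci X Y = 0 :=
  H.invariant_pairing_eq_zero (b := Reductive.ricciForm D.isCompl g.form g.nondegenerate)
    (H.ricci_rep g) hX hY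

theorem ricci_eq_zero' (g : InvariantMetric D) {X Y : D.𝔭}
    (hX : (X : GroupLieAlgebra 𝓘(ℝ, E) G) ∈ 𝔭₂) (hY : (Y : GroupLieAlgebra 𝓘(ℝ, E) G) ∈ 𝔭₁) :
    g.ricci X Y = 0 :=
  H.invariant_pairing_eq_zero' (b := Reductive.ricciForm D.isCompl g.form g.nondegenerate)
    (H.ricci_rep g) hX hY

/-- Within a summand the formula of `ricci_basis_of_eq` is symmetric in its two indices, and mixed
components vanish. This symmetry is the input Schur's lemma needs to make Ricci a multiple of Q on
each summand. -/
theorem ricci_symm (g : InvariantMetric D) (X Y : D.𝔭) : g.ricci X Y = g.ricci Y X := by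
  obtain ⟨b₁, b₂, n₁, n₂, e, hb₁, hb₂, -, -, he, he₁, he₂, h₁, h₂⟩ := H.exists_adapted_basis
  obtain ⟨x₁, x₂, hg⟩ := H.exists_isDiagonal g
  have hx := H.form_adapted_basis hb₁ hb₂ he he₁ he₂ h₁ h₂ hg
  have hx0 : ∀ i : Fin n₁ ⊕ Fin n₂,
      (Sum.elim (fun _ => x₁ / b₁) (fun _ => x₂ / b₂) i : ℝ) ≠ 0 := by
    rintro (i | i)
    · exact (div_pos hg.1 hb₁).ne'
    · exact (div_pos hg.2.1 hb₂).ne'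
  have key : ∀ i j, (Sum.elim (fun _ => x₁ / b₁) (fun _ => x₂ / b₂) i : ℝ) =
      (Sum.elim (fun _ => x₁ / b₁) (fun _ => x₂ / b₂) j : ℝ) →
      g.ricci (e i) (e j) = g.ricci (e j) (e i) := by
    intro i j hij
    have r := fun {i j} => Reductive.ricci_basis_of_eq (hc := D.isCompl) (a := i) (b := j)
      D.negKilling_apply D.orthogonal he hx hx0 g.nondegenerate
    refine (r hij).trans (Eq.trans ?_ (r hij.symm).symm)
    congr 1
    · exact Finset.sum_congr rfl fun k _ => Finset.sum_congr rfl fun d _ => by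
        rw [mul_comm (Reductive.structConst _ _ _ k i d), Reductive.connCoeff, Reductive.connCoeff,
          Reductive.connCoeff, Reductive.connCoeff, Reductive.connCoeff, Reductive.connCoeff, hij]
    · exact Finset.sum_congr rfl fun k _ => by rw [LieModule.traceForm_comm]
  have hB : Reductive.ricciForm D.isCompl g.form g.nondegenerate =
      (Reductive.ricciForm D.isCompl g.form g.nondegenerate).flip := by
    refine e.ext fun i => e.ext fun j => ?_
    change g.ricci (e i) (e j) = g.ricci (e j) (e i)
    rcases i with i | i <;> rcases j with j | j
    · exact key _ _ rfl
    · rw [H.ricci_eq_zero g (he₁ i) (he₂ j), H.ricci_eq_zero' g (he₂ j) (he₁ i)]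
    · rw [H.ricci_eq_zero g (he₁ j) (he₂ i), H.ricci_eq_zero' g (he₂ i) (he₁ j)]
    · exact key _ _ rfl
  exact LinearMap.congr_fun₂ hB X Y

theorem exists_ricci_eq_smul (g : InvariantMetric D) : ∃ c₁ c₂ : ℝ,
    (∀ X Y : D.𝔭, (X : GroupLieAlgebra 𝓘(ℝ, E) G) ∈ 𝔭₁ → (Y : GroupLieAlgebra 𝓘(ℝ, E) G) ∈ 𝔭₁ →
      g.ricci X Y = c₁ * Q.form X Y) ∧
    (∀ X Y : D.𝔭, (X : GroupLieAlgebra 𝓘(ℝ, E) G) ∈ 𝔭₂ → (Y : GroupLieAlgebra 𝓘(ℝ, E) G) ∈ 𝔭₂ →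
      g.ricci X Y = c₂ * Q.form X Y) := by
  obtain ⟨c₁, h₁⟩ := invariant_form_eq_smul Q.symm Q.pos Q.form_rep
    (b := Reductive.ricciForm D.isCompl g.form g.nondegenerate) (H.ricci_rep g) H.irreducible₁
    fun X _ Y _ => H.ricci_symm g X Y
  obtain ⟨c₂, h₂⟩ := invariant_form_eq_smul Q.symm Q.pos Q.form_rep
    (b := Reductive.ricciForm D.isCompl g.form g.nondegenerate) (H.ricci_rep g) H.irreducible₂
    fun X _ Y _ => H.ricci_symm g X Y
  exact ⟨c₁, c₂, fun X Y hX hY => h₁ X hX Y hY, fun X Y hX hY => h₂ X hX Y hY⟩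

end IsTwoSummand

/-- The Ricci tensor of the diagonal metrics is given by the coefficients `C`. -/
def HasRicciCoeffs {D : IsotropyRep E F K} (Q : InvariantMetric D)
    (𝔭₁ 𝔭₂ : Submodule ℝ (GroupLieAlgebra 𝓘(ℝ, E) G)) (C : RicciCoeffs) : Prop :=
  ∀ (g : InvariantMetric D) (x₁ x₂ : ℝ), g.IsDiagonal Q 𝔭₁ 𝔭₂ x₁ x₂ →
    (∀ X Y : D.𝔭, (X : GroupLieAlgebra 𝓘(ℝ, E) G) ∈ 𝔭₁ → (Y : GroupLieAlgebra 𝓘(ℝ, E) G) ∈ 𝔭₁ →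
      g.ricci X Y = C.rho₁ (x₁ / x₂) * Q.form X Y) ∧
    (∀ X Y : D.𝔭, (X : GroupLieAlgebra 𝓘(ℝ, E) G) ∈ 𝔭₂ → (Y : GroupLieAlgebra 𝓘(ℝ, E) G) ∈ 𝔭₂ →
      g.ricci X Y = C.rho₂ (x₁ / x₂) * Q.form X Y)

variable [T2Space G] [CompactSpace G]

theorem isotropySum_nonneg (D : IsotropyRep E F K) {ι α : Type*} [Fintype ι] [Fintype α]
    (e : Module.Basis ι ℝ D.𝔭) (u : α → ι) : 0 ≤ Reductive.isotropySum D.isCompl e u :=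
  Finset.sum_nonneg fun _ _ => Finset.sum_nonneg fun _ _ =>
    neg_nonneg.2 (killingForm_apply_self_nonpos _)

/-- Ricci is a multiple of Q on each summand, so its traces determine it; the traces are known from
`Reductive.sum_ricci_inl` and `Reductive.sum_ricci_inr`. -/
theorem IsTwoSummand.exists_ricciCoeffs {D : IsotropyRep E F K} {Q : InvariantMetric D}
    {𝔭₁ 𝔭₂ : Submodule ℝ (GroupLieAlgebra 𝓘(ℝ, E) G)} (H : IsTwoSummand Q 𝔭₁ 𝔭₂) :
    ∃ C : RicciCoeffs, C.IsAdmissible ∧ HasRicciCoeffs Q 𝔭₁ 𝔭₂ C := by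
  obtain ⟨b₁, b₂, n₁, n₂, e, hb₁, hb₂, hn₁, hn₂, he, he₁, he₂, h₁, h₂⟩ := H.exists_adapted_basis
  have hn₁' : (0 : ℝ) < n₁ := Nat.cast_pos.2 hn₁
  have hn₂' : (0 : ℝ) < n₂ := Nat.cast_pos.2 hn₂
  set A := Reductive.structSum D.isCompl D.negKilling e Sum.inl
    (Sum.inl : Fin n₁ → Fin n₁ ⊕ Fin n₂) (Sum.inl : Fin n₁ → Fin n₁ ⊕ Fin n₂) with hA
  set S := Reductive.structSum D.isCompl D.negKilling e Sum.inl
    (Sum.inl : Fin n₁ → Fin n₁ ⊕ Fin n₂) (Sum.inr : Fin n₂ → Fin n₁ ⊕ Fin n₂) with hS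
  set T := Reductive.structSum D.isCompl D.negKilling e Sum.inl
    (Sum.inr : Fin n₂ → Fin n₁ ⊕ Fin n₂) (Sum.inr : Fin n₂ → Fin n₁ ⊕ Fin n₂) with hT
  set U := Reductive.structSum D.isCompl D.negKilling e Sum.inr
    (Sum.inr : Fin n₂ → Fin n₁ ⊕ Fin n₂) (Sum.inr : Fin n₂ → Fin n₁ ⊕ Fin n₂) with hU
  set κ₁ := Reductive.isotropySum D.isCompl e (Sum.inl : Fin n₁ → Fin n₁ ⊕ Fin n₂) with hκ₁
  set κ₂ := Reductive.isotropySum D.isCompl e (Sum.inr : Fin n₂ → Fin n₁ ⊕ Fin n₂) with hκ₂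
  have hA0 : 0 ≤ A := Reductive.structSum_nonneg _ _ _
  have hS0 : 0 ≤ S := Reductive.structSum_nonneg _ _ _
  have hT0 : 0 ≤ T := Reductive.structSum_nonneg _ _ _
  have hU0 : 0 ≤ U := Reductive.structSum_nonneg _ _ _
  have hκ₁0 : 0 ≤ κ₁ := isotropySum_nonneg D e _
  have hκ₂0 : 0 ≤ κ₂ := isotropySum_nonneg D e _
  -- These are the coefficients of the trace formulas after substituting zᵢ = xᵢ/bᵢ and dividing by
  -- the trace nᵢ/bᵢ of Q.
  refine ⟨⟨b₁ * (A / 4 + S + κ₁) / n₁, b₁ * S * (b₁ / b₂) / (2 * n₁),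
    b₁ * T * (b₂ / b₁) ^ 2 / (4 * n₁), b₂ * (U / 4 + T + κ₂) / n₂,
    b₂ * S * (b₁ / b₂) ^ 2 / (4 * n₂), b₂ * T * (b₂ / b₁) / (2 * n₂)⟩,
    ⟨by positivity, by positivity, by positivity, by positivity, by positivity, by positivity,
      ?_, ?_, ?_⟩, ?_⟩
  · simp [hb₁.ne', hb₂.ne', hn₁.ne', hn₂.ne']
  · simp [hb₁.ne', hb₂.ne', hn₁.ne', hn₂.ne']
  -- S and T are terms of the two factors, whose other terms are nonnegative (κ₁, κ₂ by the sign of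
  -- the Killing form). The 4 comes from the halves in m₁ and n₂.
  · have hle : S * T ≤ 4 * ((A / 4 + S + κ₁) * (U / 4 + T + κ₂)) := by
      have h3 : S * T ≤ (A / 4 + S + κ₁) * (U / 4 + T + κ₂) :=
        mul_le_mul (by linarith) (by linarith) hT0 (by linarith)
      have : 0 ≤ S * T := mul_nonneg hS0 hT0
      linarith
    have h4 : b₁ * S * (b₁ / b₂) / (2 * n₁) * (b₂ * T * (b₂ / b₁) / (2 * n₂)) =
        b₁ * b₂ / (4 * n₁ * n₂) * (S * T) := by
      field_simp
      ring
    have h5 : b₁ * (A / 4 + S + κ₁) / n₁ * (b₂ * (U / 4 + T + κ₂) / n₂) =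
        b₁ * b₂ / (4 * n₁ * n₂) * (4 * ((A / 4 + S + κ₁) * (U / 4 + T + κ₂))) := by
      field_simp
    change b₁ * S * (b₁ / b₂) / (2 * n₁) * (b₂ * T * (b₂ / b₁) / (2 * n₂)) ≤
      b₁ * (A / 4 + S + κ₁) / n₁ * (b₂ * (U / 4 + T + κ₂) / n₂)
    rw [h4, h5]
    exact mul_le_mul_of_nonneg_left hle (by positivity)
  · intro g x₁ x₂ hg
    have hx := H.form_adapted_basis hb₁ hb₂ he he₁ he₂ h₁ h₂ hg
    obtain ⟨hx₁, hx₂, -⟩ := hg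
    have hz₁ : x₁ / b₁ ≠ 0 := (div_pos hx₁ hb₁).ne'
    have hz₂ : x₂ / b₂ ≠ 0 := (div_pos hx₂ hb₂).ne'
    obtain ⟨c₁, c₂, hc₁, hc₂⟩ := H.exists_ricci_eq_smul g
    have hQ₁ : ∀ i, Q.form (e (Sum.inl i)) (e (Sum.inl i)) = b₁⁻¹ := fun i => by
      have := h₁ _ _ (he₁ i) (he₁ i)
      rw [he, if_pos rfl] at this
      exact eq_inv_of_mul_eq_one_right this.symm
    have hQ₂ : ∀ i, Q.form (e (Sum.inr i)) (e (Sum.inr i)) = b₂⁻¹ := fun i => by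
      have := h₂ _ _ (he₂ i) (he₂ i)
      rw [he, if_pos rfl] at this
      exact eq_inv_of_mul_eq_one_right this.symm
    have s₁ : ∑ a, g.ricci (e (Sum.inl a)) (e (Sum.inl a)) = n₁ * (c₁ * b₁⁻¹) := by
      rw [Finset.sum_congr rfl fun a _ => (hc₁ _ _ (he₁ a) (he₁ a)).trans (by rw [hQ₁])]
      simp
    have s₂ : ∑ a, g.ricci (e (Sum.inr a)) (e (Sum.inr a)) = n₂ * (c₂ * b₂⁻¹) := by
      rw [Finset.sum_congr rfl fun a _ => (hc₂ _ _ (he₂ a) (he₂ a)).trans (by rw [hQ₂])]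
      simp
    have t₁ := s₁.symm.trans (Reductive.sum_ricci_inl D.negKilling_apply D.orthogonal he hz₁ hz₂ hx
      g.nondegenerate)
    have t₂ := s₂.symm.trans (Reductive.sum_ricci_inr D.negKilling_apply D.orthogonal he hz₁ hz₂ hx
      g.nondegenerate)
    rw [← hA, ← hS, ← hT, ← hκ₁] at t₁
    rw [← hU, ← hS, ← hT, ← hκ₂] at t₂
    have e₁ : c₁ = b₁ / n₁ * (n₁ * (c₁ * b₁⁻¹)) := by field_simp
    have e₂ : c₂ = b₂ / n₂ * (n₂ * (c₂ * b₂⁻¹)) := by field_simp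
    refine ⟨fun X Y hX hY => (hc₁ X Y hX hY).trans ?_, fun X Y hX hY => (hc₂ X Y hX hY).trans ?_⟩
    · rw [e₁, t₁, RicciCoeffs.rho₁]
      congr 1
      field_simp
      ring
    · rw [e₂, t₂, RicciCoeffs.rho₂]
      congr 1
      field_simp
      ring

end TwoSummandsRicci

/-! ### Diagonal metrics: existence, Einstein condition, curvature norm. -/

section DiagonalMetrics

variable {E : Type*} [NormedAddCommGroup E] [NormedSpace ℝ E] [FiniteDimensional ℝ E]
  {F : Type*} [NormedAddCommGroup F] [NormedSpace ℝ F]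
  {G : Type*} [TopologicalSpace G] [ChartedSpace E G] [Group G] [LieGroup 𝓘(ℝ, E) ∞ G]
  {K : Subgroup G} [ChartedSpace F K]

theorem InvariantMetric.normRm_nonneg {D : IsotropyRep E F K} (g : InvariantMetric D) :
    0 ≤ g.normRm := Real.sqrt_nonneg _

theorem InvariantMetric.ricci_eq_zero_of_normRm_eq_zero {D : IsotropyRep E F K}
    {g : InvariantMetric D} (h : g.normRm = 0) (X Y : D.𝔭) : g.ricci X Y = 0 := by
  refine Reductive.ricci_eq_zero_of_sum_sq_curvature g.nondegenerate
    (f := g.exists_orthonormal_basis.choose) ?_ X Y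
  rw [InvariantMetric.normRm, Real.sqrt_eq_zero] at h
  · exact h
  · exact Finset.sum_nonneg fun _ _ => Finset.sum_nonneg fun _ _ => Finset.sum_nonneg fun _ _ =>
      Finset.sum_nonneg fun _ _ => sq_nonneg _

namespace IsTwoSummand

variable {D : IsotropyRep E F K} {Q : InvariantMetric D}
  {𝔭₁ 𝔭₂ : Submodule ℝ (GroupLieAlgebra 𝓘(ℝ, E) G)} (H : IsTwoSummand Q 𝔭₁ 𝔭₂)

/-- The projection to the first summand. -/
def proj₁ : D.𝔭 →ₗ[ℝ] D.𝔭 :=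
  (𝔭₁.comap D.𝔭.subtype).projection (𝔭₂.comap D.𝔭.subtype) H.isCompl

/-- The projection to the second summand. -/
def proj₂ : D.𝔭 →ₗ[ℝ] D.𝔭 :=
  (𝔭₂.comap D.𝔭.subtype).projection (𝔭₁.comap D.𝔭.subtype) H.isCompl.symm

theorem proj₁_mem (X : D.𝔭) : (H.proj₁ X : GroupLieAlgebra 𝓘(ℝ, E) G) ∈ 𝔭₁ :=
  Submodule.projection_apply_mem H.isCompl X

theorem proj₂_mem (X : D.𝔭) : (H.proj₂ X : GroupLieAlgebra 𝓘(ℝ, E) G) ∈ 𝔭₂ :=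
  Submodule.projection_apply_mem H.isCompl.symm X

theorem proj₁_add_proj₂ (X : D.𝔭) : H.proj₁ X + H.proj₂ X = X :=
  Submodule.projection_add_projection_eq_self H.isCompl X

theorem proj₁_eq {X Y Z : D.𝔭} (hY : (Y : GroupLieAlgebra 𝓘(ℝ, E) G) ∈ 𝔭₁)
    (hZ : (Z : GroupLieAlgebra 𝓘(ℝ, E) G) ∈ 𝔭₂) (h : Y + Z = X) : H.proj₁ X = Y := by
  rw [← h, map_add, proj₁, Submodule.projection_apply_of_mem_left H.isCompl hY,
    (Submodule.projection_apply_eq_zero_iff H.isCompl).2 hZ, add_zero]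

theorem proj₂_eq {X Y Z : D.𝔭} (hY : (Y : GroupLieAlgebra 𝓘(ℝ, E) G) ∈ 𝔭₁)
    (hZ : (Z : GroupLieAlgebra 𝓘(ℝ, E) G) ∈ 𝔭₂) (h : Y + Z = X) : H.proj₂ X = Z := by
  have h1 := H.proj₁_add_proj₂ X
  rw [H.proj₁_eq hY hZ h] at h1
  exact add_left_cancel (h1.trans h.symm)

theorem proj₁_rep (k : K) (X : D.𝔭) : H.proj₁ (D.rep k X) = D.rep k (H.proj₁ X) :=
  H.proj₁_eq (H.irreducible₁.1 k _ (H.proj₁_mem X)) (H.irreducible₂.1 k _ (H.proj₂_mem X))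
    (by rw [← map_add, proj₁_add_proj₂])

theorem proj₂_rep (k : K) (X : D.𝔭) : H.proj₂ (D.rep k X) = D.rep k (H.proj₂ X) :=
  H.proj₂_eq (H.irreducible₁.1 k _ (H.proj₁_mem X)) (H.irreducible₂.1 k _ (H.proj₂_mem X))
    (by rw [← map_add, proj₁_add_proj₂])

include H in
theorem exists_ne_zero₁ : ∃ X : D.𝔭, (X : GroupLieAlgebra 𝓘(ℝ, E) G) ∈ 𝔭₁ ∧ X ≠ 0 :=
  Submodule.exists_mem_ne_zero_of_ne_bot H.irreducible₁.2.1

include H in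
theorem exists_ne_zero₂ : ∃ X : D.𝔭, (X : GroupLieAlgebra 𝓘(ℝ, E) G) ∈ 𝔭₂ ∧ X ≠ 0 :=
  Submodule.exists_mem_ne_zero_of_ne_bot H.irreducible₂.2.1

theorem form_eq {g : InvariantMetric D} {x₁ x₂ : ℝ} (hg : g.IsDiagonal Q 𝔭₁ 𝔭₂ x₁ x₂)
    (X Y : D.𝔭) : g.form X Y = x₁ * Q.form (H.proj₁ X) (H.proj₁ Y) +
      x₂ * Q.form (H.proj₂ X) (H.proj₂ Y) := by
  conv_lhs => rw [← H.proj₁_add_proj₂ X, ← H.proj₁_add_proj₂ Y]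
  simp only [map_add, LinearMap.add_apply]
  rw [hg.2.2.1 _ _ (H.proj₁_mem X) (H.proj₁_mem Y), hg.2.2.2.1 _ _ (H.proj₂_mem X) (H.proj₂_mem Y),
    hg.2.2.2.2 _ _ (H.proj₁_mem X) (H.proj₂_mem Y), g.symm (H.proj₂ X),
    hg.2.2.2.2 _ _ (H.proj₁_mem Y) (H.proj₂_mem X)]
  ring

include H in
theorem eq_of_isDiagonal {g h : InvariantMetric D} {x₁ x₂ : ℝ}
    (hg : g.IsDiagonal Q 𝔭₁ 𝔭₂ x₁ x₂) (hh : h.IsDiagonal Q 𝔭₁ 𝔭₂ x₁ x₂) : g = h := by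
  ext X Y
  rw [H.form_eq hg, H.form_eq hh]

theorem ricci_eq {C : RicciCoeffs} (hC : HasRicciCoeffs Q 𝔭₁ 𝔭₂ C) {g : InvariantMetric D}
    {x₁ x₂ : ℝ} (hg : g.IsDiagonal Q 𝔭₁ 𝔭₂ x₁ x₂) (X Y : D.𝔭) :
    g.ricci X Y = C.rho₁ (x₁ / x₂) * Q.form (H.proj₁ X) (H.proj₁ Y) +
      C.rho₂ (x₁ / x₂) * Q.form (H.proj₂ X) (H.proj₂ Y) := by
  obtain ⟨h₁, h₂⟩ := hC g x₁ x₂ hg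
  rw [← h₁ _ _ (H.proj₁_mem X) (H.proj₁_mem Y), ← h₂ _ _ (H.proj₂_mem X) (H.proj₂_mem Y)]
  have h : Reductive.ricciForm D.isCompl g.form g.nondegenerate X Y =
      Reductive.ricciForm D.isCompl g.form g.nondegenerate (H.proj₁ X + H.proj₂ X)
        (H.proj₁ Y + H.proj₂ Y) := by rw [proj₁_add_proj₂, proj₁_add_proj₂]
  refine h.trans ?_
  simp only [map_add, LinearMap.add_apply, Reductive.ricciForm_apply]
  change g.ricci (H.proj₁ X) (H.proj₁ Y) + g.ricci (H.proj₂ X) (H.proj₁ Y) +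
    (g.ricci (H.proj₁ X) (H.proj₂ Y) + g.ricci (H.proj₂ X) (H.proj₂ Y)) = _
  rw [H.ricci_eq_zero g (H.proj₁_mem X) (H.proj₂_mem Y),
    H.ricci_eq_zero' g (H.proj₂_mem X) (H.proj₁_mem Y)]
  ring

include H in
theorem exists_diagonal {x₁ x₂ : ℝ} (hx₁ : 0 < x₁) (hx₂ : 0 < x₂) :
    ∃ g : InvariantMetric D, g.IsDiagonal Q 𝔭₁ 𝔭₂ x₁ x₂ := by
  have nonneg : ∀ W, 0 ≤ Q.form W W := fun W => by
    by_cases h : W = 0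
    · simp [h]
    · exact (Q.pos W h).le
  have zero_mem₁ : ((0 : D.𝔭) : GroupLieAlgebra 𝓘(ℝ, E) G) ∈ 𝔭₁ := by simp
  have zero_mem₂ : ((0 : D.𝔭) : GroupLieAlgebra 𝓘(ℝ, E) G) ∈ 𝔭₂ := by simp
  let φ : LinearMap.BilinForm ℝ D.𝔭 :=
    x₁ • Q.form.compl₁₂ H.proj₁ H.proj₁ + x₂ • Q.form.compl₁₂ H.proj₂ H.proj₂
  have hφ : ∀ X Y, φ X Y = x₁ * Q.form (H.proj₁ X) (H.proj₁ Y) +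
      x₂ * Q.form (H.proj₂ X) (H.proj₂ Y) := fun X Y => rfl
  refine ⟨⟨φ, fun X Y => ?_, fun X hX => ?_, fun k hk X Y => ?_⟩, hx₁, hx₂, ?_, ?_, ?_⟩
  · rw [hφ, hφ, Q.symm, Q.symm (H.proj₂ X)]
  · rw [hφ]
    by_cases h : H.proj₁ X = 0
    · have h2 : H.proj₂ X ≠ 0 := by
        intro h2
        apply hX
        rw [← H.proj₁_add_proj₂ X, h, h2, add_zero]
      have := mul_pos hx₂ (Q.pos _ h2)
      have := mul_nonneg hx₁.le (nonneg (H.proj₁ X))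
      linarith
    · have := mul_pos hx₁ (Q.pos _ h)
      have := mul_nonneg hx₂.le (nonneg (H.proj₂ X))
      linarith
  · change φ (D.rep ⟨k, hk⟩ X) (D.rep ⟨k, hk⟩ Y) = φ X Y
    simp only [hφ, proj₁_rep, proj₂_rep, Q.form_rep]
  · intro X Y hX hY
    change φ X Y = _
    rw [hφ, H.proj₁_eq hX zero_mem₂ (add_zero X), H.proj₁_eq hY zero_mem₂ (add_zero Y),
      H.proj₂_eq hX zero_mem₂ (add_zero X)]
    simp
  · intro X Y hX hY
    change φ X Y = _
    rw [hφ, H.proj₂_eq zero_mem₁ hX (zero_add X), H.proj₂_eq zero_mem₁ hY (zero_add Y),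
      H.proj₁_eq zero_mem₁ hX (zero_add X)]
    simp
  · intro X Y hX hY
    change φ X Y = _
    rw [hφ, H.proj₂_eq hX zero_mem₂ (add_zero X), H.proj₁_eq zero_mem₁ hY (zero_add Y)]
    simp

include H in
/-- A diagonal metric is Einstein if and only if its two Ricci curvatures agree. -/
theorem isEinstein_iff {C : RicciCoeffs} (hC : HasRicciCoeffs Q 𝔭₁ 𝔭₂ C) {g : InvariantMetric D}
    {x₁ x₂ : ℝ} (hg : g.IsDiagonal Q 𝔭₁ 𝔭₂ x₁ x₂) :
    g.IsEinstein ↔ C.rho₁ (x₁ / x₂) = x₁ / x₂ * C.rho₂ (x₁ / x₂) := by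
  have hx₁ := hg.1
  have hx₂ := hg.2.1
  constructor
  · rintro ⟨c, hc⟩
    obtain ⟨X, hX, hX0⟩ := H.exists_ne_zero₁
    obtain ⟨Y, hY, hY0⟩ := H.exists_ne_zero₂
    have h₁ := hc X X
    rw [(hC g x₁ x₂ hg).1 X X hX hX, hg.2.2.1 X X hX hX, ← mul_assoc] at h₁
    have h₂ := hc Y Y
    rw [(hC g x₁ x₂ hg).2 Y Y hY hY, hg.2.2.2.1 Y Y hY hY, ← mul_assoc] at h₂
    rw [mul_right_cancel₀ (Q.pos X hX0).ne' h₁, mul_right_cancel₀ (Q.pos Y hY0).ne' h₂]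
    field_simp
  · intro h
    refine ⟨C.rho₂ (x₁ / x₂) / x₂, fun X Y => ?_⟩
    rw [H.ricci_eq hC hg, H.form_eq hg, h]
    field_simp

include H in
/-- The norm of the curvature tensor of the diagonal metrics. -/
theorem exists_normRm_eq : ∃ Φ : ℝ → ℝ, ContinuousOn Φ (Ioi 0) ∧
    ∀ (g : InvariantMetric D) (x₁ x₂ : ℝ), g.IsDiagonal Q 𝔭₁ 𝔭₂ x₁ x₂ →
      g.normRm = Φ (x₁ / x₂) / x₂ := by
  obtain ⟨b₁, b₂, n₁, n₂, e, hb₁, hb₂, -, -, he, he₁, he₂, h₁, h₂⟩ := H.exists_adapted_basis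
  -- Eigenvalues of the metric with x₂ = 1 and x₁ = y; the general diagonal metric is x₂ times this
  -- one.
  let w : ℝ → Fin n₁ ⊕ Fin n₂ → ℝ := fun y => Sum.elim (fun _ => y / b₁) (fun _ => 1 / b₂)
  have hw0 : ∀ y, 0 < y → ∀ i, 0 < w y i := by
    rintro y hy (i | i)
    · exact div_pos hy hb₁
    · exact one_div_pos.2 hb₂
  have hwc : ∀ i, Continuous fun y => w y i := by
    rintro (i | i)
    · exact continuous_id.div_const _
    · exact continuous_const
  refine ⟨fun y => √(∑ i, ∑ j, ∑ k, ∑ l,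
    (w y l * Reductive.curvComp D.isCompl D.negKilling e (w y) i j k l) ^ 2 /
      (w y i * w y j * w y k * w y l)), ?_, ?_⟩
  · refine ContinuousOn.sqrt (continuousOn_finsetSum _ fun i _ => continuousOn_finsetSum _
      fun j _ => continuousOn_finsetSum _ fun k _ => continuousOn_finsetSum _ fun l _ => ?_)
    refine ContinuousOn.div ?_ ?_ ?_
    · exact ((hwc l).continuousOn.mul (Reductive.continuousOn_curvComp
        (fun a => (hwc a).continuousOn) (fun y hy a => (hw0 y hy a).ne') i j k l)).pow 2
    · exact ((((hwc i).mul (hwc j)).mul (hwc k)).mul (hwc l)).continuousOn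
    · intro y hy
      have := hw0 y hy
      exact (mul_pos (mul_pos (mul_pos (this i) (this j)) (this k)) (this l)).ne'
  · intro g x₁ x₂ hg
    have hx₁ := hg.1
    have hx₂ := hg.2.1
    have hx := H.form_adapted_basis hb₁ hb₂ he he₁ he₂ h₁ h₂ hg
    have hxw : (Sum.elim (fun _ => x₁ / b₁) (fun _ => x₂ / b₂) : Fin n₁ ⊕ Fin n₂ → ℝ) =
        fun a => x₂ * w (x₁ / x₂) a := by
      ext (i | i)
      · simp only [Sum.elim_inl, w]
        field_simp
      · simp only [Sum.elim_inr, w]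
        field_simp
    have hw := hw0 (x₁ / x₂) (div_pos hx₁ hx₂)
    rw [InvariantMetric.normRm, Reductive.sum_sq_curvature_diagonal D.negKilling_apply
      D.orthogonal he hx (fun i => by rw [hxw]; exact mul_pos hx₂ (hw i)) g.nondegenerate g.symm
      g.exists_orthonormal_basis.choose_spec]
    rw [eq_div_iff hx₂.ne']
    refine (congrArg (_ * ·) (Real.sqrt_sq hx₂.le).symm).trans ?_
    beta_reduce
    rw [← Real.sqrt_mul' _ (sq_nonneg x₂)]
    congr 1
    simp only [Finset.sum_mul, hxw]
    refine Finset.sum_congr rfl fun i _ => Finset.sum_congr rfl fun j _ =>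
      Finset.sum_congr rfl fun k _ => Finset.sum_congr rfl fun l _ => ?_
    rw [Reductive.curvComp_smul _ hx₂.ne']
    have := (hw i).ne'
    have := (hw j).ne'
    have := (hw k).ne'
    have := (hw l).ne'
    generalize w (x₁ / x₂) i = wi at *
    generalize w (x₁ / x₂) j = wj at *
    generalize w (x₁ / x₂) k = wk at *
    field_simp

end IsTwoSummand

end DiagonalMetrics

/-! ### The cubic whose roots are the Einstein ratios. -/

namespace RicciCoeffs

variable {C : RicciCoeffs}

/-- The difference between the two Ricci curvatures; it vanishes at the ratios of the Einstein
metrics. -/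
def gap (C : RicciCoeffs) (y : ℝ) : ℝ := C.rho₁ y - y * C.rho₂ y

/-- The two summands exchanged. -/
def swap (C : RicciCoeffs) : RicciCoeffs := ⟨C.a₂, C.n₂, C.m₂, C.a₁, C.n₁, C.m₁⟩

theorem swap_rho₁ (y : ℝ) : C.swap.rho₁ y = C.rho₂ y⁻¹ := by
  simp only [rho₁, rho₂, swap]
  rw [inv_pow, div_inv_eq_mul, div_eq_mul_inv]

theorem swap_rho₂ (y : ℝ) : C.swap.rho₂ y = C.rho₁ y⁻¹ := by
  simp only [rho₁, rho₂, swap]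
  rw [inv_pow, div_inv_eq_mul, div_eq_mul_inv]

/-- There are exactly three Einstein metrics, at the ratios `r₁ < r₂ < r₃`. -/
structure IsGeneric (C : RicciCoeffs) (r₁ r₂ r₃ : ℝ) : Prop where
  pos : 0 < r₁
  lt₁₂ : r₁ < r₂
  lt₂₃ : r₂ < r₃
  m₁_pos : 0 < C.m₁
  m₂_pos : 0 < C.m₂
  n₁_pos : 0 < C.n₁
  n₂_pos : 0 < C.n₂
  a₂_eq : C.a₂ = (C.n₁ + C.n₂) * (r₁ + r₂ + r₃)
  a₁_eq : C.a₁ = (C.n₁ + C.n₂) * (r₁ * r₂ + r₁ * r₃ + r₂ * r₃)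
  m_eq : C.m₁ + C.m₂ = (C.n₁ + C.n₂) * (r₁ * r₂ * r₃)
  rho₂_pos₁ : 0 < C.rho₂ r₁
  rho₂_pos₂ : 0 < C.rho₂ r₂
  rho₂_pos₃ : 0 < C.rho₂ r₃

theorem mul_gap {y : ℝ} (hy : y ≠ 0) : y * C.gap y =
    (C.n₁ + C.n₂) * y ^ 3 - C.a₂ * y ^ 2 + C.a₁ * y - (C.m₁ + C.m₂) := by
  simp only [gap, rho₁, rho₂]
  field_simp
  ring

/-- If ρ₂ ≤ 0 then ρ₁ = yρ₂ ≤ 0 as well, so a₁ < m₁/y and a₂ < n₂y. Multiplying gives a₁a₂ < m₁n₂,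
against admissibility. -/
theorem IsAdmissible.rho₂_pos (h : C.IsAdmissible) (hm : 0 < C.m₁) (hm' : 0 < C.m₂)
    (hn : 0 < C.n₁) (hn' : 0 < C.n₂) {y : ℝ} (hy : 0 < y) (hg : C.rho₁ y = y * C.rho₂ y) :
    0 < C.rho₂ y := by
  by_contra hle
  rw [not_lt] at hle
  have h₁ : C.rho₁ y ≤ 0 := by
    rw [hg]
    exact mul_nonpos_of_nonneg_of_nonpos hy.le hle
  have h₂ : C.a₁ < C.m₁ / y := by
    have : 0 < C.n₁ * y ^ 2 := by positivity
    rw [rho₁] at h₁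
    linarith
  have h₃ : C.a₂ < C.n₂ * y := by
    have : 0 < C.m₂ / y ^ 2 := by positivity
    rw [rho₂] at hle
    linarith
  have h₄ : C.a₁ * C.a₂ < C.m₁ / y * (C.n₂ * y) :=
    mul_lt_mul'' h₂ h₃ h.a₁_nonneg h.a₂_nonneg
  have h₅ : C.m₁ / y * (C.n₂ * y) = C.m₁ * C.n₂ := by field_simp
  linarith [h.le]

theorem IsAdmissible.isGeneric (h : C.IsAdmissible) {r₁ r₂ r₃ : ℝ} (h₁ : 0 < r₁) (h₁₂ : r₁ < r₂)
    (h₂₃ : r₂ < r₃)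
    (hroot : ∀ y, 0 < y → (C.rho₁ y = y * C.rho₂ y ↔ y = r₁ ∨ y = r₂ ∨ y = r₃)) :
    C.IsGeneric r₁ r₂ r₃ := by
  have h₂ := h₁.trans h₁₂
  have h₃ := h₂.trans h₂₃
  set n := C.n₁ + C.n₂ with hn
  have hzero : ∀ y, 0 < y → (n * y ^ 3 - C.a₂ * y ^ 2 + C.a₁ * y - (C.m₁ + C.m₂) = 0 ↔
      y = r₁ ∨ y = r₂ ∨ y = r₃) := by
    intro y hy
    rw [← hroot y hy, ← mul_gap hy.ne', mul_eq_zero, or_iff_right hy.ne', gap, sub_eq_zero]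
  have z₁ := (hzero r₁ h₁).2 (Or.inl rfl)
  have z₂ := (hzero r₂ h₂).2 (Or.inr (Or.inl rfl))
  have z₃ := (hzero r₃ h₃).2 (Or.inr (Or.inr rfl))
  have d₁₂ : r₂ - r₁ ≠ 0 := (sub_pos.2 h₁₂).ne'
  have d₂₃ : r₃ - r₂ ≠ 0 := (sub_pos.2 h₂₃).ne'
  have d₁₃ : r₃ - r₁ ≠ 0 := (sub_pos.2 (h₁₂.trans h₂₃)).ne'
  -- First and then second divided differences at the three roots: Vieta's relations follow before
  -- the degree is known.
  have e₁₂ : n * (r₂ ^ 2 + r₁ * r₂ + r₁ ^ 2) - C.a₂ * (r₁ + r₂) + C.a₁ = 0 := by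
    refine (mul_eq_zero.1 (?_ : (r₂ - r₁) * _ = 0)).resolve_left d₁₂
    linear_combination z₂ - z₁
  have e₂₃ : n * (r₃ ^ 2 + r₂ * r₃ + r₂ ^ 2) - C.a₂ * (r₂ + r₃) + C.a₁ = 0 := by
    refine (mul_eq_zero.1 (?_ : (r₃ - r₂) * _ = 0)).resolve_left d₂₃
    linear_combination z₃ - z₂
  have e₁₃ : n * (r₁ + r₂ + r₃) - C.a₂ = 0 := by
    refine (mul_eq_zero.1 (?_ : (r₃ - r₁) * _ = 0)).resolve_left d₁₃
    linear_combination e₂₃ - e₁₂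
  have ha₂ : C.a₂ = n * (r₁ + r₂ + r₃) := by linarith
  have ha₁ : C.a₁ = n * (r₁ * r₂ + r₁ * r₃ + r₂ * r₃) := by
    rw [ha₂] at e₁₂
    linear_combination e₁₂
  have hm : C.m₁ + C.m₂ = n * (r₁ * r₂ * r₃) := by
    rw [ha₂, ha₁] at z₁
    linear_combination -z₁
  -- Otherwise all coefficients vanish and every positive ratio, such as r₃ + 1, would be a root.
  have hn0 : n ≠ 0 := by
    intro h0
    have := (hzero (r₃ + 1) (by linarith)).1 (by rw [hm, ha₁, ha₂, h0]; ring)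
    rcases this with h | h | h <;> linarith
  have hm0 : C.m₁ + C.m₂ ≠ 0 := by
    rw [hm]
    positivity
  -- n₁ and n₂ vanish together, so a nonzero sum makes both positive; likewise for m₁ and m₂.
  have n₁ : 0 < C.n₁ := lt_of_le_of_ne h.n₁_nonneg fun h0 =>
    hn0 (by rw [hn, ← h0, h.n_iff.1 h0.symm, add_zero])
  have n₂ : 0 < C.n₂ := lt_of_le_of_ne h.n₂_nonneg fun h0 => n₁.ne' (h.n_iff.2 h0.symm)
  have m₁ : 0 < C.m₁ := lt_of_le_of_ne h.m₁_nonneg fun h0 =>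
    hm0 (by rw [← h0, h.m_iff.1 h0.symm, add_zero])
  have m₂ : 0 < C.m₂ := lt_of_le_of_ne h.m₂_nonneg fun h0 => m₁.ne' (h.m_iff.2 h0.symm)
  have pos := fun y (hy : 0 < y) (hr : y = r₁ ∨ y = r₂ ∨ y = r₃) =>
    h.rho₂_pos m₁ m₂ n₁ n₂ hy ((hroot y hy).2 hr)
  exact ⟨h₁, h₁₂, h₂₃, m₁, m₂, n₁, n₂, ha₂, ha₁, hm, pos _ h₁ (Or.inl rfl),
    pos _ h₂ (Or.inr (Or.inl rfl)), pos _ h₃ (Or.inr (Or.inr rfl))⟩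

namespace IsGeneric

variable {r₁ r₂ r₃ : ℝ} (h : C.IsGeneric r₁ r₂ r₃)

include h

theorem pos₂ : 0 < r₂ := h.pos.trans h.lt₁₂

theorem pos₃ : 0 < r₃ := h.pos₂.trans h.lt₂₃

theorem gap_eq {y : ℝ} (hy : y ≠ 0) :
    C.gap y = (C.n₁ + C.n₂) * ((y - r₁) * (y - r₂) * (y - r₃)) / y := by
  rw [eq_div_iff hy, mul_comm, mul_gap hy, h.a₂_eq, h.a₁_eq, h.m_eq]
  ring

/-- Exchanging the summands inverts the ratio, hence reverses the order of the roots. Positivity of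
ρ₂ passes over because ρ₁(r) = rρ₂(r) at a root. -/
theorem swap : C.swap.IsGeneric r₃⁻¹ r₂⁻¹ r₁⁻¹ := by
  have h1 := h.pos
  have h2 := h.pos₂
  have h3 := h.pos₃
  have rho : ∀ r, 0 < r → (C.n₁ + C.n₂) * ((r - r₁) * (r - r₂) * (r - r₃)) = 0 →
      0 < C.rho₂ r → 0 < C.swap.rho₂ r⁻¹ := by
    intro r hr hr0 hpos
    have hg := h.gap_eq hr.ne'
    rw [hr0, zero_div, gap, sub_eq_zero] at hg
    rw [swap_rho₂, inv_inv, hg]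
    exact mul_pos hr hpos
  refine ⟨inv_pos.2 h3, inv_strictAnti₀ h2 h.lt₂₃, inv_strictAnti₀ h1 h.lt₁₂, h.n₂_pos, h.n₁_pos,
    h.m₂_pos, h.m₁_pos, ?_, ?_, ?_, rho _ h3 (by simp) h.rho₂_pos₃, rho _ h2 (by simp) h.rho₂_pos₂,
    rho _ h1 (by simp) h.rho₂_pos₁⟩
  · change C.a₁ = (C.m₂ + C.m₁) * _
    rw [add_comm C.m₂, h.m_eq, h.a₁_eq]
    field_simp
  · change C.a₂ = (C.m₂ + C.m₁) * _
    rw [add_comm C.m₂, h.m_eq, h.a₂_eq]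
    field_simp
  · change C.n₂ + C.n₁ = (C.m₂ + C.m₁) * _
    rw [add_comm C.m₂, h.m_eq]
    field_simp
    ring

end IsGeneric

end RicciCoeffs

/-! ### Linear equations, and time as a function of a monotone parameter. -/

section RealAnalysis

/-- On the compact interval between s and t the coefficient is bounded, so the equation is uniformly
Lipschitz and w agrees with the zero solution, forwards or backwards in time. -/
theorem eq_zero_of_hasDerivWithinAt_linear {J : Set ℝ} (hJ : J.OrdConnected) {w k : ℝ → ℝ}
    (hk : ContinuousOn k J) (hw : ∀ t ∈ J, HasDerivWithinAt w (k t * w t) J t) {s t : ℝ}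
    (hs : s ∈ J) (ht : t ∈ J) (h0 : w s = 0) : w t = 0 := by
  have hsub : ∀ {a b}, a ∈ J → b ∈ J → Icc a b ⊆ J := fun ha hb => hJ.out ha hb
  have key : ∀ {a b : ℝ}, a ∈ J → b ∈ J → ∃ M : NNReal, ∀ t ∈ Icc a b,
      LipschitzOnWith M (fun x => k t * x) univ := by
    intro a b ha hb
    obtain ⟨M, hM⟩ := isCompact_Icc.exists_bound_of_continuousOn (hk.mono (hsub ha hb))
    refine ⟨⟨max M 0, le_max_right _ _⟩, fun t ht => LipschitzOnWith.of_dist_le_mul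
      fun x _ y _ => ?_⟩
    rw [Real.dist_eq, Real.dist_eq, ← mul_sub, abs_mul]
    exact mul_le_mul_of_nonneg_right ((hM t ht).trans (le_max_left _ _)) (abs_nonneg _)
  have hcont : ∀ {a b}, a ∈ J → b ∈ J → ContinuousOn w (Icc a b) := fun ha hb t ht =>
    ((hw t (hsub ha hb ht)).continuousWithinAt).mono (hsub ha hb)
  rcases le_total s t with h | h
  · obtain ⟨M, hM⟩ := key hs ht
    refine ODE_solution_unique_of_mem_Icc_right (v := fun t x => k t * x) (s := fun _ => univ)
      (g := fun _ => 0) (fun u hu => hM u (Ico_subset_Icc_self hu)) (hcont hs ht) (fun u hu => ?_)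
      (fun _ _ => trivial) continuousOn_const (fun u hu => ?_) (fun _ _ => trivial) h0
      (right_mem_Icc.2 h)
    · exact ((hw u (hsub hs ht (Ico_subset_Icc_self hu))).mono (hsub hs ht)).mono_of_mem_nhdsWithin
        (Icc_mem_nhdsGE_of_mem hu)
    · simpa using hasDerivWithinAt_const u (Ici u) (0 : ℝ)
  · obtain ⟨M, hM⟩ := key ht hs
    refine ODE_solution_unique_of_mem_Icc_left (v := fun t x => k t * x) (s := fun _ => univ)
      (g := fun _ => 0) (fun u hu => hM u (Ioc_subset_Icc_self hu)) (hcont ht hs) (fun u hu => ?_)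
      (fun _ _ => trivial) continuousOn_const (fun u hu => ?_) (fun _ _ => trivial) h0
      (left_mem_Icc.2 h)
    · exact ((hw u (hsub ht hs (Ioc_subset_Icc_self hu))).mono (hsub ht hs)).mono_of_mem_nhdsWithin
        (Icc_mem_nhdsLE_of_mem hu)
    · simpa using hasDerivWithinAt_const u (Iic u) (0 : ℝ)

theorem eq_of_hasDerivWithinAt_zero {J : Set ℝ} (hJ : J.OrdConnected) {f : ℝ → ℝ}
    (hf : ∀ t ∈ J, HasDerivWithinAt f 0 J t) {s t : ℝ} (hs : s ∈ J) (ht : t ∈ J) : f t = f s := by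
  have := hJ.convex.norm_image_sub_le_of_norm_hasDerivWithin_le (C := 0) hf (by simp) hs ht
  rw [zero_mul, norm_le_zero_iff, sub_eq_zero] at this
  exact this

variable {p q : ℝ} {f σ σ' ρ : ℝ → ℝ}

theorem strictMonoOn_of_hasDerivAt_pos (hσ : ∀ u ∈ Ioo p q, HasDerivAt σ (σ' u) u)
    (hσ' : ∀ u ∈ Ioo p q, 0 < σ' u) : StrictMonoOn σ (Ioo p q) :=
  strictMonoOn_of_hasDerivWithinAt_pos (convex_Ioo p q)
    (fun u hu => (hσ u hu).continuousAt.continuousWithinAt)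
    (fun u hu => (hσ u (interior_subset hu)).hasDerivWithinAt)
    fun u hu => hσ' u (interior_subset hu)

theorem monotoneOn_of_hasDerivAt_nonneg (hσ : ∀ u ∈ Ioo p q, HasDerivAt σ (σ' u) u)
    (hσ' : ∀ u ∈ Ioo p q, 0 ≤ σ' u) : MonotoneOn σ (Ioo p q) :=
  monotoneOn_of_hasDerivWithinAt_nonneg (convex_Ioo p q)
    (fun u hu => (hσ u hu).continuousAt.continuousWithinAt)
    (fun u hu => (hσ u (interior_subset hu)).hasDerivWithinAt)
    fun u hu => hσ' u (interior_subset hu)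

theorem antitoneOn_of_hasDerivAt_nonpos (hσ : ∀ u ∈ Ioo p q, HasDerivAt σ (σ' u) u)
    (hσ' : ∀ u ∈ Ioo p q, σ' u ≤ 0) : AntitoneOn σ (Ioo p q) :=
  antitoneOn_of_hasDerivWithinAt_nonpos (convex_Ioo p q)
    (fun u hu => (hσ u hu).continuousAt.continuousWithinAt)
    (fun u hu => (hσ u (interior_subset hu)).hasDerivWithinAt)
    fun u hu => hσ' u (interior_subset hu)

/-- A positive quantity `f` which tends to zero, while it decreases at a rate `2 ρ` bounded from
below with respect to the time `σ`, does so in finite time. -/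
theorem exists_tendsto_time (hpq : p < q) (hσ : ∀ u ∈ Ioo p q, HasDerivAt σ (σ' u) u)
    (hσ' : ∀ u ∈ Ioo p q, 0 < σ' u) (hf : ∀ u ∈ Ioo p q, HasDerivAt f (-2 * ρ u * σ' u) u)
    (hf0 : ∀ u ∈ Ioo p q, 0 < f u) {ρ₀ : ℝ} (hρ₀ : 0 < ρ₀) (hρ : Tendsto ρ (𝓝[<] q) (𝓝 ρ₀))
    (hfq : Tendsto f (𝓝[<] q) (𝓝 0)) :
    ∃ T, Tendsto σ (𝓝[<] q) (𝓝 T) ∧ (∀ u ∈ Ioo p q, σ u < T) ∧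
      Tendsto (fun u => f u / (T - σ u)) (𝓝[<] q) (𝓝 (2 * ρ₀)) := by
  have hmono := strictMonoOn_of_hasDerivAt_pos hσ hσ'
  have hmem : ∀ᶠ u in 𝓝[<] q, u ∈ Ioo p q := Ioo_mem_nhdsLT hpq
  -- Near q one has ρ > ρ₀/2, so f + ρ₀σ decreases there; as f > 0, this bounds σ.
  have hbdd : BddAbove (σ '' Ioo p q) := by
    obtain ⟨r, hr, hrq⟩ := (mem_nhdsLT_iff_exists_Ioo_subset' hpq).1
      (hρ.eventually (lt_mem_nhds (half_lt_self hρ₀)))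
    have hr : r < q := hr
    set r' := max p r with hr'
    have hr'q : r' < q := max_lt hpq hr
    have hsub : Ioo r' q ⊆ Ioo p q := Ioo_subset_Ioo_left (le_max_left _ _)
    have hanti : AntitoneOn (fun u => f u + ρ₀ * σ u) (Ioo r' q) :=
      antitoneOn_of_hasDerivAt_nonpos
        (fun u hu => (hf u (hsub hu)).add ((hσ u (hsub hu)).const_mul ρ₀)) fun u hu => by
          have h1 : ρ₀ / 2 < ρ u := hrq ⟨(le_max_right _ _).trans_lt hu.1, hu.2⟩
          have h2 := hσ' u (hsub hu)
          nlinarith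
    have hu0 : (r' + q) / 2 ∈ Ioo r' q := ⟨by linarith, by linarith⟩
    set u0 := (r' + q) / 2
    refine ⟨(f u0 + ρ₀ * σ u0) / ρ₀, ?_⟩
    rintro _ ⟨u, hu, rfl⟩
    rw [le_div_iff₀ hρ₀]
    rcases le_total u0 u with h | h
    · have h1 := hanti hu0 ⟨hu0.1.trans_le h, hu.2⟩ h
      have h2 := hf0 u hu
      simp only at h1
      linarith
    · have h1 := hmono.monotoneOn hu (hsub hu0) h
      have h2 := hf0 u0 (hsub hu0)
      nlinarith
  have hT := MonotoneOn.tendsto_nhdsWithin_Ioo_left ⟨_, ⟨left_lt_add_div_two.2 hpq,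
    add_div_two_lt_right.2 hpq⟩⟩ hmono.monotoneOn hbdd
  set T := sSup (σ '' Ioo p q)
  refine ⟨T, hT, fun u hu => ?_, ?_⟩
  · have hv : (u + q) / 2 ∈ Ioo p q := ⟨by linarith [hu.1, hu.2], by linarith [hu.2]⟩
    exact (hmono hu hv (by linarith [hu.2])).trans_le (le_csSup hbdd ⟨_, hv, rfl⟩)
  -- L'Hôpital: the derivatives of f and T - σ are -2ρσ' and -σ'.
  · refine HasDerivAt.lhopital_zero_nhdsLT (hmem.mono hf)
      (hmem.mono fun u hu => (hσ u hu).const_sub T)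
      (hmem.mono fun u hu => neg_ne_zero.2 (hσ' u hu).ne') hfq ?_ ?_
    · simpa using hT.const_sub T
    · refine (hρ.const_mul 2).congr' (hmem.mono fun u hu => ?_)
      have := (hσ' u hu).ne'
      field_simp

/-- A quantity `f` which tends to infinity at the left end, while its rate of change `-2 ρ` with
respect to the time `σ` converges. -/
theorem tendsto_time_atBot (hpq : p < q) (hσ : ∀ u ∈ Ioo p q, HasDerivAt σ (σ' u) u)
    (hσ' : ∀ u ∈ Ioo p q, 0 < σ' u) (hf : ∀ u ∈ Ioo p q, HasDerivAt f (-2 * ρ u * σ' u) u)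
    {ρ₀ : ℝ} (hρ₀ : 0 < ρ₀) (hρ : Tendsto ρ (𝓝[>] p) (𝓝 ρ₀))
    (hfp : Tendsto f (𝓝[>] p) atTop) :
    Tendsto σ (𝓝[>] p) atBot ∧ Tendsto (fun u => f u / (-σ u)) (𝓝[>] p) (𝓝 (2 * ρ₀)) := by
  -- Near p the rate lies within ε of ρ₀, which makes f + 2(ρ₀+ε)σ increasing and f + 2(ρ₀-ε)σ
  -- decreasing.
  have key : ∀ ε > 0, ∃ A B : ℝ, ∀ᶠ u in 𝓝[>] p,
      f u + 2 * (ρ₀ + ε) * σ u ≤ A ∧ B ≤ f u + 2 * (ρ₀ - ε) * σ u := by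
    intro ε hε
    have h1 : ∀ᶠ u in 𝓝[>] p, ρ₀ - ε < ρ u ∧ ρ u < ρ₀ + ε :=
      (hρ.eventually (lt_mem_nhds (by linarith))).and (hρ.eventually (gt_mem_nhds (by linarith)))
    obtain ⟨r, hr, hrp⟩ := (mem_nhdsGT_iff_exists_Ioo_subset' hpq).1 h1
    have hr : p < r := hr
    set r' := min q r with hr'
    have hr'p : p < r' := lt_min hpq hr
    have hsub : Ioo p r' ⊆ Ioo p q := Ioo_subset_Ioo_right (min_le_left _ _)
    have hρ' : ∀ u ∈ Ioo p r', ρ₀ - ε < ρ u ∧ ρ u < ρ₀ + ε := fun u hu =>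
      hrp ⟨hu.1, hu.2.trans_le (min_le_right _ _)⟩
    have hmono : MonotoneOn (fun u => f u + 2 * (ρ₀ + ε) * σ u) (Ioo p r') :=
      monotoneOn_of_hasDerivAt_nonneg
        (fun u hu => (hf u (hsub hu)).add ((hσ u (hsub hu)).const_mul _)) fun u hu => by
          have h2 := hσ' u (hsub hu)
          nlinarith [(hρ' u hu).2]
    have hanti : AntitoneOn (fun u => f u + 2 * (ρ₀ - ε) * σ u) (Ioo p r') :=
      antitoneOn_of_hasDerivAt_nonpos
        (fun u hu => (hf u (hsub hu)).add ((hσ u (hsub hu)).const_mul _)) fun u hu => by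
          have h2 := hσ' u (hsub hu)
          nlinarith [(hρ' u hu).1]
    have hu0 : (p + r') / 2 ∈ Ioo p r' := ⟨by linarith, by linarith⟩
    set u0 := (p + r') / 2
    refine ⟨f u0 + 2 * (ρ₀ + ε) * σ u0, f u0 + 2 * (ρ₀ - ε) * σ u0, ?_⟩
    filter_upwards [Ioo_mem_nhdsGT hu0.1] with u hu
    have hu' : u ∈ Ioo p r' := ⟨hu.1, hu.2.trans hu0.2⟩
    exact ⟨hmono hu' hu0 hu.2.le, hanti hu' hu0 hu.2.le⟩
  have hσb : Tendsto σ (𝓝[>] p) atBot := by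
    obtain ⟨A, B, h⟩ := key 1 one_pos
    have hpos : 0 < 2 * (ρ₀ + 1) := by linarith
    have h1 : Tendsto (fun u => (A - f u) / (2 * (ρ₀ + 1))) (𝓝[>] p) atBot :=
      (tendsto_const_nhds.add_atBot (tendsto_neg_atTop_atBot.comp hfp)).atBot_div_const hpos
    refine tendsto_atBot_mono' _ (h.mono fun u hu => ?_) h1
    rw [le_div_iff₀ hpos]
    linarith [hu.1]
  refine ⟨hσb, ?_⟩
  have hneg : Tendsto (fun u => -σ u) (𝓝[>] p) atTop := tendsto_neg_atBot_atTop.comp hσb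
  rw [Metric.tendsto_nhds]
  intro δ hδ
  -- The slope error is 2·δ/4 = δ/2; the constants A and B, divided by -σ → ∞, use up the other
  -- half.
  obtain ⟨A, B, h⟩ := key (δ / 4) (by linarith)
  have hA := (hneg.const_div_atTop A).eventually (gt_mem_nhds (show (0 : ℝ) < δ / 2 by linarith))
  have hB := (hneg.const_div_atTop B).eventually (lt_mem_nhds (show -(δ / 2) < (0 : ℝ) by linarith))
  filter_upwards [h, hA, hB, hneg.eventually_gt_atTop 0] with u hu hA hB hs
  rw [div_lt_iff₀ hs] at hA
  rw [lt_div_iff₀ hs] at hB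
  rw [Real.dist_eq, abs_lt]
  have hfs : f u / (-σ u) - 2 * ρ₀ = (f u + 2 * ρ₀ * σ u) / (-σ u) := by
    rw [eq_div_iff hs.ne', sub_mul, div_mul_cancel₀ _ hs.ne']
    ring
  rw [hfs, lt_div_iff₀ hs, div_lt_iff₀ hs]
  constructor <;> nlinarith [hu.1, hu.2]

/-- The time spent near p is at most M times the length of the parameter interval. This is what
excludes ancient solutions. -/
theorem exists_lower_bound_time (hpq : p < q) (hσ : ∀ u ∈ Ioo p q, HasDerivAt σ (σ' u) u)
    (hσ' : ∀ u ∈ Ioo p q, 0 < σ' u) {M : ℝ} (hM : ∀ᶠ u in 𝓝[>] p, σ' u ≤ M) :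
    ∃ B, ∀ u ∈ Ioo p q, B ≤ σ u := by
  obtain ⟨r, hr, hrp⟩ := (mem_nhdsGT_iff_exists_Ioo_subset' hpq).1 hM
  have hr : p < r := hr
  set r' := min q r with hr'
  have hr'p : p < r' := lt_min hpq hr
  have hsub : Ioo p r' ⊆ Ioo p q := Ioo_subset_Ioo_right (min_le_left _ _)
  have hanti : AntitoneOn (fun u => σ u - M * u) (Ioo p r') :=
    antitoneOn_of_hasDerivAt_nonpos
      (fun u hu => (hσ u (hsub hu)).sub ((hasDerivAt_id u).const_mul M)) fun u hu => by
        have : σ' u ≤ M := hrp ⟨hu.1, hu.2.trans_le (min_le_right _ _)⟩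
        linarith
  have hmono := (strictMonoOn_of_hasDerivAt_pos hσ hσ').monotoneOn
  have hu0 : (p + r') / 2 ∈ Ioo p r' := ⟨by linarith, by linarith⟩
  set u0 := (p + r') / 2
  have hM0 : 0 ≤ M := (hσ' u0 (hsub hu0)).le.trans
    (hrp ⟨hu0.1, hu0.2.trans_le (min_le_right _ _)⟩)
  refine ⟨σ u0 - M * (u0 - p), fun u hu => ?_⟩
  rcases le_total u u0 with h | h
  · have h1 := hanti ⟨hu.1, h.trans_lt hu0.2⟩ hu0 h
    simp only at h1
    nlinarith [hu.1]
  · have h1 := hmono (hsub hu0) hu h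
    have := mul_nonneg hM0 (sub_pos.2 hu0.1).le
    linarith

/-- The inverse of a function with positive derivative on an interval. -/
theorem exists_inverse_time (hσ : ∀ u ∈ Ioo p q, HasDerivAt σ (σ' u) u)
    (hσ' : ∀ u ∈ Ioo p q, 0 < σ' u) (hc : ContinuousOn σ' (Ioo p q)) :
    ∃ U : ℝ → ℝ, (∀ u ∈ Ioo p q, U (σ u) = u) ∧
      ∀ t ∈ σ '' Ioo p q, U t ∈ Ioo p q ∧ σ (U t) = t ∧ HasDerivAt U (σ' (U t))⁻¹ t := by
  have hmono := strictMonoOn_of_hasDerivAt_pos hσ hσ'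
  refine ⟨Function.invFunOn σ (Ioo p q), fun u hu => hmono.injOn.leftInvOn_invFunOn hu, ?_⟩
  rintro _ ⟨u, hu, rfl⟩
  have hU : ∀ v ∈ Ioo p q, Function.invFunOn σ (Ioo p q) (σ v) = v := fun v hv =>
    hmono.injOn.leftInvOn_invFunOn hv
  rw [hU u hu]
  have hnhds : ∀ᶠ v in 𝓝 u, v ∈ Ioo p q := isOpen_Ioo.mem_nhds hu
  have hs : HasStrictDerivAt σ (σ' u) u := hasStrictDerivAt_of_hasDerivAt_of_continuousAt
    (hnhds.mono hσ) (hc.continuousAt hnhds)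
  exact ⟨hu, rfl, (hs.to_local_left_inverse (hσ' u hu).ne' (hnhds.mono hU)).hasDerivAt⟩

end RealAnalysis

/-! ### The planar flow, parametrised by the ratio. -/

namespace RicciCoeffs

variable {C : RicciCoeffs}

/-- The Ricci flow equation for the diagonal metrics, on the time interval `I`. -/
structure IsFlow (C : RicciCoeffs) (I : Set ℝ) (x₁ x₂ : ℝ → ℝ) : Prop where
  pos₁ : ∀ t ∈ I, 0 < x₁ t
  pos₂ : ∀ t ∈ I, 0 < x₂ t
  deriv₁ : ∀ t ∈ I, HasDerivWithinAt x₁ (-2 * C.rho₁ (x₁ t / x₂ t)) I t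
  deriv₂ : ∀ t ∈ I, HasDerivWithinAt x₂ (-2 * C.rho₂ (x₁ t / x₂ t)) I t

theorem IsFlow.mono {I J : Set ℝ} {x₁ x₂ : ℝ → ℝ} (h : C.IsFlow I x₁ x₂) (hJ : J ⊆ I) :
    C.IsFlow J x₁ x₂ :=
  ⟨fun t ht => h.pos₁ t (hJ ht), fun t ht => h.pos₂ t (hJ ht),
    fun t ht => (h.deriv₁ t (hJ ht)).mono hJ, fun t ht => (h.deriv₂ t (hJ ht)).mono hJ⟩

theorem IsFlow.of_swap {I : Set ℝ} {x₁ x₂ : ℝ → ℝ} (h : C.swap.IsFlow I x₁ x₂) :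
    C.IsFlow I x₂ x₁ :=
  ⟨h.pos₂, h.pos₁,
    fun t ht => by simpa only [swap_rho₂, inv_div] using h.deriv₂ t ht,
    fun t ht => by simpa only [swap_rho₁, inv_div] using h.deriv₁ t ht⟩

theorem IsFlow.swap {I : Set ℝ} {x₁ x₂ : ℝ → ℝ} (h : C.IsFlow I x₁ x₂) :
    C.swap.IsFlow I x₂ x₁ :=
  IsFlow.of_swap (C := C.swap) h

theorem IsFlow.ratio_pos {I : Set ℝ} {x₁ x₂ : ℝ → ℝ} (h : C.IsFlow I x₁ x₂) {t : ℝ} (ht : t ∈ I) :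
    0 < x₁ t / x₂ t := div_pos (h.pos₁ t ht) (h.pos₂ t ht)

theorem IsFlow.hasDerivWithinAt_ratio {I : Set ℝ} {x₁ x₂ : ℝ → ℝ} (h : C.IsFlow I x₁ x₂) {t : ℝ}
    (ht : t ∈ I) : HasDerivWithinAt (fun t => x₁ t / x₂ t)
      (-2 * C.gap (x₁ t / x₂ t) / x₂ t) I t := by
  have h2 := (h.pos₂ t ht).ne'
  refine HasDerivWithinAt.congr_deriv ((h.deriv₁ t ht).div (h.deriv₂ t ht) h2) ?_
  rw [gap]
  field_simp
  ring

theorem continuousOn_rho₁ : ContinuousOn C.rho₁ (Ioi 0) := fun y hy => by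
  have : y ≠ 0 := ne_of_gt hy
  unfold rho₁
  fun_prop (disch := assumption)

theorem continuousOn_rho₂ : ContinuousOn C.rho₂ (Ioi 0) := fun y hy => by
  have : y ^ 2 ≠ 0 := pow_ne_zero 2 (ne_of_gt hy)
  unfold rho₂
  fun_prop (disch := assumption)

theorem continuousOn_gap : ContinuousOn C.gap (Ioi 0) :=
  continuousOn_rho₁.sub (continuousOn_id.mul continuousOn_rho₂)

/-- Since r is a root of the gap, y - r solves a linear homogeneous equation along the flow;
vanishing once, it would vanish always. -/
theorem IsFlow.ratio_ne {J : Set ℝ} {x₁ x₂ k : ℝ → ℝ} {r s : ℝ} (h : C.IsFlow J x₁ x₂)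
    (hJ : J.OrdConnected) (hk : ContinuousOn k (Ioi 0)) (hr : ∀ y, 0 < y → C.gap y = k y * (y - r))
    (hs : s ∈ J) (hsr : x₁ s / x₂ s ≠ r) {t : ℝ} (ht : t ∈ J) : x₁ t / x₂ t ≠ r := by
  intro htr
  apply hsr
  rw [← sub_eq_zero]
  have hcont : ContinuousOn (fun t => x₁ t / x₂ t) J := fun t ht =>
    (h.hasDerivWithinAt_ratio ht).continuousWithinAt
  have hcont₂ : ContinuousOn x₂ J := fun t ht => (h.deriv₂ t ht).continuousWithinAt
  refine eq_zero_of_hasDerivWithinAt_linear (w := fun t => x₁ t / x₂ t - r)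
    (k := fun t => -2 * k (x₁ t / x₂ t) / x₂ t) hJ ?_ ?_ ht hs (sub_eq_zero.2 htr)
  · exact (continuousOn_const.mul (hk.comp hcont fun t ht => h.ratio_pos ht)).div hcont₂
      fun t ht => (h.pos₂ t ht).ne'
  · intro t ht
    refine HasDerivWithinAt.congr_deriv ((h.hasDerivWithinAt_ratio ht).sub_const r) ?_
    rw [hr _ (h.ratio_pos ht)]
    ring

theorem IsFlow.ratio_mem_Ioo {J : Set ℝ} {x₁ x₂ : ℝ → ℝ} {p q s : ℝ} (h : C.IsFlow J x₁ x₂)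
    (hJ : J.OrdConnected) (hs : s ∈ J) (hsr : x₁ s / x₂ s ∈ Ioo p q)
    (hp : ∀ t ∈ J, x₁ t / x₂ t ≠ p) (hq : ∀ t ∈ J, x₁ t / x₂ t ≠ q) {t : ℝ} (ht : t ∈ J) :
    x₁ t / x₂ t ∈ Ioo p q := by
  have hcont : ContinuousOn (fun t => x₁ t / x₂ t) J := fun t ht =>
    (h.hasDerivWithinAt_ratio ht).continuousWithinAt
  have himg : ((fun t => x₁ t / x₂ t) '' J).OrdConnected :=
    (hJ.isPreconnected.image _ hcont).ordConnected
  constructor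
  · by_contra! hle
    obtain ⟨u, hu, hup⟩ := himg.out ⟨t, ht, rfl⟩ ⟨s, hs, rfl⟩ ⟨hle, hsr.1.le⟩
    exact hp u hu hup
  · by_contra! hle
    obtain ⟨u, hu, hup⟩ := himg.out ⟨s, hs, rfl⟩ ⟨t, ht, rfl⟩ ⟨hsr.2.le, hle⟩
    exact hq u hu hup

/-- On the interval `(p, q)`, the value `X y` of `x₂` and the time `τ y` at which the ratio is `y`
along a solution of the flow. -/
structure IsProfile (C : RicciCoeffs) (p q : ℝ) (X τ : ℝ → ℝ) : Prop where
  nonneg : 0 ≤ p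
  lt : p < q
  gap_neg : ∀ y ∈ Ioo p q, C.gap y < 0
  pos : ∀ y ∈ Ioo p q, 0 < X y
  derivX : ∀ y ∈ Ioo p q, HasDerivAt X (X y * (C.rho₂ y / C.gap y)) y
  derivτ : ∀ y ∈ Ioo p q, HasDerivAt τ (-X y / (2 * C.gap y)) y

namespace IsProfile

variable {p q : ℝ} {X τ : ℝ → ℝ} (P : C.IsProfile p q X τ)

include P

theorem pos_of_mem {y : ℝ} (hy : y ∈ Ioo p q) : 0 < y := P.nonneg.trans_lt hy.1

theorem derivτ_pos {y : ℝ} (hy : y ∈ Ioo p q) : 0 < -X y / (2 * C.gap y) :=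
  div_pos_of_neg_of_neg (neg_lt_zero.2 (P.pos y hy)) (by linarith [P.gap_neg y hy])

theorem derivX' {y : ℝ} (hy : y ∈ Ioo p q) :
    HasDerivAt X (-2 * C.rho₂ y * (-X y / (2 * C.gap y))) y := by
  refine HasDerivAt.congr_deriv (P.derivX y hy) ?_
  have := (P.gap_neg y hy).ne
  field_simp

theorem continuousOn_derivτ : ContinuousOn (fun y => -X y / (2 * C.gap y)) (Ioo p q) := by
  refine ContinuousOn.div ?_ ?_ fun y hy => mul_ne_zero two_ne_zero (P.gap_neg y hy).ne
  · exact ContinuousOn.neg fun y hy => (P.derivX y hy).continuousAt.continuousWithinAt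
  · exact continuousOn_const.mul (continuousOn_gap.mono fun y hy => P.pos_of_mem hy)

/-- Every solution of the flow is given by the profile. -/
theorem eq_of_isFlow {J : Set ℝ} {x₁ x₂ : ℝ → ℝ} (h : C.IsFlow J x₁ x₂) (hJ : J.OrdConnected)
    (hmem : ∀ t ∈ J, x₁ t / x₂ t ∈ Ioo p q) (h0 : (0 : ℝ) ∈ J) (hX : X (x₁ 0 / x₂ 0) = x₂ 0)
    (hτ : τ (x₁ 0 / x₂ 0) = 0) {t : ℝ} (ht : t ∈ J) :
    X (x₁ t / x₂ t) = x₂ t ∧ τ (x₁ t / x₂ t) = t := by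
  have h1 : ∀ t ∈ J, X (x₁ t / x₂ t) = x₂ t := by
    intro t ht
    -- The quotient x₂/X(y) and then the difference τ(y) - t are constant along the flow.
    have := eq_of_hasDerivWithinAt_zero hJ (f := fun t => x₂ t / X (x₁ t / x₂ t)) (fun t ht => by
      have hd := (P.derivX _ (hmem t ht)).comp_hasDerivWithinAt t (h.hasDerivWithinAt_ratio ht)
      have hp := (P.pos _ (hmem t ht)).ne'
      have hg := (P.gap_neg _ (hmem t ht)).ne
      have h2 := (h.pos₂ t ht).ne'
      refine HasDerivWithinAt.congr_deriv ((h.deriv₂ t ht).div hd hp) ?_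
      generalize C.rho₂ (x₁ t / x₂ t) = a at *
      generalize C.gap (x₁ t / x₂ t) = b at *
      generalize X (x₁ t / x₂ t) = d at *
      field_simp
      ring) h0 ht
    beta_reduce at this
    rw [hX, div_self (h.pos₂ 0 h0).ne', div_eq_one_iff_eq (P.pos _ (hmem t ht)).ne'] at this
    exact this.symm
  refine ⟨h1 t ht, ?_⟩
  have := eq_of_hasDerivWithinAt_zero hJ (f := fun t => τ (x₁ t / x₂ t) - t) (fun t ht => by
    have hd := (P.derivτ _ (hmem t ht)).comp_hasDerivWithinAt t (h.hasDerivWithinAt_ratio ht)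
    have hg := (P.gap_neg _ (hmem t ht)).ne
    have h2 := (h.pos₂ t ht).ne'
    refine HasDerivWithinAt.congr_deriv (hd.sub (hasDerivWithinAt_id t J)) ?_
    rw [h1 t ht]
    generalize C.gap (x₁ t / x₂ t) = b at *
    field_simp
    ring) h0 ht
  beta_reduce at this
  rw [hτ, sub_zero, sub_eq_zero] at this
  exact this

/-- The solution of the flow given by a profile. -/
theorem exists_isFlow : ∃ U : ℝ → ℝ, (∀ y ∈ Ioo p q, U (τ y) = y) ∧
    (∀ t ∈ τ '' Ioo p q, U t ∈ Ioo p q ∧ τ (U t) = t) ∧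
    C.IsFlow (τ '' Ioo p q) (fun t => U t * X (U t)) (fun t => X (U t)) := by
  obtain ⟨U, hU, hU'⟩ := exists_inverse_time P.derivτ (fun y hy => P.derivτ_pos hy)
    P.continuousOn_derivτ
  have hratio : ∀ t ∈ τ '' Ioo p q, U t * X (U t) / X (U t) = U t := fun t ht =>
    mul_div_cancel_right₀ _ (P.pos _ (hU' t ht).1).ne'
  have hd : ∀ t ∈ τ '' Ioo p q, HasDerivAt (fun t => X (U t)) (-2 * C.rho₂ (U t)) t := by
    intro t ht
    obtain ⟨h1, -, h2⟩ := hU' t ht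
    refine HasDerivAt.congr_deriv ((P.derivX' h1).comp t h2) ?_
    rw [mul_assoc, mul_inv_cancel₀ (P.derivτ_pos h1).ne', mul_one]
  refine ⟨U, hU, fun t ht => ⟨(hU' t ht).1, (hU' t ht).2.1⟩,
    fun t ht => mul_pos (P.pos_of_mem (hU' t ht).1) (P.pos _ (hU' t ht).1),
    fun t ht => P.pos _ (hU' t ht).1, fun t ht => ?_, fun t ht => ?_⟩
  · obtain ⟨h1, -, h2⟩ := hU' t ht
    rw [hratio t ht]
    refine HasDerivAt.hasDerivWithinAt ?_
    refine HasDerivAt.congr_deriv (h2.mul (hd t ht)) ?_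
    have hg := (P.gap_neg _ h1).ne
    have hp := (P.pos _ h1).ne'
    have : C.rho₁ (U t) = C.gap (U t) + U t * C.rho₂ (U t) := by rw [gap]; ring
    rw [this]
    field_simp
    ring
  · rw [hratio t ht]
    exact (hd t ht).hasDerivWithinAt

end IsProfile

end RicciCoeffs

/-! ### Limits of powers of |y - r|. -/

section LogPowers

variable {g : ℝ → ℝ} {r A : ℝ}

/-- `Real.log` is the logarithm of the absolute value, so the limit is two-sided and serves both
ends of an interval. -/
theorem tendsto_mul_log_atBot (hA : 0 < A) (hg : ContinuousAt g r) :
    Tendsto (fun y => A * Real.log (y - r) + g y) (𝓝[≠] r) atBot := by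
  have h1 : Tendsto (fun y => y - r) (𝓝[≠] r) (𝓝[≠] 0) := by
    refine tendsto_nhdsWithin_iff.2 ⟨?_, ?_⟩
    · have : Tendsto (fun y => y - r) (𝓝 r) (𝓝 (r - r)) := tendsto_id.sub_const r
      rw [sub_self] at this
      exact this.mono_left nhdsWithin_le_nhds
    · filter_upwards [self_mem_nhdsWithin] with y hy
      exact sub_ne_zero.2 hy
  exact ((Real.tendsto_log_nhdsNE_zero.comp h1).const_mul_atBot hA).atBot_add
    (hg.tendsto.mono_left nhdsWithin_le_nhds)

theorem tendsto_exp_mul_log_of_pos (hA : 0 < A) (hg : ContinuousAt g r) :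
    Tendsto (fun y => Real.exp (A * Real.log (y - r) + g y)) (𝓝[≠] r) (𝓝 0) :=
  Real.tendsto_exp_atBot.comp (tendsto_mul_log_atBot hA hg)

theorem tendsto_exp_mul_log_of_neg (hA : A < 0) (hg : ContinuousAt g r) :
    Tendsto (fun y => Real.exp (A * Real.log (y - r) + g y)) (𝓝[≠] r) atTop := by
  have := tendsto_neg_atBot_atTop.comp (tendsto_mul_log_atBot (neg_pos.2 hA) hg.neg)
  refine Real.tendsto_exp_atTop.comp (this.congr fun y => ?_)
  simp only [Function.comp, Pi.neg_apply]
  ring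

end LogPowers

/-! ### Explicit profiles between the Einstein ratios. -/

namespace RicciCoeffs

theorem exists_primitive {C : RicciCoeffs} {p q : ℝ} (hp : 0 ≤ p) (hgap : ∀ y ∈ Ioo p q, C.gap y < 0)
    {X : ℝ → ℝ} (hX : ∀ y ∈ Ioo p q, HasDerivAt X (X y * (C.rho₂ y / C.gap y)) y)
    {y₀ : ℝ} (hy₀ : y₀ ∈ Ioo p q) :
    ∃ τ : ℝ → ℝ, τ y₀ = 0 ∧ ∀ y ∈ Ioo p q, HasDerivAt τ (-X y / (2 * C.gap y)) y := by
  have hc : ContinuousOn (fun y => -X y / (2 * C.gap y)) (Ioo p q) := by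
    refine ContinuousOn.div ?_ ?_ fun y hy => mul_ne_zero two_ne_zero (hgap y hy).ne
    · exact ContinuousOn.neg fun y hy => (hX y hy).continuousAt.continuousWithinAt
    · exact continuousOn_const.mul (continuousOn_gap.mono fun y hy => hp.trans_lt hy.1)
  refine ⟨fun y => ∫ s in y₀..y, -X s / (2 * C.gap s), intervalIntegral.integral_same,
    fun y hy => ?_⟩
  have hsub : uIcc y₀ y ⊆ Ioo p q := ordConnected_Ioo.uIcc_subset hy₀ hy
  exact intervalIntegral.integral_hasDerivAt_right (hc.mono hsub).intervalIntegrable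
    (hc.stronglyMeasurableAtFilter isOpen_Ioo y hy) (hc.continuousAt (isOpen_Ioo.mem_nhds hy))

namespace IsGeneric

variable {C : RicciCoeffs} {r₁ r₂ r₃ : ℝ} (h : C.IsGeneric r₁ r₂ r₃)

include h

theorem coeff_pos : 0 < C.n₁ + C.n₂ := add_pos h.n₁_pos h.n₂_pos

/-- The partial fraction decomposition of the logarithmic derivative of `x₂` as a function of the
ratio. -/
theorem exists_rho₂_div_gap : ∃ A₀ A₁ A₂ A₃ : ℝ, -1 < A₀ ∧ 0 < A₁ ∧ A₂ < 0 ∧ 0 < A₃ ∧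
    ∀ y, y ≠ 0 → y ≠ r₁ → y ≠ r₂ → y ≠ r₃ → C.rho₂ y / C.gap y =
      A₀ * y⁻¹ + A₁ * (y - r₁)⁻¹ + A₂ * (y - r₂)⁻¹ + A₃ * (y - r₃)⁻¹ := by
  have hn := h.coeff_pos
  have hr₁ := h.pos
  have hr₂ := h.pos₂
  have hr₃ := h.pos₃
  have d₁₂ : 0 < r₂ - r₁ := sub_pos.2 h.lt₁₂
  have d₂₃ : 0 < r₃ - r₂ := sub_pos.2 h.lt₂₃
  have d₁₃ : 0 < r₃ - r₁ := sub_pos.2 (h.lt₁₂.trans h.lt₂₃)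
  -- Residues of ρ₂/gap. At 0 it is -m₂/(m₁ + m₂) > -1; at rᵢ it is rᵢρ₂(rᵢ)/(n∏(rᵢ - rⱼ)), negative
  -- only for r₂, where exactly one factor of the product is negative.
  refine ⟨-C.m₂ / ((C.n₁ + C.n₂) * (r₁ * r₂ * r₃)),
    r₁ * C.rho₂ r₁ / ((C.n₁ + C.n₂) * ((r₂ - r₁) * (r₃ - r₁))),
    -(r₂ * C.rho₂ r₂ / ((C.n₁ + C.n₂) * ((r₂ - r₁) * (r₃ - r₂)))),
    r₃ * C.rho₂ r₃ / ((C.n₁ + C.n₂) * ((r₃ - r₁) * (r₃ - r₂))), ?_, ?_, ?_, ?_, ?_⟩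
  · rw [← h.m_eq, lt_div_iff₀ (add_pos h.m₁_pos h.m₂_pos)]
    linarith [h.m₁_pos]
  · have := h.rho₂_pos₁
    positivity
  · have := h.rho₂_pos₂
    rw [neg_lt_zero]
    positivity
  · have := h.rho₂_pos₃
    positivity
  · intro y h0 h1 h2 h3
    have e1 := sub_ne_zero.2 h1
    have e2 := sub_ne_zero.2 h2
    have e3 := sub_ne_zero.2 h3
    rw [h.gap_eq h0]
    generalize C.n₁ + C.n₂ = n at *
    simp only [rho₂]
    field_simp
    ring

theorem exists_gap_eq_mul {r : ℝ} (hr : r = r₁ ∨ r = r₂ ∨ r = r₃) :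
    ∃ k : ℝ → ℝ, ContinuousOn k (Ioi 0) ∧ ∀ y, 0 < y → C.gap y = k y * (y - r) := by
  have hc : ∀ a b, ContinuousOn (fun y => (C.n₁ + C.n₂) * ((y - a) * (y - b)) / y) (Ioi 0) :=
    fun a b y hy => by
      have : y ≠ 0 := ne_of_gt hy
      fun_prop (disch := assumption)
  rcases hr with rfl | rfl | rfl
  · exact ⟨_, hc r₂ r₃, fun y hy => by rw [h.gap_eq hy.ne']; ring⟩
  · exact ⟨_, hc r₁ r₃, fun y hy => by rw [h.gap_eq hy.ne']; ring⟩
  · exact ⟨_, hc r₁ r₂, fun y hy => by rw [h.gap_eq hy.ne']; ring⟩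

theorem gap_neg_left {y : ℝ} (hy : y ∈ Ioo 0 r₁) : C.gap y < 0 := by
  have h1 := hy.2
  have h2 := h.lt₁₂
  have h3 := h.lt₂₃
  rw [h.gap_eq hy.1.ne']
  refine div_neg_of_neg_of_pos (mul_neg_of_pos_of_neg h.coeff_pos ?_) hy.1
  exact mul_neg_of_pos_of_neg (mul_pos_of_neg_of_neg (by linarith) (by linarith)) (by linarith)

theorem gap_neg_right {y : ℝ} (hy : y ∈ Ioo r₂ r₃) : C.gap y < 0 := by
  have h0 := h.pos
  have h1 := hy.1
  have h2 := h.lt₁₂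
  have h3 := hy.2
  have hy0 : 0 < y := by linarith
  rw [h.gap_eq hy0.ne']
  refine div_neg_of_neg_of_pos (mul_neg_of_pos_of_neg h.coeff_pos ?_) hy0
  exact mul_neg_of_pos_of_neg (mul_pos (by linarith) (by linarith)) (by linarith)

/-- Exponentiate the integrated partial fractions, with c adjusted to the value at y₀. As `Real.log`
takes absolute values, one formula works on every interval between the poles. -/
theorem exists_log_profile {y₀ a : ℝ} (ha : 0 < a) : ∃ A₀ A₁ A₂ A₃ c : ℝ,
    -1 < A₀ ∧ 0 < A₁ ∧ A₂ < 0 ∧ 0 < A₃ ∧ ∃ X : ℝ → ℝ, X y₀ = a ∧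
    (∀ y, X y = Real.exp (A₀ * Real.log y + A₁ * Real.log (y - r₁) + A₂ * Real.log (y - r₂) +
      A₃ * Real.log (y - r₃) + c)) ∧
    ∀ y, y ≠ 0 → y ≠ r₁ → y ≠ r₂ → y ≠ r₃ →
      HasDerivAt X (X y * (C.rho₂ y / C.gap y)) y := by
  obtain ⟨A₀, A₁, A₂, A₃, h₀, h₁, h₂, h₃, hA⟩ := h.exists_rho₂_div_gap
  set L : ℝ → ℝ := fun y => A₀ * Real.log y + A₁ * Real.log (y - r₁) + A₂ * Real.log (y - r₂) +
    A₃ * Real.log (y - r₃) with hL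
  refine ⟨A₀, A₁, A₂, A₃, Real.log a - L y₀, h₀, h₁, h₂, h₃,
    fun y => Real.exp (L y + (Real.log a - L y₀)), ?_, fun y => rfl, ?_⟩
  · beta_reduce
    rw [add_sub_cancel, Real.exp_log ha]
  · intro y e0 e1 e2 e3
    have hlog : ∀ r, y ≠ r → HasDerivAt (fun y => Real.log (y - r)) (y - r)⁻¹ y := fun r hr => by
      simpa using ((hasDerivAt_id y).sub_const r).log (sub_ne_zero.2 hr)
    rw [hA y e0 e1 e2 e3]
    exact ((((((Real.hasDerivAt_log e0).const_mul A₀).add ((hlog r₁ e1).const_mul A₁)).add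
      ((hlog r₂ e2).const_mul A₂)).add ((hlog r₃ e3).const_mul A₃)).add_const _).exp

/-- The end behaviour is read off from the exponents A₃ > 0 at r₃ and A₂ < 0 at r₂. -/
theorem exists_profile_right {y₀ a : ℝ} (hy₀ : y₀ ∈ Ioo r₂ r₃) (ha : 0 < a) : ∃ X τ : ℝ → ℝ,
    C.IsProfile r₂ r₃ X τ ∧ X y₀ = a ∧ τ y₀ = 0 ∧ Tendsto X (𝓝[<] r₃) (𝓝 0) ∧
      Tendsto X (𝓝[>] r₂) atTop := by
  obtain ⟨A₀, A₁, A₂, A₃, c, h₀, h₁, h₂, h₃, X, hX₀, hX, hXd⟩ := h.exists_log_profile (y₀ := y₀) ha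
  have hr₁ := h.pos
  have hr₂ := h.pos₂
  have hr₃ := h.pos₃
  have d₁₂ : r₂ - r₁ ≠ 0 := (sub_pos.2 h.lt₁₂).ne'
  have d₂₃ : r₃ - r₂ ≠ 0 := (sub_pos.2 h.lt₂₃).ne'
  have d₃₂ : r₂ - r₃ ≠ 0 := (sub_neg.2 h.lt₂₃).ne
  have d₁₃ : r₃ - r₁ ≠ 0 := (sub_pos.2 (h.lt₁₂.trans h.lt₂₃)).ne'
  have hd : ∀ y ∈ Ioo r₂ r₃, HasDerivAt X (X y * (C.rho₂ y / C.gap y)) y := fun y hy =>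
    hXd y (hr₂.trans hy.1).ne' (h.lt₁₂.trans hy.1).ne' hy.1.ne' hy.2.ne
  obtain ⟨τ, hτ₀, hτ⟩ := exists_primitive hr₂.le (fun y => h.gap_neg_right) hd hy₀
  refine ⟨X, τ, ⟨hr₂.le, h.lt₂₃, fun y => h.gap_neg_right, fun y _ => ?_, hd, hτ⟩, hX₀, hτ₀, ?_, ?_⟩
  · rw [hX]
    exact Real.exp_pos _
  · have hg : ContinuousAt (fun y => A₀ * Real.log y + A₁ * Real.log (y - r₁) +
        A₂ * Real.log (y - r₂) + c) r₃ := by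
      have := hr₃.ne'
      fun_prop (disch := assumption)
    refine ((tendsto_exp_mul_log_of_pos h₃ hg).mono_left (nhdsLT_le_nhdsNE r₃)).congr fun y => ?_
    rw [hX]
    ring_nf
  · have hg : ContinuousAt (fun y => A₀ * Real.log y + A₁ * Real.log (y - r₁) +
        A₃ * Real.log (y - r₃) + c) r₂ := by
      have := hr₂.ne'
      fun_prop (disch := assumption)
    refine ((tendsto_exp_mul_log_of_neg h₂ hg).mono_left (nhdsGT_le_nhdsNE r₂)).congr fun y => ?_
    rw [hX]
    ring_nf

/-- Near 0, X behaves like y^A₀ and 1/gap like y, so dt/dy is of order y^(1+A₀) and tends to 0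
because A₀ > -1. The bound 1 is an arbitrary positive constant. -/
theorem exists_profile_left {y₀ a : ℝ} (hy₀ : y₀ ∈ Ioo 0 r₁) (ha : 0 < a) : ∃ X τ : ℝ → ℝ,
    C.IsProfile 0 r₁ X τ ∧ X y₀ = a ∧ τ y₀ = 0 ∧ Tendsto X (𝓝[<] r₁) (𝓝 0) ∧
      ∀ᶠ y in 𝓝[>] 0, -X y / (2 * C.gap y) ≤ 1 := by
  obtain ⟨A₀, A₁, A₂, A₃, c, h₀, h₁, h₂, h₃, X, hX₀, hX, hXd⟩ := h.exists_log_profile (y₀ := y₀) ha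
  have hr₁ := h.pos
  have hr₂ := h.pos₂
  have hr₃ := h.pos₃
  have d₁₂ : r₁ - r₂ ≠ 0 := (sub_neg.2 h.lt₁₂).ne
  have d₁₃ : r₁ - r₃ ≠ 0 := (sub_neg.2 (h.lt₁₂.trans h.lt₂₃)).ne
  have hd : ∀ y ∈ Ioo 0 r₁, HasDerivAt X (X y * (C.rho₂ y / C.gap y)) y := fun y hy =>
    hXd y hy.1.ne' hy.2.ne (hy.2.trans h.lt₁₂).ne (hy.2.trans (h.lt₁₂.trans h.lt₂₃)).ne
  obtain ⟨τ, hτ₀, hτ⟩ := exists_primitive le_rfl (fun y => h.gap_neg_left) hd hy₀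
  refine ⟨X, τ, ⟨le_rfl, h.pos, fun y => h.gap_neg_left, fun y _ => ?_, hd, hτ⟩, hX₀, hτ₀, ?_, ?_⟩
  · rw [hX]
    exact Real.exp_pos _
  · have hg : ContinuousAt (fun y => A₀ * Real.log y + A₂ * Real.log (y - r₂) +
        A₃ * Real.log (y - r₃) + c) r₁ := by
      have := hr₁.ne'
      fun_prop (disch := assumption)
    refine ((tendsto_exp_mul_log_of_pos h₁ hg).mono_left (nhdsLT_le_nhdsNE r₁)).congr fun y => ?_
    rw [hX]
    ring_nf
  · have e1 : (0 : ℝ) - r₁ ≠ 0 := by linarith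
    have e2 : (0 : ℝ) - r₂ ≠ 0 := by linarith
    have e3 : (0 : ℝ) - r₃ ≠ 0 := by linarith
    have hg : ContinuousAt (fun y => A₁ * Real.log (y - r₁) + A₂ * Real.log (y - r₂) +
        A₃ * Real.log (y - r₃) + c) 0 := by
      fun_prop (disch := assumption)
    have hn := h.coeff_pos
    have hk : ContinuousAt (fun y => -1 / (2 * ((C.n₁ + C.n₂) *
        ((y - r₁) * (y - r₂) * (y - r₃))))) 0 := by
      have : 2 * ((C.n₁ + C.n₂) * (((0 : ℝ) - r₁) * (0 - r₂) * (0 - r₃))) ≠ 0 :=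
        mul_ne_zero two_ne_zero (mul_ne_zero hn.ne' (mul_ne_zero (mul_ne_zero e1 e2) e3))
      fun_prop (disch := assumption)
    have h4 := ((tendsto_exp_mul_log_of_pos (show 0 < 1 + A₀ by linarith) hg).mono_left
      (nhdsGT_le_nhdsNE 0)).mul (hk.tendsto.mono_left nhdsWithin_le_nhds)
    rw [zero_mul] at h4
    filter_upwards [h4.eventually (gt_mem_nhds one_pos), self_mem_nhdsWithin] with y hy hy0
    have hy0 : 0 < y := hy0
    refine le_of_eq_of_le ?_ hy.le
    rw [hX, h.gap_eq hy0.ne']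
    have : Real.exp ((1 + A₀) * Real.log (y - 0) + (A₁ * Real.log (y - r₁) +
        A₂ * Real.log (y - r₂) + A₃ * Real.log (y - r₃) + c)) = y * Real.exp (A₀ * Real.log y +
        A₁ * Real.log (y - r₁) + A₂ * Real.log (y - r₂) + A₃ * Real.log (y - r₃) + c) := by
      refine Eq.trans ?_ (congrArg (· * _) (Real.exp_log hy0))
      rw [← Real.exp_add, sub_zero]
      ring_nf
    rw [this, mul_div_assoc', div_div_eq_mul_div]
    ring

end IsGeneric

end RicciCoeffs

/-! ### Maximal solutions and their asymptotics. -/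

namespace RicciCoeffs

/-- `(x₁, x₂)` is the solution of the flow with initial value `(a₁, a₂)`, maximal among the
solutions on intervals contained in `A`. It is defined on the interval `I`, and it shrinks to zero
at time `T`, at a linear rate, while the ratio tends to `r`. -/
structure IsShrinkingFlow (C : RicciCoeffs) (A I : Set ℝ) (T a₁ a₂ r : ℝ) (x₁ x₂ : ℝ → ℝ) :
    Prop where
  pos : 0 < T
  flow : C.IsFlow I x₁ x₂
  init₁ : x₁ 0 = a₁
  init₂ : x₂ 0 = a₂
  maximal : ∀ J ⊆ A, J.OrdConnected → (0 : ℝ) ∈ J → ∀ z₁ z₂, C.IsFlow J z₁ z₂ → z₁ 0 = a₁ →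
    z₂ 0 = a₂ → J ⊆ I ∧ EqOn z₁ x₁ J ∧ EqOn z₂ x₂ J
  ratio : Tendsto (fun t => x₁ t / x₂ t) (𝓝[<] T) (𝓝 r)
  rate : ∃ c, 0 < c ∧ Tendsto (fun t => x₂ t / (T - t)) (𝓝[<] T) (𝓝 c)

/-- As `t → -∞`, the solution `(x₁, x₂)` grows at a linear rate, while the ratio tends to `r`. -/
structure IsAncientFlow (r : ℝ) (x₁ x₂ : ℝ → ℝ) : Prop where
  ratio : Tendsto (fun t => x₁ t / x₂ t) atBot (𝓝 r)
  rate : ∃ c, 0 < c ∧ Tendsto (fun t => x₂ t / (-t)) atBot (𝓝 c)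

variable {C : RicciCoeffs}

/-- The rate carries over because x₂/(T - t) is the product of x₂/x₁ → r⁻¹ and x₁/(T - t). -/
theorem IsShrinkingFlow.of_swap {A I : Set ℝ} {T a₁ a₂ r : ℝ} {x₁ x₂ : ℝ → ℝ} (hr : 0 < r)
    (hI : Ico 0 T ⊆ I)
    (h : C.swap.IsShrinkingFlow A I T a₂ a₁ r⁻¹ x₂ x₁) : C.IsShrinkingFlow A I T a₁ a₂ r x₁ x₂ := by
  refine ⟨h.pos, h.flow.of_swap, h.init₂, h.init₁, ?_, ?_, ?_⟩
  · intro J hJA hJ h0 z₁ z₂ hz h₁ h₂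
    obtain ⟨k₁, k₂, k₃⟩ := h.maximal J hJA hJ h0 z₂ z₁ hz.swap h₂ h₁
    exact ⟨k₁, k₃, k₂⟩
  · simpa using h.ratio.inv₀ (inv_ne_zero hr.ne')
  · obtain ⟨c, hc, hlim⟩ := h.rate
    refine ⟨r⁻¹ * c, mul_pos (inv_pos.2 hr) hc, (h.ratio.mul hlim).congr' ?_⟩
    filter_upwards [Ico_mem_nhdsLT h.pos] with t ht
    have := (h.flow.pos₂ t (hI ht)).ne'
    field_simp

theorem IsAncientFlow.of_swap {r T : ℝ} {x₁ x₂ : ℝ → ℝ} (hr : 0 < r)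
    (hflow : C.IsFlow (Iio T) x₁ x₂) (h : IsAncientFlow r⁻¹ x₂ x₁) : IsAncientFlow r x₁ x₂ := by
  refine ⟨by simpa using h.ratio.inv₀ (inv_ne_zero hr.ne'), ?_⟩
  obtain ⟨c, hc, hlim⟩ := h.rate
  refine ⟨r⁻¹ * c, mul_pos (inv_pos.2 hr) hc, (h.ratio.mul hlim).congr' ?_⟩
  filter_upwards [Iio_mem_atBot T] with t ht
  have := (hflow.pos₁ t ht).ne'
  field_simp

/-- Reparametrise the profile by time, U = τ⁻¹. Any other solution keeps its ratio in (p, q), hence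
lies on the profile, and its times lie in the image of τ: this is uniqueness and maximality at once.
-/
theorem IsProfile.exists_isShrinkingFlow {p q a₁ a₂ : ℝ} {X τ : ℝ → ℝ} (P : C.IsProfile p q X τ)
    (hy : a₁ / a₂ ∈ Ioo p q) (ha₂ : 0 < a₂) (hX : X (a₁ / a₂) = a₂) (hτ : τ (a₁ / a₂) = 0)
    (hq : 0 < C.rho₂ q) (hXq : Tendsto X (𝓝[<] q) (𝓝 0))
    (hmem : ∀ J : Set ℝ, J.OrdConnected → (0 : ℝ) ∈ J → ∀ z₁ z₂, C.IsFlow J z₁ z₂ → z₁ 0 = a₁ →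
      z₂ 0 = a₂ → ∀ t ∈ J, z₁ t / z₂ t ∈ Ioo p q) :
    ∃ (T : ℝ) (U x₁ x₂ : ℝ → ℝ), Ico 0 T ⊆ τ '' Ioo p q ∧ τ '' Ioo p q ⊆ Iio T ∧
      (∀ t ∈ τ '' Ioo p q, U t ∈ Ioo p q ∧ τ (U t) = t ∧ x₁ t / x₂ t = U t ∧ x₂ t = X (U t)) ∧
      C.IsShrinkingFlow univ (τ '' Ioo p q) T a₁ a₂ q x₁ x₂ := by
  obtain ⟨U, hU, hU', hflow⟩ := P.exists_isFlow
  have hq0 : 0 < q := P.nonneg.trans_lt P.lt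
  have hρ : Tendsto C.rho₂ (𝓝[<] q) (𝓝 (C.rho₂ q)) :=
    (continuousOn_rho₂.continuousAt (Ioi_mem_nhds hq0)).tendsto.mono_left nhdsWithin_le_nhds
  obtain ⟨T, hT, hlt, hrate⟩ := exists_tendsto_time P.lt P.derivτ (fun y hy => P.derivτ_pos hy)
    (fun y hy => P.derivX' hy) P.pos hq hρ hXq
  have hmono := strictMonoOn_of_hasDerivAt_pos P.derivτ fun y hy => P.derivτ_pos hy
  have hord : (τ '' Ioo p q).OrdConnected := (ordConnected_Ioo.isPreconnected.image _ fun y hy =>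
    (P.derivτ y hy).continuousAt.continuousWithinAt).ordConnected
  have hIoo : ∀ y ∈ Ioo p q, Ico (τ y) T ⊆ τ '' Ioo p q := by
    intro y hy t ht
    obtain ⟨u, hu1, hu2⟩ := ((hT.eventually (lt_mem_nhds ht.2)).and (Ioo_mem_nhdsLT P.lt)).exists
    exact hord.out ⟨y, hy, rfl⟩ ⟨u, hu2, rfl⟩ ⟨ht.1, hu1.le⟩
  have hT0 : 0 < T := hτ ▸ hlt _ hy
  -- As τ increases strictly to T at q, its inverse tends to q at T.
  have hUq : Tendsto U (𝓝[<] T) (𝓝[<] q) := by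
    refine tendsto_nhdsWithin_iff.2 ⟨tendsto_order.2 ⟨fun c hc => ?_, fun c hc => ?_⟩, ?_⟩
    · obtain ⟨u, hu1, hu2⟩ := exists_between (max_lt hc P.lt)
      have hu : u ∈ Ioo p q := ⟨(le_max_right _ _).trans_lt hu1, hu2⟩
      filter_upwards [Ioo_mem_nhdsLT (hlt u hu)] with t ht
      obtain ⟨h1, h2⟩ := hU' t (hIoo u hu ⟨ht.1.le, ht.2⟩)
      refine ((le_max_left _ _).trans_lt hu1).trans ((hmono.lt_iff_lt hu h1).1 ?_)
      rw [h2]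
      exact ht.1
    · filter_upwards [Ico_mem_nhdsLT (hlt _ hy)] with t ht
      exact (hU' t (hIoo _ hy ht)).1.2.trans hc
    · filter_upwards [Ico_mem_nhdsLT (hlt _ hy)] with t ht
      exact (hU' t (hIoo _ hy ht)).1.2
  have hratio : ∀ t ∈ τ '' Ioo p q, U t * X (U t) / X (U t) = U t := fun t ht =>
    mul_div_cancel_right₀ _ (P.pos _ (hU' t ht).1).ne'
  have hU0 : U 0 = a₁ / a₂ := by rw [← hτ, hU _ hy]
  refine ⟨T, U, _, _, ?_, ?_, fun t ht => ⟨(hU' t ht).1, (hU' t ht).2, hratio t ht, rfl⟩, hT0, hflow,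
    ?_, ?_, ?_, ?_, ?_⟩
  · have := hIoo _ hy
    rwa [hτ] at this
  · rintro _ ⟨y, hy, rfl⟩
    exact hlt y hy
  · rw [hU0, hX, div_mul_cancel₀ _ ha₂.ne']
  · rw [hU0, hX]
  · intro J _ hJ h0 z₁ z₂ hz h₁ h₂
    have hm := hmem J hJ h0 z₁ z₂ hz h₁ h₂
    have key : ∀ t ∈ J, X (z₁ t / z₂ t) = z₂ t ∧ τ (z₁ t / z₂ t) = t := fun t ht =>
      P.eq_of_isFlow hz hJ hm h0 (by rw [h₁, h₂, hX]) (by rw [h₁, h₂, hτ]) ht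
    have hUt : ∀ t ∈ J, U t = z₁ t / z₂ t := fun t ht => by
      rw [← hU _ (hm t ht), (key t ht).2]
    refine ⟨fun t ht => ⟨_, hm t ht, (key t ht).2⟩, fun t ht => ?_, fun t ht => ?_⟩
    · beta_reduce
      rw [hUt t ht, (key t ht).1, div_mul_cancel₀ _ (hz.pos₂ t ht).ne']
    · beta_reduce
      rw [hUt t ht, (key t ht).1]
  · refine (hUq.mono_right nhdsWithin_le_nhds).congr' ?_
    filter_upwards [Ico_mem_nhdsLT (hlt _ hy)] with t ht
    exact (hratio t (hIoo _ hy ht)).symm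
  · refine ⟨_, mul_pos two_pos hq, (hrate.comp hUq).congr' ?_⟩
    filter_upwards [Ico_mem_nhdsLT (hlt _ hy)] with t ht
    rw [Function.comp, (hU' t (hIoo _ hy ht)).2]

namespace IsGeneric

variable {r₁ r₂ r₃ a₁ a₂ : ℝ} (h : C.IsGeneric r₁ r₂ r₃)

include h

/-- An end of the interval is 0, excluded by positivity, or an Einstein ratio, which a nonconstant
ratio never meets. -/
theorem ratio_mem_Ioo {p q : ℝ} (hp : p = 0 ∨ p = r₂) (hq : q = r₁ ∨ q = r₃)
    (hy : a₁ / a₂ ∈ Ioo p q) (J : Set ℝ) (hJ : J.OrdConnected) (h0 : (0 : ℝ) ∈ J)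
    (z₁ z₂ : ℝ → ℝ) (hz : C.IsFlow J z₁ z₂) (hz₁ : z₁ 0 = a₁) (hz₂ : z₂ 0 = a₂) (t : ℝ)
    (ht : t ∈ J) : z₁ t / z₂ t ∈ Ioo p q := by
  have hy' : z₁ 0 / z₂ 0 ∈ Ioo p q := by rwa [hz₁, hz₂]
  refine hz.ratio_mem_Ioo hJ h0 hy' (fun t ht => ?_) (fun t ht => ?_) ht
  · rcases hp with rfl | rfl
    · exact (hz.ratio_pos ht).ne'
    · obtain ⟨k, hk, hk'⟩ := h.exists_gap_eq_mul (Or.inr (Or.inl rfl))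
      exact hz.ratio_ne hJ hk hk' h0 hy'.1.ne' ht
  · obtain ⟨k, hk, hk'⟩ := h.exists_gap_eq_mul (hq.imp_right Or.inr)
    exact hz.ratio_ne hJ hk hk' h0 hy'.2.ne ht

/-- The flow starting from a ratio below the smallest Einstein ratio. -/
theorem exists_flow_left (hy : a₁ / a₂ ∈ Ioo 0 r₁) (ha₂ : 0 < a₂) :
    (∃ (T : ℝ) (x₁ x₂ : ℝ → ℝ), C.IsShrinkingFlow (Ici 0) (Ico 0 T) T a₁ a₂ r₁ x₁ x₂) ∧
    ∀ (T : ℝ) (z₁ z₂ : ℝ → ℝ), 0 < T → C.IsFlow (Iio T) z₁ z₂ → z₁ 0 = a₁ → z₂ 0 ≠ a₂ := by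
  obtain ⟨X, τ, P, hX, hτ, hXq, hbound⟩ := h.exists_profile_left hy ha₂
  obtain ⟨T, U, x₁, x₂, hI, hI', -, hS⟩ := P.exists_isShrinkingFlow hy ha₂ hX hτ h.rho₂_pos₁ hXq
    (h.ratio_mem_Ioo (Or.inl rfl) (Or.inl rfl) hy)
  refine ⟨⟨T, x₁, x₂, hS.pos, hS.flow.mono hI, hS.init₁, hS.init₂, ?_, hS.ratio, hS.rate⟩, ?_⟩
  · intro J hJA hJ h0 z₁ z₂ hz h₁ h₂
    obtain ⟨k₁, k₂⟩ := hS.maximal J (subset_univ J) hJ h0 z₁ z₂ hz h₁ h₂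
    exact ⟨fun t ht => ⟨hJA ht, hI' (k₁ ht)⟩, k₂⟩
  · intro T' z₁ z₂ hT' hz h₁ h₂
    obtain ⟨B, hB⟩ := exists_lower_bound_time P.lt P.derivτ (fun y hy => P.derivτ_pos hy) hbound
    obtain ⟨k₁, -⟩ := hS.maximal (Iio T') (subset_univ _) ordConnected_Iio hT' z₁ z₂ hz h₁ h₂
    -- A time in the domain of the supposed ancient flow, but below the lower bound B of all times
    -- on the profile.
    obtain ⟨y, hy, hyt⟩ := k₁ (show min (B - 1) 0 ∈ Iio T' from (min_le_right _ _).trans_lt hT')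
    have := hB y hy
    rw [hyt] at this
    linarith [min_le_left (B - 1) 0]

/-- The flow starting from a ratio between the two largest Einstein ratios. -/
theorem exists_flow_right (hy : a₁ / a₂ ∈ Ioo r₂ r₃) (ha₂ : 0 < a₂) :
    ∃ (T : ℝ) (x₁ x₂ : ℝ → ℝ), C.IsShrinkingFlow univ (Iio T) T a₁ a₂ r₃ x₁ x₂ ∧
      IsAncientFlow r₂ x₁ x₂ := by
  obtain ⟨X, τ, P, hX, hτ, hXq, hXp⟩ := h.exists_profile_right hy ha₂
  obtain ⟨T, U, x₁, x₂, hI, hI', hU, hS⟩ := P.exists_isShrinkingFlow hy ha₂ hX hτ h.rho₂_pos₃ hXq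
    (h.ratio_mem_Ioo (Or.inr rfl) (Or.inr rfl) hy)
  have hρ : Tendsto C.rho₂ (𝓝[>] r₂) (𝓝 (C.rho₂ r₂)) :=
    (continuousOn_rho₂.continuousAt (Ioi_mem_nhds h.pos₂)).tendsto.mono_left nhdsWithin_le_nhds
  obtain ⟨hbot, hrate⟩ := tendsto_time_atBot P.lt P.derivτ (fun y hy => P.derivτ_pos hy)
    (fun y hy => P.derivX' hy) h.rho₂_pos₂ hρ hXp
  have hmono := strictMonoOn_of_hasDerivAt_pos P.derivτ fun y hy => P.derivτ_pos hy
  have hord : (τ '' Ioo r₂ r₃).OrdConnected :=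
    (ordConnected_Ioo.isPreconnected.image _ fun y hy =>
      (P.derivτ y hy).continuousAt.continuousWithinAt).ordConnected
  -- The image is an interval, it contains [0, T), and τ → -∞ at r₂.
  have heq : τ '' Ioo r₂ r₃ = Iio T := by
    refine hI'.antisymm fun t ht => ?_
    rcases le_total 0 t with h0 | h0
    · exact hI ⟨h0, ht⟩
    · obtain ⟨u, hu1, hu2⟩ := ((hbot.eventually_le_atBot t).and (Ioo_mem_nhdsGT P.lt)).exists
      exact hord.out ⟨u, hu2, rfl⟩ ⟨_, hy, hτ⟩ ⟨hu1, h0⟩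
  rw [heq] at hS hU
  refine ⟨T, x₁, x₂, hS, ?_⟩
  have hUp : Tendsto U atBot (𝓝[>] r₂) := by
    refine tendsto_nhdsWithin_iff.2 ⟨tendsto_order.2 ⟨fun c hc => ?_, fun c hc => ?_⟩, ?_⟩
    · filter_upwards [Iio_mem_atBot T] with t ht
      exact hc.trans (hU t ht).1.1
    · obtain ⟨u, hu1, hu2⟩ := exists_between (lt_min hc P.lt)
      have hu : u ∈ Ioo r₂ r₃ := ⟨hu1, hu2.trans_le (min_le_right _ _)⟩
      filter_upwards [Iio_mem_atBot T, Iio_mem_atBot (τ u)] with t ht htu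
      obtain ⟨h1, h2, -⟩ := hU t ht
      refine lt_trans ((hmono.lt_iff_lt h1 hu).1 ?_) (hu2.trans_le (min_le_left _ _))
      rw [h2]
      exact htu
    · filter_upwards [Iio_mem_atBot T] with t ht
      exact (hU t ht).1.1
  refine ⟨(hUp.mono_right nhdsWithin_le_nhds).congr' ?_, _, mul_pos two_pos h.rho₂_pos₂,
    (hrate.comp hUp).congr' ?_⟩
  · filter_upwards [Iio_mem_atBot T] with t ht
    exact (hU t ht).2.2.1.symm
  · filter_upwards [Iio_mem_atBot T] with t ht
    obtain ⟨-, h2, -, h3⟩ := hU t ht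
    rw [Function.comp, h2, h3]

/-- For the exchanged summands, (r₁, r₂) becomes the interval (r₂⁻¹, r₁⁻¹) between the two largest
ratios. -/
theorem exists_flow_right' (hy : a₁ / a₂ ∈ Ioo r₁ r₂) (ha₁ : 0 < a₁) :
    ∃ (T : ℝ) (x₁ x₂ : ℝ → ℝ), C.IsShrinkingFlow univ (Iio T) T a₁ a₂ r₁ x₁ x₂ ∧
      IsAncientFlow r₂ x₁ x₂ := by
  have hy' : a₂ / a₁ ∈ Ioo r₂⁻¹ r₁⁻¹ := by
    rw [← inv_div]
    exact ⟨inv_strictAnti₀ (h.pos.trans hy.1) hy.2, inv_strictAnti₀ h.pos hy.1⟩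
  obtain ⟨T, x₂, x₁, hS, hA⟩ := h.swap.exists_flow_right hy' ha₁
  exact ⟨T, x₁, x₂, hS.of_swap h.pos Ico_subset_Iio_self, hA.of_swap h.pos₂ hS.flow.of_swap⟩

/-- For the exchanged summands, (r₃, ∞) becomes the interval (0, r₃⁻¹) below the smallest ratio. -/
theorem exists_flow_left' (hy : r₃ < a₁ / a₂) (ha₁ : 0 < a₁) :
    (∃ (T : ℝ) (x₁ x₂ : ℝ → ℝ), C.IsShrinkingFlow (Ici 0) (Ico 0 T) T a₁ a₂ r₃ x₁ x₂) ∧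
    ∀ (T : ℝ) (z₁ z₂ : ℝ → ℝ), 0 < T → C.IsFlow (Iio T) z₁ z₂ → z₁ 0 = a₁ → z₂ 0 ≠ a₂ := by
  have hy' : a₂ / a₁ ∈ Ioo 0 r₃⁻¹ := by
    rw [← inv_div]
    exact ⟨inv_pos.2 (h.pos₃.trans hy), inv_strictAnti₀ h.pos₃ hy⟩
  obtain ⟨⟨T, x₂, x₁, hS⟩, hno⟩ := h.swap.exists_flow_left hy' ha₁
  exact ⟨⟨T, x₁, x₂, hS.of_swap h.pos₃ subset_rfl⟩,
    fun T z₁ z₂ hT hz h₁ h₂ => hno T z₂ z₁ hT hz.swap h₂ h₁⟩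

end IsGeneric

end RicciCoeffs

theorem bddAbove_image_Ico_of_tendsto {f : ℝ → ℝ} {a b l : ℝ} (hab : a < b)
    (hf : ContinuousOn f (Ico a b)) (hl : Tendsto f (𝓝[<] b) (𝓝 l)) :
    BddAbove (f '' Ico a b) := by
  obtain ⟨c, hc, hcb⟩ := (mem_nhdsLT_iff_exists_Ioo_subset' hab).1
    (hl.eventually (gt_mem_nhds (lt_add_one l)))
  have hc : c < b := hc
  obtain ⟨M, hM⟩ := (isCompact_Icc (a := a) (b := c)).bddAbove_image
    (hf.mono fun t ht => ⟨ht.1, ht.2.trans_lt hc⟩)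
  refine ⟨max M (l + 1), ?_⟩
  rintro _ ⟨t, ht, rfl⟩
  rcases le_or_gt t c with h | h
  · exact le_max_of_le_left (hM ⟨t, ⟨ht.1, h⟩, rfl⟩)
  · have h1 : f t < l + 1 := hcb ⟨h, ht.2⟩
    exact le_max_of_le_right h1.le

/-! ### From the planar system back to homogeneous Ricci flows. -/

section HomogeneousFlow

variable {E : Type*} [NormedAddCommGroup E] [NormedSpace ℝ E] [FiniteDimensional ℝ E]
  {F : Type*} [NormedAddCommGroup F] [NormedSpace ℝ F]
  {G : Type*} [TopologicalSpace G] [ChartedSpace E G] [Group G] [LieGroup 𝓘(ℝ, E) ∞ G]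
  {K : Subgroup G} [ChartedSpace F K]

namespace IsTwoSummand

variable {D : IsotropyRep E F K} {Q : InvariantMetric D}
  {𝔭₁ 𝔭₂ : Submodule ℝ (GroupLieAlgebra 𝓘(ℝ, E) G)} (H : IsTwoSummand Q 𝔭₁ 𝔭₂)
  {C : RicciCoeffs} (hC : HasRicciCoeffs Q 𝔭₁ 𝔭₂ C)

include H

theorem isDiagonal_unique {g : InvariantMetric D} {x₁ x₂ z₁ z₂ : ℝ}
    (hx : g.IsDiagonal Q 𝔭₁ 𝔭₂ x₁ x₂) (hz : g.IsDiagonal Q 𝔭₁ 𝔭₂ z₁ z₂) :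
    z₁ = x₁ ∧ z₂ = x₂ := by
  obtain ⟨X, hX, hX0⟩ := H.exists_ne_zero₁
  obtain ⟨Y, hY, hY0⟩ := H.exists_ne_zero₂
  exact ⟨mul_right_cancel₀ (Q.pos X hX0).ne'
      ((hz.2.2.1 X X hX hX).symm.trans (hx.2.2.1 X X hX hX)),
    mul_right_cancel₀ (Q.pos Y hY0).ne'
      ((hz.2.2.2.1 Y Y hY hY).symm.trans (hx.2.2.2.1 Y Y hY hY))⟩

/-- For t < 0, |t||Rm| = Φ(y)·(x₂/(-t))⁻¹, and both factors converge. -/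
theorem isTypeIAncient {T r : ℝ} {g : ℝ → InvariantMetric D} {x₁ x₂ : ℝ → ℝ}
    (hx : ∀ t ∈ Iio T, (g t).IsDiagonal Q 𝔭₁ 𝔭₂ (x₁ t) (x₂ t)) (hr : 0 < r)
    (hA : RicciCoeffs.IsAncientFlow r x₁ x₂) : IsTypeIAncient g := by
  obtain ⟨Φ, hΦc, hΦ⟩ := H.exists_normRm_eq
  obtain ⟨c, hc, hrate⟩ := hA.rate
  have hΦr : Tendsto (fun t => Φ (x₁ t / x₂ t)) atBot (𝓝 (Φ r)) :=
    (hΦc.continuousAt (Ioi_mem_nhds hr)).tendsto.comp hA.ratio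
  refine ⟨Φ r * c⁻¹, (hΦr.mul (hrate.inv₀ hc.ne')).congr' ?_⟩
  filter_upwards [Iio_mem_atBot T, Iio_mem_atBot 0] with t ht ht0
  have ht0 : t < 0 := ht0
  rw [hΦ _ _ _ (hx t ht), abs_of_neg ht0, inv_div]
  ring

include hC

/-- Test the flow equation on one nonzero vector of each summand. -/
theorem isFlow_of_isHRF {I : Set ℝ} {g : ℝ → InvariantMetric D} (hg : IsHRF I g) {x₁ x₂ : ℝ → ℝ}
    (hx : ∀ t ∈ I, (g t).IsDiagonal Q 𝔭₁ 𝔭₂ (x₁ t) (x₂ t)) : C.IsFlow I x₁ x₂ := by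
  have aux : ∀ (x : ℝ → ℝ) (c : ℝ) (X : D.𝔭), X ≠ 0 →
      (∀ t ∈ I, (g t).form X X = x t * Q.form X X) → ∀ t ∈ I,
      (g t).ricci X X = c * Q.form X X → HasDerivWithinAt x (-2 * c) I t := by
    intro x c X hX h t ht hr
    have hQ := (Q.pos X hX).ne'
    have hx : ∀ s ∈ I, x s = (g s).form X X / Q.form X X := fun s hs => by
      rw [h s hs, mul_div_cancel_right₀ _ hQ]
    refine HasDerivWithinAt.congr_deriv
      (((hg t ht X X).div_const (Q.form X X)).congr hx (hx t ht)) ?_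
    rw [hr]
    field_simp
  obtain ⟨X, hX, hX0⟩ := H.exists_ne_zero₁
  obtain ⟨Y, hY, hY0⟩ := H.exists_ne_zero₂
  exact ⟨fun t ht => (hx t ht).1, fun t ht => (hx t ht).2.1,
    fun t ht => aux x₁ _ X hX0 (fun s hs => (hx s hs).2.2.1 X X hX hX) t ht
      ((hC _ _ _ (hx t ht)).1 X X hX hX),
    fun t ht => aux x₂ _ Y hY0 (fun s hs => (hx s hs).2.2.2.1 Y Y hY hY) t ht
      ((hC _ _ _ (hx t ht)).2 Y Y hY hY)⟩

theorem isHRF_of_isFlow {I : Set ℝ} {g : ℝ → InvariantMetric D} {x₁ x₂ : ℝ → ℝ}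
    (h : C.IsFlow I x₁ x₂) (hx : ∀ t ∈ I, (g t).IsDiagonal Q 𝔭₁ 𝔭₂ (x₁ t) (x₂ t)) :
    IsHRF I g := by
  intro t ht X Y
  refine HasDerivWithinAt.congr_deriv (HasDerivWithinAt.congr
    (((h.deriv₁ t ht).mul_const (Q.form (H.proj₁ X) (H.proj₁ Y))).add
      ((h.deriv₂ t ht).mul_const (Q.form (H.proj₂ X) (H.proj₂ Y))))
    (fun s hs => H.form_eq (hx s hs) X Y) (H.form_eq (hx t ht) X Y)) ?_
  rw [H.ricci_eq hC (hx t ht)]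
  ring

theorem isGeneric (hadm : C.IsAdmissible) {y₁ y₂ y₃ : ℝ} (hy₀ : 0 < y₁) (hy₁₂ : y₁ < y₂)
    (hy₂₃ : y₂ < y₃)
    (hEinstein : ∀ (g : InvariantMetric D) (x₁ x₂ : ℝ), g.IsDiagonal Q 𝔭₁ 𝔭₂ x₁ x₂ →
      (g.IsEinstein ↔ x₁ / x₂ = y₁ ∨ x₁ / x₂ = y₂ ∨ x₁ / x₂ = y₃)) :
    C.IsGeneric y₁ y₂ y₃ := by
  refine hadm.isGeneric hy₀ hy₁₂ hy₂₃ fun y hy => ?_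
  -- Each y > 0 is the ratio of a metric, with x₂ = 1, so the hypothesis on Einstein metrics
  -- describes all positive zeros of the gap.
  obtain ⟨g, hg⟩ := H.exists_diagonal hy one_pos
  have h1 := H.isEinstein_iff hC hg
  have h2 := hEinstein g y 1 hg
  rw [div_one] at h1 h2
  exact h1.symm.trans h2

theorem not_existsAncientHRF {g₀ : InvariantMetric D} {a₁ a₂ : ℝ}
    (hg₀ : g₀.IsDiagonal Q 𝔭₁ 𝔭₂ a₁ a₂)
    (hno : ∀ (T : ℝ) (z₁ z₂ : ℝ → ℝ), 0 < T → C.IsFlow (Iio T) z₁ z₂ → z₁ 0 = a₁ → z₂ 0 ≠ a₂) :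
    ¬ ExistsAncientHRF g₀ := by
  rintro ⟨T, g, hT, hg, h0⟩
  choose z₁ z₂ hz using fun t => H.exists_isDiagonal (g t)
  have hu := H.isDiagonal_unique hg₀ (h0 ▸ hz 0)
  exact hno T z₁ z₂ hT (H.isFlow_of_isHRF hC hg fun t _ => hz t) hu.1 hu.2

/-- ρ₂(r) > 0 makes the Ricci tensor, hence the curvature, nonzero. This is what forces |Rm| to blow
up as x₂ → 0. -/
theorem curvatureNorm_pos {Φ : ℝ → ℝ} (hΦ : ∀ (g : InvariantMetric D) (x₁ x₂ : ℝ),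
    g.IsDiagonal Q 𝔭₁ 𝔭₂ x₁ x₂ → g.normRm = Φ (x₁ / x₂) / x₂) {r : ℝ} (hr : 0 < r)
    (hr₂ : 0 < C.rho₂ r) : 0 < Φ r := by
  obtain ⟨g, hg⟩ := H.exists_diagonal hr one_pos
  have h1 := hΦ g r 1 hg
  rw [div_one, div_one] at h1
  rw [← h1]
  refine lt_of_le_of_ne g.normRm_nonneg fun h0 => ?_
  obtain ⟨Y, hY, hY0⟩ := H.exists_ne_zero₂
  have h2 := (hC g r 1 hg).2 Y Y hY hY
  rw [InvariantMetric.ricci_eq_zero_of_normRm_eq_zero h0.symm, div_one] at h2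
  exact (mul_pos hr₂ (Q.pos Y hY0)).ne h2

/-- |Rm| = Φ(y)/x₂ is unbounded, as Φ(r) > 0 and x₂ → 0. On the other hand (T - t)|Rm| = Φ(y)·(x₂/(T
- t))⁻¹ is continuous on [0, T) and converges at T. -/
theorem isTypeISingularity {I : Set ℝ} {T r : ℝ} {g : ℝ → InvariantMetric D} {x₁ x₂ : ℝ → ℝ}
    (hT : 0 < T) (hI : Ico 0 T ⊆ I) (hflow : C.IsFlow I x₁ x₂)
    (hx : ∀ t ∈ I, (g t).IsDiagonal Q 𝔭₁ 𝔭₂ (x₁ t) (x₂ t)) (hr : 0 < r) (hr₂ : 0 < C.rho₂ r)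
    (hratio : Tendsto (fun t => x₁ t / x₂ t) (𝓝[<] T) (𝓝 r))
    (hrate : ∃ c, 0 < c ∧ Tendsto (fun t => x₂ t / (T - t)) (𝓝[<] T) (𝓝 c))
    (hx₂ : Tendsto x₂ (𝓝[<] T) (𝓝 0)) : IsTypeISingularity g T := by
  obtain ⟨Φ, hΦc, hΦ⟩ := H.exists_normRm_eq
  obtain ⟨c, hc, hrate⟩ := hrate
  have hnorm : ∀ t ∈ Ico 0 T, (g t).normRm = Φ (x₁ t / x₂ t) / x₂ t := fun t ht =>
    hΦ _ _ _ (hx t (hI ht))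
  have hmem : ∀ᶠ t in 𝓝[<] T, t ∈ Ico 0 T := Ico_mem_nhdsLT hT
  have hΦr : Tendsto (fun t => Φ (x₁ t / x₂ t)) (𝓝[<] T) (𝓝 (Φ r)) :=
    (hΦc.continuousAt (Ioi_mem_nhds hr)).tendsto.comp hratio
  constructor
  · have hx₂' : Tendsto x₂ (𝓝[<] T) (𝓝[>] 0) := tendsto_nhdsWithin_iff.2
      ⟨hx₂, hmem.mono fun t ht => hflow.pos₂ t (hI ht)⟩
    have h1 : Tendsto (fun t => Φ (x₁ t / x₂ t) / x₂ t) (𝓝[<] T) atTop := by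
      simp only [div_eq_mul_inv (Φ _)]
      exact hΦr.pos_mul_atTop (H.curvatureNorm_pos hC hΦ hr hr₂)
        (tendsto_inv_nhdsGT_zero.comp hx₂')
    rintro ⟨M, hM⟩
    obtain ⟨t, ht, htM⟩ := (hmem.and (h1.eventually_gt_atTop M)).exists
    rw [← hnorm t ht] at htM
    exact htM.not_ge (hM ⟨t, ht, rfl⟩)
  · have h1 : Tendsto (fun t => Φ (x₁ t / x₂ t) * (x₂ t / (T - t))⁻¹) (𝓝[<] T)
        (𝓝 (Φ r * c⁻¹)) := hΦr.mul (hrate.inv₀ hc.ne')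
    have heq : ∀ t ∈ Ico 0 T, (T - t) * (g t).normRm =
        Φ (x₁ t / x₂ t) * (x₂ t / (T - t))⁻¹ := fun t ht => by
      rw [hnorm t ht, inv_div]
      ring
    rw [image_congr heq]
    refine bddAbove_image_Ico_of_tendsto hT ?_ h1
    have c₁ : ContinuousOn (fun t => x₁ t / x₂ t) (Ico 0 T) := fun t ht =>
      (hflow.hasDerivWithinAt_ratio (hI ht)).continuousWithinAt.mono hI
    have c₂ : ContinuousOn x₂ (Ico 0 T) := fun t ht =>
      (hflow.deriv₂ t (hI ht)).continuousWithinAt.mono hI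
    have hTt : ∀ t ∈ Ico 0 T, T - t ≠ 0 := fun t ht => (sub_pos.2 ht.2).ne'
    refine (hΦc.comp c₁ fun t ht => hflow.ratio_pos (hI ht)).mul (ContinuousOn.inv₀ (c₂.div
      (continuousOn_const.sub continuousOn_id) hTt) fun t ht => ?_)
    exact div_ne_zero (hflow.pos₂ t (hI ht)).ne' (hTt t ht)

/-- A solution of the flow equation for the coefficients, as a homogeneous Ricci flow. -/
theorem exists_flow {A I : Set ℝ} {T a₁ a₂ r : ℝ} {x₁ x₂ : ℝ → ℝ} (hIA : I ⊆ A)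
    (hI : Ico 0 T ⊆ I) (hS : C.IsShrinkingFlow A I T a₁ a₂ r x₁ x₂) (hr : 0 < r)
    (hr₂ : 0 < C.rho₂ r) {g₀ : InvariantMetric D} (hg₀ : g₀.IsDiagonal Q 𝔭₁ 𝔭₂ a₁ a₂) :
    ∃ g : ℝ → InvariantMetric D, (∀ t ∈ I, (g t).IsDiagonal Q 𝔭₁ 𝔭₂ (x₁ t) (x₂ t)) ∧
      IsUniqueMaximalHRF A I g₀ g ∧ IsTypeISingularity g T ∧ ShrinksToPoint g T ∧
      RatioTendsto Q 𝔭₁ 𝔭₂ I g (𝓝[<] T) r := by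
  have hex : ∀ t, ∃ g : InvariantMetric D, t ∈ I → g.IsDiagonal Q 𝔭₁ 𝔭₂ (x₁ t) (x₂ t) := by
    intro t
    by_cases ht : t ∈ I
    · obtain ⟨g, hg⟩ := H.exists_diagonal (hS.flow.pos₁ t ht) (hS.flow.pos₂ t ht)
      exact ⟨g, fun _ => hg⟩
    · exact ⟨Q, fun h => absurd h ht⟩
  choose g hg using hex
  have h0 : (0 : ℝ) ∈ I := hI ⟨le_rfl, hS.pos⟩
  have hx₂ : Tendsto x₂ (𝓝[<] T) (𝓝 0) := by
    obtain ⟨c, hc, hrate⟩ := hS.rate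
    have h1 : Tendsto (fun t => T - t) (𝓝[<] T) (𝓝 (T - T)) :=
      (tendsto_id.const_sub T).mono_left nhdsWithin_le_nhds
    have h2 := hrate.mul h1
    rw [sub_self, mul_zero] at h2
    refine h2.congr' ?_
    filter_upwards [self_mem_nhdsWithin] with t ht
    exact div_mul_cancel₀ _ (sub_pos.2 ht).ne'
  have hmem : ∀ᶠ t in 𝓝[<] T, t ∈ I := mem_of_superset (Ico_mem_nhdsLT hS.pos) hI
  have hx₁ : Tendsto x₁ (𝓝[<] T) (𝓝 0) := by
    have h2 := hS.ratio.mul hx₂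
    rw [mul_zero] at h2
    exact h2.congr' (hmem.mono fun t ht => div_mul_cancel₀ _ (hS.flow.pos₂ t ht).ne')
  refine ⟨g, hg, ⟨hIA, H.isHRF_of_isFlow hC hS.flow hg, ?_, ?_⟩,
    H.isTypeISingularity hC hS.pos hI hS.flow hg hr hr₂ hS.ratio hS.rate hx₂, ?_,
    x₁, x₂, hg, hS.ratio⟩
  · have := hg 0 h0
    rw [hS.init₁, hS.init₂] at this
    exact H.eq_of_isDiagonal this hg₀
  · intro J hJA hJ hJ0 h hh hh0
    -- A competing flow is diagonal at every time by Schur's lemma, so it too solves the planar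
    -- system.
    choose z₁ z₂ hz using fun t => H.exists_isDiagonal (h t)
    have hu := H.isDiagonal_unique hg₀ (hh0 ▸ hz 0)
    obtain ⟨k₁, k₂, k₃⟩ := hS.maximal J hJA hJ hJ0 z₁ z₂
      (H.isFlow_of_isHRF hC hh fun t _ => hz t) hu.1 hu.2
    refine ⟨k₁, fun t ht => H.eq_of_isDiagonal (hz t) ?_⟩
    rw [k₂ ht, k₃ ht]
    exact hg t (k₁ ht)
  · intro X Y
    have h1 := (hx₁.mul_const (Q.form (H.proj₁ X) (H.proj₁ Y))).add
      (hx₂.mul_const (Q.form (H.proj₂ X) (H.proj₂ Y)))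
    rw [zero_mul, zero_mul, add_zero] at h1
    exact h1.congr' (hmem.mono fun t ht => (H.form_eq (hg t ht) X Y).symm)

end IsTwoSummand

end HomogeneousFlow

end

/-! ### The four ranges of the initial ratio. -/

theorem mainTheorem8
    {E : Type*} [NormedAddCommGroup E] [NormedSpace ℝ E] [FiniteDimensional ℝ E]
    {F : Type*} [NormedAddCommGroup F] [NormedSpace ℝ F] [FiniteDimensional ℝ F]
    -- a compact Lie group `G`
    {G : Type*} [TopologicalSpace G] [T2Space G] [CompactSpace G] [ChartedSpace E G] [Group G]
    [LieGroup 𝓘(ℝ, E) ∞ G]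
    -- a closed Lie subgroup `K`; `G/K` is connected and effective, and `K` is maximal in `G`
    (K : Subgroup G) [ChartedSpace F K] [LieGroup 𝓘(ℝ, F) ∞ K]
    (hK : IsClosedLieSubgroup (E := E) (F := F) K)
    (hconn : ConnectedSpace (G ⧸ K))
    (heff : K.normalCore = ⊥)
    (hmax : IsMaximalIn K)
    -- the isotropy representation and its two inequivalent irreducible summands
    (D : IsotropyRep E F K) (𝔭₁ 𝔭₂ : Submodule ℝ (GroupLieAlgebra 𝓘(ℝ, E) G))
    (hsup : 𝔭₁ ⊔ 𝔭₂ = D.𝔭) (hdisj : Disjoint 𝔭₁ 𝔭₂)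
    (hirr₁ : IsAdIrreducible K 𝔭₁) (hirr₂ : IsAdIrreducible K 𝔭₂)
    (hineq : ¬ AdEquivalent K 𝔭₁ 𝔭₂)
    -- the background metric
    (Q : InvariantMetric D) (hQ₁ : Q.IsNegKillingOn 𝔭₁) (hQ₂ : Q.IsNegKillingOn 𝔭₂)
    -- there are exactly three invariant Einstein metrics up to scaling
    (y₁ y₂ y₃ : ℝ) (hy₀ : 0 < y₁) (hy₁₂ : y₁ < y₂) (hy₂₃ : y₂ < y₃)
    (hEinstein : ∀ (g : InvariantMetric D) (x₁ x₂ : ℝ), g.IsDiagonal Q 𝔭₁ 𝔭₂ x₁ x₂ →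
      (g.IsEinstein ↔ x₁ / x₂ = y₁ ∨ x₁ / x₂ = y₂ ∨ x₁ / x₂ = y₃))
    -- the initial metric
    (g₀ : InvariantMetric D) (a₁ a₂ : ℝ) (hg₀ : g₀.IsDiagonal Q 𝔭₁ 𝔭₂ a₁ a₂) :
    (a₁ / a₂ < y₁ →
      (∃ (T : ℝ) (g : ℝ → InvariantMetric D), 0 < T ∧
        IsUniqueMaximalHRF (Ici 0) (Ico 0 T) g₀ g ∧
        IsTypeISingularity g T ∧ ShrinksToPoint g T ∧
        RatioTendsto Q 𝔭₁ 𝔭₂ (Ico 0 T) g (𝓝[<] T) y₁) ∧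
      ¬ ExistsAncientHRF g₀) ∧
    (y₁ < a₁ / a₂ ∧ a₁ / a₂ < y₂ →
      ∃ (T : ℝ) (g : ℝ → InvariantMetric D), 0 < T ∧
        IsUniqueMaximalHRF univ (Iio T) g₀ g ∧ IsTypeIAncient g ∧
        IsTypeISingularity g T ∧ ShrinksToPoint g T ∧
        RatioTendsto Q 𝔭₁ 𝔭₂ (Iio T) g (𝓝[<] T) y₁ ∧
        RatioTendsto Q 𝔭₁ 𝔭₂ (Iio T) g atBot y₂) ∧
    (y₂ < a₁ / a₂ ∧ a₁ / a₂ < y₃ →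
      ∃ (T : ℝ) (g : ℝ → InvariantMetric D), 0 < T ∧
        IsUniqueMaximalHRF univ (Iio T) g₀ g ∧ IsTypeIAncient g ∧
        IsTypeISingularity g T ∧ ShrinksToPoint g T ∧
        RatioTendsto Q 𝔭₁ 𝔭₂ (Iio T) g (𝓝[<] T) y₃ ∧
        RatioTendsto Q 𝔭₁ 𝔭₂ (Iio T) g atBot y₂) ∧
    (y₃ < a₁ / a₂ →
      (∃ (T : ℝ) (g : ℝ → InvariantMetric D), 0 < T ∧
        IsUniqueMaximalHRF (Ici 0) (Ico 0 T) g₀ g ∧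
        IsTypeISingularity g T ∧ ShrinksToPoint g T ∧
        RatioTendsto Q 𝔭₁ 𝔭₂ (Ico 0 T) g (𝓝[<] T) y₃) ∧
      ¬ ExistsAncientHRF g₀) := by
  have H : IsTwoSummand Q 𝔭₁ 𝔭₂ := ⟨hsup, hdisj, hirr₁, hirr₂, hineq, hQ₁, hQ₂⟩
  obtain ⟨C, hadm, hC⟩ := H.exists_ricciCoeffs
  have h := H.isGeneric hC hadm hy₀ hy₁₂ hy₂₃ hEinstein
  have ha₁ := hg₀.1
  have ha₂ := hg₀.2.1
  refine ⟨fun hy => ?_, fun hy => ?_, fun hy => ?_, fun hy => ?_⟩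
  · obtain ⟨⟨T, x₁, x₂, hS⟩, hno⟩ := h.exists_flow_left ⟨div_pos ha₁ ha₂, hy⟩ ha₂
    obtain ⟨g, -, hg⟩ := H.exists_flow hC Ico_subset_Ici_self subset_rfl hS h.pos h.rho₂_pos₁ hg₀
    exact ⟨⟨T, g, hS.pos, hg⟩, H.not_existsAncientHRF hC hg₀ hno⟩
  · obtain ⟨T, x₁, x₂, hS, hA⟩ := h.exists_flow_right' hy ha₁
    obtain ⟨g, hd, hmax, hI, hshrink, hratio⟩ := H.exists_flow hC (subset_univ _)
      Ico_subset_Iio_self hS h.pos h.rho₂_pos₁ hg₀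
    exact ⟨T, g, hS.pos, hmax, H.isTypeIAncient hd h.pos₂ hA, hI, hshrink, hratio,
      x₁, x₂, hd, hA.ratio⟩
  · obtain ⟨T, x₁, x₂, hS, hA⟩ := h.exists_flow_right hy ha₂
    obtain ⟨g, hd, hmax, hI, hshrink, hratio⟩ := H.exists_flow hC (subset_univ _)
      Ico_subset_Iio_self hS h.pos₃ h.rho₂_pos₃ hg₀
    exact ⟨T, g, hS.pos, hmax, H.isTypeIAncient hd h.pos₂ hA, hI, hshrink, hratio,
      x₁, x₂, hd, hA.ratio⟩
  · obtain ⟨⟨T, x₁, x₂, hS⟩, hno⟩ := h.exists_flow_left' hy ha₁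
    obtain ⟨g, -, hg⟩ := H.exists_flow hC Ico_subset_Ici_self subset_rfl hS h.pos₃ h.rho₂_pos₃ hg₀
    exact ⟨⟨T, g, hS.pos, hg⟩, H.not_existsAncientHRF hC hg₀ hno⟩
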